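/- Let $F$ be a field of characteristic $0$, $D$ a central division algebra over $F$ with $\dim_F D=d^2<\infty$, let $p,q\ge 0$, $N=p+q$, let $G=GL_{N,D}$ be the algebraic group over $F$ with $G(F)=GL_N(D)$, and for $0\le p'\le N$ put $q'=N-p'$, $\theta_{p'}=\mathrm{diag}(I_{p'},-I_{q'})$. Let $\theta=\theta_p$, let $G^\theta=GL_{p,D}\times GL_{q,D}$ be its centralizer, $S=\{g\in G: (g\theta)^2=1\}$ and let $S_{p'}=\{g\theta_{p'}g^{-1}\theta: g\in G\}\subset S$; the group $G^\theta$ acts on $S$ and on $S_{p'}$ by conjugation. A point $x$ is called $G^\theta$-semisimple if its geometric orbit (over an algebraic closure $\bar F$) is Zariski closed, and $G^\theta$-regular (in $S_{p'}$) if the dimension of its centralizer in $G^\theta$ is minimal among the geometric points of $S_{p'}$. A matrix $A\in\mathfrak{gl}_m(D)$ is semisimple if it is diagonalizable over $\bar F$, and regular if its centralizer in $GL_{m,D}$ has minimal dimension among those of the geometric points of $\mathfrak{gl}_{m,D}$. For integers $m,r,t\ge0$ with $m+r\le p$, $m+t\le q$ and $A\in\mathfrak{gl}_m(D)$ let $$x(A,r,t)=\begin{pmatrix}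 A&0&0&A-I_m&0&0\\ 0&I_{p-m-r}&0&0&0&0\\ 0&0&-I_r&0&0&0\\ A+I_m&0&0&A&0&0\\ 0&0&0&0&I_{q-m-t}&0\\ 0&0&0&0&0&-I_t\end{pmatrix}.$$ Put $\nu=\min\{p,q,p',q'\}$ and, for $A\in\mathfrak{gl}_\nu(D)$, $x(A)=x(A,\max\{p-p',0\},\max\{p'-p,0\})$. For $x\in S_{p'}(F)$ let $x^+\in\mathfrak{gl}_p(D)$ be its upper left block, $\mathrm{Prd}_{x^+}\in F[T]$ the reduced characteristic polynomial of $x^+$ ($=1$ if $p=0$), and $$\chi_x=(T-1)^{-d\max\{p'-q,0\}}(T+1)^{-d\max\{p-p',0\}}\,\mathrm{Prd}_{x^+}.$$ **(I)** Let $0\le p'\le N$ and $x\in S_{p'}(F)$. Then $\chi_x$ is a polynomial in $F[T]$, and the following are equivalent: 1. $x$ is $G^\theta(F)$-conjugate to some $x(A)$ with $A\in\mathfrak{gl}_\nu(D)$ semisimple, regular and without eigenvalues $\pm1$; 2. $\chi_x$ is separable, $\chi_x(1)\neq0$ and $\chi_x(-1)\ne0$; 3. $x$ is $G^\theta$-semisimple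 and $G^\theta$-regular. **(II)** An element $x\in S(F)$ is $G^\theta$-semisimple if and only if it is $G^\theta(F)$-conjugate to $x(A,r,t)$ for some integers $m,r,t\ge0$ with $m+r\le p$, $m+t\le q$ and some semisimple $A\in\mathfrak{gl}_m(D)$ without eigenvalues $\pm1$. **(III)** The rule $(m,[A],r,t)\mapsto[x(A,r,t)]$ is a well-defined bijection from the set of quadruples in which $m,r,t\ge0$ are integers with $m+r\le p$, $m+t\le q$ and $[A]$ is the $GL_m(D)$-conjugacy class of a semisimple $A\in\mathfrak{gl}_m(D)$ without eigenvalues $\pm1$, onto the set of $G^\theta(F)$-conjugacy classes of $G^\theta$-semisimple elements of $S(F)$. Moreover, for $0\le p'\le N$, integers $m,r,t\ge0$ with $m+r\le p$, $m+t\le q$ and any $A\in\mathfrak{gl}_m(D)$, one has $x(A,r,t)\in S_{p'}(F)$ if and only if $t-r=p'-p$. -/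

import Mathlib

open Polynomial
open scoped TensorProduct Topology

noncomputable section

namespace GLInvolution

/-! ### Zariski topology, closed orbits, dimension of stabilizers -/

/-- The Zariski topology on a finite-dimensional vector space `W` over a field `K`: its basic open
sets are the non-vanishing loci of the polynomial functions on `W`, that is, of the polynomials in
the linear forms on `W`. -/
@[reducible]
def zariski (K W : Type*) [Field K] [AddCommGroup W] [Module K W] : TopologicalSpace W :=
  TopologicalSpace.generateFrom
    {U | ∃ f : MvPolynomial (Module.Dual K W) K,
      U = {w | MvPolynomial.eval (fun l => l w) f ≠ 0}}

/-- The topology induced by the Zariski topology on a subset of `W`. -/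
@[reducible]
def zariskiOn (K : Type*) {W : Type*} [Field K] [AddCommGroup W] [Module K W] (X : Set W) :
    TopologicalSpace X :=
  TopologicalSpace.induced Subtype.val (zariski K W)

/-- The orbit of `x` under conjugation by the group `H` of units. -/
def conjOrbit {A : Type*} [Monoid A] (H : Subgroup Aˣ) (x : A) : Set A :=
  {y | ∃ h ∈ H, y = (h : A) * x * ((h⁻¹ : Aˣ) : A)}

/-- The centralizer of `x` in the group `H` of units, as a subset of the ambient algebra. -/
def stabilizerIn {A : Type*} [Monoid A] (H : Subgroup Aˣ) (x : A) : Set A :=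
  {a | ∃ h ∈ H, (h : A) * x = x * (h : A) ∧ a = (h : A)}

/-- `K` is algebraically closed, `A` is a finite-dimensional `K`-algebra, and `H` is a group of
units of `A` acting by conjugation on `X ⊆ A`: the orbit of `x` is Zariski closed in `X`. -/
def HasClosedOrbit (K : Type*) {A : Type*} [Field K] [Ring A] [Algebra K A]
    (H : Subgroup Aˣ) (X : Set A) (x : A) : Prop :=
  IsClosed[zariskiOn K X] {y : X | (y : A) ∈ conjOrbit H x}

/-- The dimension of the centralizer of `x` in `H`: the Krull dimension of its Zariski topology. -/
def stabilizerDim (K : Type*) {A : Type*} [Field K] [Ring A] [Algebra K A]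
    (H : Subgroup Aˣ) (x : A) : WithBot ℕ∞ :=
  @topologicalKrullDim (stabilizerIn H x) (zariskiOn K (stabilizerIn H x))

/-- `x` is regular for the action of `H` on `X` by conjugation: the dimension of its centralizer
in `H` is minimal among all points of `X`. -/
def IsRegularPoint (K : Type*) {A : Type*} [Field K] [Ring A] [Algebra K A]
    (H : Subgroup Aˣ) (X : Set A) (x : A) : Prop :=
  ∀ y ∈ X, stabilizerDim K H x ≤ stabilizerDim K H y

/-! ### The group, the involution and the symmetric space, with coefficients in any ring `R`

Matrices are indexed by `Fin p ⊕ Fin q`, the basis `e_1, …, e_p, f_1, …, f_q`. -/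

/-- The diagonal matrix `θ_{p'}` with `p'` entries `1` followed by `p + q - p'` entries `-1`. -/
def thetaMat (R : Type*) [Ring R] (p q p' : ℕ) : Matrix (Fin p ⊕ Fin q) (Fin p ⊕ Fin q) R :=
  Matrix.diagonal fun i => if (finSumFinEquiv i : ℕ) < p' then 1 else -1

/-- `G^θ`: the invertible matrices commuting with `θ = θ_p`. -/
def fixedGroup (R : Type*) [Ring R] (p q : ℕ) :
    Subgroup (Matrix (Fin p ⊕ Fin q) (Fin p ⊕ Fin q) R)ˣ :=
  (Submonoid.centralizer {thetaMat R p q p}).units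

/-- `S`: the matrices `x` with `(x θ)² = 1` (such an `x` is invertible). -/
def symSpace (R : Type*) [Ring R] (p q : ℕ) : Set (Matrix (Fin p ⊕ Fin q) (Fin p ⊕ Fin q) R) :=
  {x | (x * thetaMat R p q p) ^ 2 = 1}

/-- `S_{p'}`: the matrices `g θ_{p'} g⁻¹ θ` with `g` invertible. -/
def symComponent (R : Type*) [Ring R] (p q p' : ℕ) :
    Set (Matrix (Fin p ⊕ Fin q) (Fin p ⊕ Fin q) R) :=
  {x | ∃ g : (Matrix (Fin p ⊕ Fin q) (Fin p ⊕ Fin q) R)ˣ,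
    x = (g : Matrix (Fin p ⊕ Fin q) (Fin p ⊕ Fin q) R) * thetaMat R p q p' *
      ((g⁻¹ : (Matrix (Fin p ⊕ Fin q) (Fin p ⊕ Fin q) R)ˣ) :
        Matrix (Fin p ⊕ Fin q) (Fin p ⊕ Fin q) R) * thetaMat R p q p}

/-- The matrix `A` placed in the upper left corner of a zero matrix of size `a × b`. -/
def corner {R : Type*} [Ring R] {m : ℕ} (a b : ℕ) (A : Matrix (Fin m) (Fin m) R) :
    Matrix (Fin a) (Fin b) R :=
  Matrix.of fun i j => if h : (i : ℕ) < m ∧ (j : ℕ) < m then A ⟨i, h.1⟩ ⟨j, h.2⟩ else 0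

/-- The block diagonal matrix `diag(A, I_{a-m-r}, -I_r)` of size `a`, for `m + r ≤ a`. -/
def diagBlock {R : Type*} [Ring R] {m : ℕ} (a r : ℕ) (A : Matrix (Fin m) (Fin m) R) :
    Matrix (Fin a) (Fin a) R :=
  corner a a A + Matrix.diagonal fun (i : Fin a) =>
    if (i : ℕ) < m then 0 else if (i : ℕ) + r < a then 1 else -1

/-- The matrix `x(A, r, t)`, for `m + r ≤ p` and `m + t ≤ q`. -/
def xMat {R : Type*} [Ring R] (p q : ℕ) {m : ℕ} (A : Matrix (Fin m) (Fin m) R) (r t : ℕ) :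
    Matrix (Fin p ⊕ Fin q) (Fin p ⊕ Fin q) R :=
  Matrix.fromBlocks (diagBlock p r A) (corner p q (A - 1)) (corner q p (A + 1)) (diagBlock q t A)

/-- `A` has no eigenvalue `1` and no eigenvalue `-1`. -/
def NoEigenvalueOne {R : Type*} [Ring R] {m : ℕ} (A : Matrix (Fin m) (Fin m) R) : Prop :=
  ∀ v : Fin m → R, A.mulVec v = v ∨ A.mulVec v = -v → v = 0

/-- The integer `ν = min(p, q, p', q')`, where `q' = p + q - p'`. -/
def nu (p q p' : ℕ) : ℕ := min (min p q) (min p' (p + q - p'))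

/-- The matrix `x(A)` attached to `A` of size `ν` (the subtractions are truncated). -/
def xReg {R : Type*} [Ring R] (p q p' : ℕ) (A : Matrix (Fin (nu p q p')) (Fin (nu p q p')) R) :
    Matrix (Fin p ⊕ Fin q) (Fin p ⊕ Fin q) R :=
  xMat p q A (p - p') (p' - p)

/-! ### Matrices over a central division algebra `D` over `F` -/

/-- The geometric point defined by a matrix over `D`. -/
def geomPoint (F : Type*) [Field F] {D : Type*} [DivisionRing D] [Algebra F D] {n : Type*}
    (x : Matrix n n D) : Matrix n n (AlgebraicClosure F ⊗[F] D) :=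
  x.map (Algebra.TensorProduct.includeRight : D →ₐ[F] AlgebraicClosure F ⊗[F] D)

/-- `P` is the reduced characteristic polynomial of the matrix `x` over the central division
algebra `D` of degree `d` over `F`: over an algebraic closure of `F` it becomes the usual
characteristic polynomial, through an identification of `D` with an algebra of `d × d` matrices. -/
def IsReducedCharpoly (F : Type*) [Field F] {D : Type*} [DivisionRing D] [Algebra F D] (d : ℕ)
    {n : Type*} [Fintype n] [DecidableEq n] (x : Matrix n n D) (P : F[X]) : Prop :=
  ∃ ψ : (AlgebraicClosure F ⊗[F] D) ≃ₐ[AlgebraicClosure F]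
      Matrix (Fin d) (Fin d) (AlgebraicClosure F),
    P.map (algebraMap F (AlgebraicClosure F)) =
      (Matrix.comp n n (Fin d) (Fin d) (AlgebraicClosure F) ((geomPoint F x).map ψ)).charpoly

open Classical in
/-- The reduced characteristic polynomial `Prd_x`. -/
def reducedCharpoly (F : Type*) [Field F] {D : Type*} [DivisionRing D] [Algebra F D] (d : ℕ)
    {n : Type*} [Fintype n] [DecidableEq n] (x : Matrix n n D) : F[X] :=
  if h : ∃ P : F[X], IsReducedCharpoly F d x P then h.choose else 0

/-- The polynomial `(t - 1)^{d max(p' - q, 0)} (t + 1)^{d max(p - p', 0)}`. -/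
def chiDenominator (F : Type*) [Field F] (d p q p' : ℕ) : F[X] :=
  (X - 1) ^ (d * (p' - q)) * (X + 1) ^ (d * (p - p'))

/-- The polynomial `χ_x`: the quotient of `Prd_{x⁺}` by the previous polynomial, where `x⁺` is the
upper left block of `x`. -/
def chi (F : Type*) [Field F] {D : Type*} [DivisionRing D] [Algebra F D] (d : ℕ) {p q : ℕ} (p' : ℕ)
    (x : Matrix (Fin p ⊕ Fin q) (Fin p ⊕ Fin q) D) : F[X] :=
  reducedCharpoly F d x.toBlocks₁₁ /ₘ chiDenominator F d p q p'

/-- `A ∈ gl_m(D)` is semisimple in the usual sense: it is diagonalizable over an algebraic closure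
of `F`, that is, its minimal polynomial over `F` is separable. -/
def IsSemisimpleMat (F : Type*) [Field F] {D : Type*} [DivisionRing D] [Algebra F D] {m : ℕ}
    (A : Matrix (Fin m) (Fin m) D) : Prop :=
  (minpoly F A).Separable

/-- `A ∈ gl_m(D)` is regular: the dimension of its centralizer in `GL_{m,D}` is minimal among the
geometric points of `gl_{m,D}`. -/
def IsRegularMat (F : Type*) [Field F] {D : Type*} [DivisionRing D] [Algebra F D] {m : ℕ}
    (A : Matrix (Fin m) (Fin m) D) : Prop :=
  IsRegularPoint (AlgebraicClosure F) ⊤ Set.univ (geomPoint F A)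

/-- `x` is `G^θ`-semisimple as a point of `S`. -/
def IsThetaSemisimple (F : Type*) [Field F] {D : Type*} [DivisionRing D] [Algebra F D] {p q : ℕ}
    (x : Matrix (Fin p ⊕ Fin q) (Fin p ⊕ Fin q) D) : Prop :=
  HasClosedOrbit (AlgebraicClosure F) (fixedGroup (AlgebraicClosure F ⊗[F] D) p q)
    (symSpace (AlgebraicClosure F ⊗[F] D) p q) (geomPoint F x)

/-- `x` is `G^θ`-semisimple as a point of the component `S_{p'}`. -/
def IsThetaSemisimpleIn (F : Type*) [Field F] {D : Type*} [DivisionRing D] [Algebra F D] {p q : ℕ}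
    (p' : ℕ) (x : Matrix (Fin p ⊕ Fin q) (Fin p ⊕ Fin q) D) : Prop :=
  HasClosedOrbit (AlgebraicClosure F) (fixedGroup (AlgebraicClosure F ⊗[F] D) p q)
    (symComponent (AlgebraicClosure F ⊗[F] D) p q p') (geomPoint F x)

/-- `x` is `G^θ`-regular as a point of the component `S_{p'}`. -/
def IsThetaRegularIn (F : Type*) [Field F] {D : Type*} [DivisionRing D] [Algebra F D] {p q : ℕ}
    (p' : ℕ) (x : Matrix (Fin p ⊕ Fin q) (Fin p ⊕ Fin q) D) : Prop :=
  IsRegularPoint (AlgebraicClosure F) (fixedGroup (AlgebraicClosure F ⊗[F] D) p q)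
    (symComponent (AlgebraicClosure F ⊗[F] D) p q p') (geomPoint F x)

/-- The `G^θ(F)`-conjugacy classes of `G^θ`-semisimple elements of `S(F)`. -/
def semisimpleClasses (F : Type*) [Field F] (D : Type*) [DivisionRing D] [Algebra F D] (p q : ℕ) :
    Set (Set (Matrix (Fin p ⊕ Fin q) (Fin p ⊕ Fin q) D)) :=
  {c | ∃ x ∈ symSpace D p q, IsThetaSemisimple F x ∧ c = conjOrbit (fixedGroup D p q) x}

/-- The quadruples `(m, [A], r, t)`, where `m + r ≤ p`, `m + t ≤ q`, and `[A]` is the conjugacy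
class of a semisimple `A ∈ gl_m(D)` without eigenvalues `±1`. -/
def quadruples (F : Type*) [Field F] (D : Type*) [DivisionRing D] [Algebra F D] (p q : ℕ) :
    Set (Σ m : ℕ, Set (Matrix (Fin m) (Fin m) D) × ℕ × ℕ) :=
  {z | z.1 + z.2.2.1 ≤ p ∧ z.1 + z.2.2.2 ≤ q ∧
    ∃ A : Matrix (Fin z.1) (Fin z.1) D,
      IsSemisimpleMat F A ∧ NoEigenvalueOne A ∧ z.2.1 = conjOrbit ⊤ A}

end GLInvolution

end

open GLInvolution

/-! Write x in blocks (a b; c e). Membership in S means a² - bc = 1, e² - cb = 1, ab = be, ca = ec;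
moreover x² - 1 = 2Nx, where N is the off-diagonal part of x and commutes with x.

Everything rests on one fact of linear algebra (`exists_normalForm`, `exists_normalForm_of_forall`):
if z = x² - 1 and z² have the same left kernel, then x is conjugate to some x(A, r, t) with A² - 1
invertible. Indeed a and e are then conjugate to diag(A, 1, -1) and diag(A', 1, -1); b and c
intertwine them and vanish on the parts with eigenvalue ±1; on the remaining part bc = A² - 1, so c
identifies A with A', and a change of basis turns b and c into A - 1 and A + 1. This works over D
itself. The diagonal blocks recover the parameters (`xMat_conj`), and the trace of xθ recovers the
component (`mem_symComponent_iff`).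

The geometric conditions are studied over the algebraic closure, where D becomes M_d and all sizes
are multiplied by d.

Closed orbits. Degenerating a point along a one-parameter subgroup of G^θ
(`exists_eq_of_hasClosedOrbit`) shows that a closed orbit forces z = z²w for suitable z. For z = x²
- 1 this gives a normal form, and the kernel condition descends to D by injectivity. For z a
polynomial in x + θxθ = 2 diag(a, e) it gives the semisimplicity of A. Conversely, the orbit of x(A,
r, t) with A semisimple is cut out by explicit polynomial equations (`hasClosedOrbit_xMat`).

Regularity. Put α = p - m - r and δ = q - m - t. The stabilizer of x(A, r, t) has dimension dim Z(A)
+ α² + δ² + r² + t². On S_{p'} the differences α - δ and t - r are fixed, so up to a constant this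
is dim Z(A) + 2(αδ + rt). Since dim Z(A) ≥ m and ν = m + min(α, δ) + min(r, t), the minimum is ν,
reached exactly when m = ν, rt = 0 and A is regular. Points without a normal form obey the same
lower bound by semicontinuity along a line (`le_stabRank`).

The polynomial χ. The ranks of x ± θ bound from below the multiplicities of ±1 as roots of the
characteristic polynomial of a. If these bounds are attained, Sylvester's inequality makes the rank
of (bc)² maximal, which again yields a normal form (`exists_mul_self_sub_one_eq`). Then χ_x is the
reduced characteristic polynomial of A, and its separability says that A is semisimple and regular.
-/

namespace GLInvolution

/-! ### Polynomial functions and the Zariski topology -/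

section PolynomialFunctions

variable {K W : Type*} [Field K] [AddCommGroup W] [Module K W]

/-- `φ` is a polynomial function on the vector space `W`. -/
def IsPolyFun (K : Type*) {W : Type*} [Field K] [AddCommGroup W] [Module K W] (φ : W → K) : Prop :=
  ∃ f : MvPolynomial (Module.Dual K W) K, ∀ w, φ w = MvPolynomial.eval (fun l => l w) f

namespace IsPolyFun

theorem const (c : K) : IsPolyFun K (fun _ : W => c) := ⟨MvPolynomial.C c, by simp⟩

theorem linear (l : W →ₗ[K] K) : IsPolyFun K (fun w => l w) := ⟨MvPolynomial.X l, by simp⟩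

theorem add {φ φ' : W → K} (h : IsPolyFun K φ) (h' : IsPolyFun K φ') :
    IsPolyFun K (fun w => φ w + φ' w) := by
  obtain ⟨f, hf⟩ := h
  obtain ⟨f', hf'⟩ := h'
  exact ⟨f + f', fun w => by simp [hf, hf']⟩

theorem mul {φ φ' : W → K} (h : IsPolyFun K φ) (h' : IsPolyFun K φ') :
    IsPolyFun K (fun w => φ w * φ' w) := by
  obtain ⟨f, hf⟩ := h
  obtain ⟨f', hf'⟩ := h'
  exact ⟨f * f', fun w => by simp [hf, hf']⟩

theorem sub {φ φ' : W → K} (h : IsPolyFun K φ) (h' : IsPolyFun K φ') :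
    IsPolyFun K (fun w => φ w - φ' w) := by
  obtain ⟨f, hf⟩ := h
  obtain ⟨f', hf'⟩ := h'
  exact ⟨f - f', fun w => by simp [hf, hf']⟩

theorem sum {ι : Type*} (s : Finset ι) {φ : ι → W → K} (h : ∀ i, IsPolyFun K (φ i)) :
    IsPolyFun K (fun w => ∑ i ∈ s, φ i w) := by
  choose f hf using h
  exact ⟨∑ i ∈ s, f i, fun w => by simp [hf, map_sum]⟩

theorem comp_linear {W' : Type*} [AddCommGroup W'] [Module K W'] {φ : W → K} (h : IsPolyFun K φ)
    (L : W' →ₗ[K] W) : IsPolyFun K (fun w => φ (L w)) := by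
  obtain ⟨f, hf⟩ := h
  refine ⟨MvPolynomial.rename (fun l => l ∘ₗ L) f, fun w => ?_⟩
  simp only [hf]
  rw [MvPolynomial.eval_rename]
  rfl

/-- The restriction of a polynomial function to a line is a polynomial in one variable. -/
theorem exists_line {φ : W → K} (h : IsPolyFun K φ) (w v : W) :
    ∃ f : K[X], ∀ s : K, f.eval s = φ (w + s • v) := by
  obtain ⟨f, hf⟩ := h
  refine ⟨MvPolynomial.aeval (fun l => C (l w) + X * C (l v)) f, fun s => ?_⟩
  rw [hf]
  clear hf
  induction f using MvPolynomial.induction_on with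
  | C a => simp
  | add f g hf hg => simp only [map_add, eval_add, hf, hg]
  | mul_X f l hf => simp only [map_mul, eval_mul, hf]; simp [mul_comm s]

/-- Lift the entries to polynomials: forming the characteristic polynomial commutes with evaluation.
-/
theorem charpoly_coeff {n : Type*} [Fintype n] [DecidableEq n] {M : W → Matrix n n K}
    (h : ∀ i j, IsPolyFun K (fun w => M w i j)) (k : ℕ) :
    IsPolyFun K (fun w => (M w).charpoly.coeff k) := by
  choose f hf using h
  refine ⟨(Matrix.of f).charpoly.coeff k, fun w => ?_⟩
  have hM : M w = (Matrix.of f).map (MvPolynomial.eval (fun l => l w)) :=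
    Matrix.ext fun i j => hf i j w
  rw [← Polynomial.coeff_map, ← Matrix.charpoly_map, ← hM]

theorem det {n : Type*} [Fintype n] [DecidableEq n] {M : W → Matrix n n K}
    (h : ∀ i j, IsPolyFun K (fun w => M w i j)) : IsPolyFun K (fun w => (M w).det) := by
  choose f hf using h
  refine ⟨(Matrix.of f).det, fun w => ?_⟩
  have hM : M w = (Matrix.of f).map (MvPolynomial.eval (fun l => l w)) :=
    Matrix.ext fun i j => hf i j w
  rw [RingHom.map_det]
  exact congrArg Matrix.det hM

end IsPolyFun

/-- `M` is a matrix-valued polynomial map on `W`. -/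
def IsPolyMap (K : Type*) {W m n : Type*} [Field K] [AddCommGroup W] [Module K W]
    (M : W → Matrix m n K) : Prop :=
  ∀ i j, IsPolyFun K (fun w => M w i j)

namespace IsPolyMap

variable {l m n : Type*}

theorem const (A : Matrix m n K) : IsPolyMap K (fun _ : W => A) := fun _ _ => .const _

theorem linear (L : W →ₗ[K] Matrix m n K) : IsPolyMap K (fun w => L w) := fun i j =>
  .linear (Matrix.entryLinearMap K K i j ∘ₗ L)

theorem add {A B : W → Matrix m n K} (hA : IsPolyMap K A) (hB : IsPolyMap K B) :
    IsPolyMap K (fun w => A w + B w) := fun i j => (hA i j).add (hB i j)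

theorem sub {A B : W → Matrix m n K} (hA : IsPolyMap K A) (hB : IsPolyMap K B) :
    IsPolyMap K (fun w => A w - B w) := fun i j => (hA i j).sub (hB i j)

theorem mul [Fintype m] {A : W → Matrix l m K} {B : W → Matrix m n K} (hA : IsPolyMap K A)
    (hB : IsPolyMap K B) : IsPolyMap K (fun w => A w * B w) := fun i j => by
  simp only [Matrix.mul_apply]
  exact .sum _ fun k => (hA i k).mul (hB k j)

theorem smul {A : W → Matrix m n K} {φ : W → K} (hφ : IsPolyFun K φ) (hA : IsPolyMap K A) :
    IsPolyMap K (fun w => φ w • A w) := fun i j => hφ.mul (hA i j)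

theorem aeval [Fintype n] [DecidableEq n] {A : W → Matrix n n K} (hA : IsPolyMap K A) (g : K[X]) :
    IsPolyMap K (fun w => Polynomial.aeval (A w) g) := by
  induction g using Polynomial.induction_on' with
  | add f g hf hg =>
    simp only [map_add]
    exact hf.add hg
  | monomial k c =>
    have : ∀ k : ℕ, IsPolyMap K (fun w => A w ^ k) := fun k => by
      induction k with
      | zero => simpa using const (1 : Matrix n n K)
      | succ k ih => simpa only [pow_succ] using ih.mul hA
    simp only [Polynomial.aeval_monomial, Algebra.algebraMap_eq_smul_one, smul_mul_assoc, one_mul]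
    exact smul (.const c) (this k)

end IsPolyMap

/-! ### The Zariski topology -/

/-- The non-vanishing loci are stable under intersection, since polynomials can be multiplied; so
the defining subbasis is a basis. -/
theorem isTopologicalBasis_zariski (K W : Type*) [Field K] [AddCommGroup W] [Module K W] :
    @TopologicalSpace.IsTopologicalBasis W (zariski K W)
      {U | ∃ φ, IsPolyFun K φ ∧ U = {w | φ w ≠ 0}} := by
  let := zariski K W
  have := TopologicalSpace.isTopologicalBasis_of_subbasis_of_inter
    (r := {U | ∃ f : MvPolynomial (Module.Dual K W) K,
      U = {w | MvPolynomial.eval (fun l => l w) f ≠ 0}}) (t := zariski K W) rfl (by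
    rintro _ ⟨f, rfl⟩ _ ⟨g, rfl⟩
    refine ⟨f * g, ?_⟩
    ext w
    simp)
  convert! this using 1
  ext U
  constructor
  · rintro ⟨φ, ⟨f, hf⟩, rfl⟩
    exact Or.inr ⟨f, by simp [hf]⟩
  · rintro (rfl | ⟨f, rfl⟩)
    · exact ⟨_, IsPolyFun.const 1, by simp⟩
    · exact ⟨_, ⟨f, fun _ => rfl⟩, rfl⟩

theorem isClosed_zeroSet {φ : W → K} (hφ : IsPolyFun K φ) : IsClosed[zariski K W] {w | φ w = 0} := by
  let := zariski K W
  rw [← isOpen_compl_iff]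
  exact (isTopologicalBasis_zariski K W).isOpen ⟨φ, hφ, by ext; simp⟩

theorem isClosed_zeroSet_on (X : Set W) {φ : W → K} (hφ : IsPolyFun K φ) :
    IsClosed[zariskiOn K X] {w : X | φ w = 0} := by
  let := zariski K W
  exact (isClosed_zeroSet hφ).preimage continuous_subtype_val

/-- A point where all polynomial functions vanishing on a closed set vanish is in this set. -/
theorem mem_of_forall_isPolyFun {X : Set W} {Z : Set X} (hZ : IsClosed[zariskiOn K X] Z) (w : X)
    (h : ∀ φ : W → K, IsPolyFun K φ → (∀ z ∈ Z, φ z = 0) → φ w = 0) : w ∈ Z := by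
  let := zariski K W
  by_contra hw
  obtain ⟨U, hU, hUZ⟩ := isOpen_induced_iff.mp hZ.isOpen_compl
  have hwU : (w : W) ∈ U := by
    have : w ∈ Subtype.val ⁻¹' U := by rw [hUZ]; exact hw
    exact this
  obtain ⟨_, ⟨φ, hφ, rfl⟩, hw', hs⟩ :=
    (isTopologicalBasis_zariski K W).exists_subset_of_mem_open hwU hU
  refine hw' (h φ hφ fun z hz => ?_)
  by_contra hne
  have h1 : z ∈ Subtype.val ⁻¹' U := hs hne
  rw [hUZ] at h1
  exact h1 hz

end PolynomialFunctions

/-! ### Krull dimension of open subsets of linear subspaces -/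

section KrullDimension

variable {K W : Type*} [Field K] [Infinite K] [AddCommGroup W] [Module K W]

theorem exists_eval_ne_zero {f : K[X]} (hf : f ≠ 0) : ∃ s, f.eval s ≠ 0 := by
  by_contra! h
  exact hf (Polynomial.funext (by simpa using h))

/-- The non-vanishing locus in an affine subspace of a polynomial function is irreducible. -/
theorem isPreirreducible_affine (S : Submodule K W) (w₀ : W) {g : W → K} (hg : IsPolyFun K g)
    (E : Set W) (hE : ∀ w, w - w₀ ∈ S → g w ≠ 0 → w ∈ E) (hE' : ∀ w ∈ E, g w ≠ 0) :
    @IsPreirreducible E (zariskiOn K E) {w | (w : W) - w₀ ∈ S} := by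
  let := zariski K W
  rintro U V hU hV ⟨u, hu, huU⟩ ⟨v, hv, hvV⟩
  obtain ⟨U, hU', rfl⟩ := isOpen_induced_iff.mp hU
  obtain ⟨V, hV', rfl⟩ := isOpen_induced_iff.mp hV
  obtain ⟨_, ⟨φ, hφ, rfl⟩, hu', hs⟩ :=
    (isTopologicalBasis_zariski K W).exists_subset_of_mem_open huU hU'
  obtain ⟨_, ⟨φ', hφ', rfl⟩, hv', hs'⟩ :=
    (isTopologicalBasis_zariski K W).exists_subset_of_mem_open hvV hV'
  -- Two nonempty open sets already meet on the line joining a point of one to a point of the other: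
  -- each of the three conditions excludes only the zeros of a nonzero polynomial in the parameter.
  obtain ⟨f, hf⟩ := hφ.exists_line u.1 (v.1 - u.1)
  obtain ⟨f', hf'⟩ := hφ'.exists_line u.1 (v.1 - u.1)
  obtain ⟨f'', hf''⟩ := hg.exists_line u.1 (v.1 - u.1)
  have h0 : f ≠ 0 := by
    rintro rfl
    exact hu' (by simpa using (hf 0).symm)
  have h1 : f' ≠ 0 := by
    rintro rfl
    exact hv' (by simpa using (hf' 1).symm)
  have h2 : f'' ≠ 0 := by
    rintro rfl
    exact hE' u.1 u.2 (by simpa using (hf'' 0).symm)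
  obtain ⟨s, hs0⟩ := exists_eval_ne_zero (mul_ne_zero (mul_ne_zero h0 h1) h2)
  simp only [eval_mul, mul_ne_zero_iff, hf, hf', hf''] at hs0
  have hmem : u.1 + s • (v.1 - u.1) - w₀ ∈ S := by
    have : u.1 + s • (v.1 - u.1) - w₀ = (u.1 - w₀) + s • ((v.1 - w₀) - (u.1 - w₀)) := by
      simp only [sub_sub_sub_cancel_right]; abel
    rw [this]
    exact S.add_mem hu (S.smul_mem _ (S.sub_mem hv hu))
  exact ⟨⟨_, hE _ hmem hs0.2⟩, hmem, hs hs0.1.1, hs' hs0.1.2⟩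

omit [Infinite K] in
theorem isClosed_affine (S : Submodule K W) (w₀ : W) (E : Set W) :
    IsClosed[zariskiOn K E] {w | (w : W) - w₀ ∈ S} := by
  let := zariski K W
  have : {w : E | (w : W) - w₀ ∈ S} =
      ⋂ l : {l : Module.Dual K W // S ≤ LinearMap.ker l}, {w : E | l.1 w - l.1 w₀ = 0} := by
    ext w
    simp only [Set.mem_ofPred_eq, Set.mem_iInter]
    constructor
    · intro h l
      simpa using l.2 h
    · intro h
      by_contra hw
      obtain ⟨l, hl, hl'⟩ := Submodule.exists_le_ker_of_notMem hw
      exact hl (by simpa using h ⟨l, hl'⟩)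
  rw [this]
  exact isClosed_iInter fun l => isClosed_zeroSet_on E ((IsPolyFun.linear l.1).sub (.const _))

/-- A full flag of `S`, translated to a point of `E` and intersected with `E`, is a chain of
irreducible closed sets of the required length. -/
theorem le_krullDim_affine [FiniteDimensional K W] (S : Submodule K W) {g : W → K}
    (hg : IsPolyFun K g) (E : Set W) (hE : E = {w | w ∈ S ∧ g w ≠ 0}) (hne : E.Nonempty) :
    (Module.finrank K S : WithBot ℕ∞) ≤ @topologicalKrullDim E (zariskiOn K E) := by
  let := zariski K W
  obtain ⟨w₀, hw₀⟩ := hne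
  have hw₀' := hw₀
  rw [hE] at hw₀'
  let b := Module.finBasis K S
  let T : ℕ → Submodule K W := fun k => Submodule.span K ((fun i => (b i : W)) '' {i | i.1 < k})
  have hTS : ∀ k, T k ≤ S := fun k => Submodule.span_le.2 (by rintro _ ⟨i, -, rfl⟩; exact (b i).2)
  have hind : LinearIndependent K (fun i => (b i : W)) :=
    b.linearIndependent.map' S.subtype S.ker_subtype
  let Z : Fin (Module.finrank K S + 1) → TopologicalSpace.IrreducibleCloseds E := fun k =>
    { carrier := {w | (w : W) - w₀ ∈ T k}
      isIrreducible' := ⟨⟨⟨w₀, hw₀⟩, by simp⟩, isPreirreducible_affine _ _ hg E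
        (fun w hw hgw => by
          rw [hE]
          refine ⟨?_, hgw⟩
          simpa using S.add_mem (hTS _ hw) hw₀'.1)
        (fun w hw => by rw [hE] at hw; exact hw.2)⟩
      isClosed' := isClosed_affine _ _ _ }
  have hZ : StrictMono Z := by
    rw [Fin.strictMono_iff_lt_succ]
    intro i
    have hle : T i.castSucc ≤ T i.succ := Submodule.span_mono (Set.image_mono fun j hj => by
      simp only [Set.mem_ofPred_eq, Fin.val_castSucc, Fin.val_succ] at hj ⊢; omega)
    refine lt_of_le_of_ne (fun w hw => hle hw) fun heq => ?_
    -- Strictness is witnessed by a point `w₀ + s • b i` of `E` with `s ≠ 0`.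
    obtain ⟨f, hf⟩ := hg.exists_line w₀ (b i)
    have h0 : f ≠ 0 := by
      rintro rfl
      exact hw₀'.2 (by simpa using (hf 0).symm)
    obtain ⟨s, hs⟩ := exists_eval_ne_zero (mul_ne_zero h0 X_ne_zero)
    simp only [eval_mul, eval_X, mul_ne_zero_iff, hf] at hs
    have hE' : w₀ + s • (b i : W) ∈ E := by
      rw [hE]
      exact ⟨S.add_mem hw₀'.1 (S.smul_mem _ (b i).2), hs.1⟩
    have hmem : (⟨_, hE'⟩ : E) ∈ Z i.succ := by
      change w₀ + s • (b i : W) - w₀ ∈ T i.succ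
      rw [add_sub_cancel_left]
      exact Submodule.smul_mem _ _ (Submodule.subset_span ⟨i, by simp, rfl⟩)
    rw [← heq] at hmem
    change w₀ + s • (b i : W) - w₀ ∈ T i.castSucc at hmem
    rw [add_sub_cancel_left, Submodule.smul_mem_iff _ hs.2] at hmem
    exact hind.notMem_span_image (s := {j | j.1 < i.castSucc.1}) (by simp) hmem
  exact Order.LTSeries.length_le_krullDim (LTSeries.mk _ Z hZ)

omit [Infinite K] in
-- Coordinates on `S` turn polynomial functions on `E` into polynomials in `finrank K S` variables.
-- Sending an irreducible closed set to its vanishing ideal is then strictly order-reversing into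
-- the primes of a polynomial ring of known dimension.
theorem krullDim_affine_le [FiniteDimensional K W] (S : Submodule K W) (E : Set W)
    (hE : E ⊆ S) :
    @topologicalKrullDim E (zariskiOn K E) ≤ Module.finrank K S := by
  let := zariski K W
  let b := Module.finBasis K S
  let c : E → Fin (Module.finrank K S) → K := fun w => b.repr ⟨w, hE w.2⟩
  have hcpoly : ∀ φ : W → K, IsPolyFun K φ →
      ∃ f : MvPolynomial (Fin (Module.finrank K S)) K, ∀ w : E, φ w = MvPolynomial.eval (c w) f := by
    rintro φ ⟨f, hf⟩
    refine ⟨MvPolynomial.aeval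
      (fun l : Module.Dual K W => ∑ i, MvPolynomial.C (l (b i)) * MvPolynomial.X i) f, fun w => ?_⟩
    have hw : (w : W) = ∑ i, c w i • (b i : W) := by
      have := congrArg S.subtype (b.sum_repr ⟨w, hE w.2⟩)
      rw [map_sum] at this
      exact this.symm
    have hl : ∀ l : Module.Dual K W, l w = ∑ i, l (b i) * c w i := fun l => by
      rw [hw, map_sum]
      simp [mul_comm]
    rw [hf]
    clear hf
    induction f using MvPolynomial.induction_on with
    | C a => simp
    | add f g hf hg => simp only [map_add, hf, hg]
    | mul_X f l hf => simp only [map_mul, hf]; simp [hl l]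
  have hpoly : ∀ f : MvPolynomial (Fin (Module.finrank K S)) K, ∃ φ : W → K, IsPolyFun K φ ∧
      ∀ w : E, φ w = MvPolynomial.eval (c w) f := by
    intro f
    choose l hl using fun i => LinearMap.exists_extend (b.coord i)
    refine ⟨fun w => MvPolynomial.eval (fun i => l i w) f, ⟨MvPolynomial.rename l f, fun w => by
      rw [MvPolynomial.eval_rename]; rfl⟩, fun w => ?_⟩
    refine congrArg (fun v => MvPolynomial.eval v f) (funext fun i => ?_)
    exact congrArg (fun L => L ⟨w, hE w.2⟩) (hl i)
  let I : TopologicalSpace.IrreducibleCloseds E → Ideal (MvPolynomial (Fin (Module.finrank K S)) K) := fun Z =>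
    { carrier := {f | ∀ w ∈ Z, MvPolynomial.eval (c w) f = 0}
      add_mem' := fun hf hg w hw => by simp [hf w hw, hg w hw]
      zero_mem' := by simp
      smul_mem' := fun f g hg w hw => by simp [hg w hw] }
  have hclosed : ∀ f : MvPolynomial (Fin (Module.finrank K S)) K, IsClosed {w : E | MvPolynomial.eval (c w) f = 0} := by
    intro f
    obtain ⟨φ, hφ, hφf⟩ := hpoly f
    simp_rw [← hφf]
    exact isClosed_zeroSet_on E hφ
  have hprime : ∀ Z, (I Z).IsPrime := by
    intro Z
    refine ⟨fun htop => ?_, fun {f g} hfg => ?_⟩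
    · obtain ⟨w, hw⟩ := Z.isIrreducible'.1
      have h1 : (1 : MvPolynomial (Fin (Module.finrank K S)) K) ∈ I Z := by rw [htop]; trivial
      simpa using h1 w hw
    · have := isPreirreducible_iff_isClosed_union_isClosed.mp Z.isIrreducible'.2 _ _
        (hclosed f) (hclosed g) (fun w hw => by simpa using hfg w hw)
      exact this.imp (fun h w hw => h hw) (fun h w hw => h hw)
  let J : TopologicalSpace.IrreducibleCloseds E → (PrimeSpectrum (MvPolynomial (Fin (Module.finrank K S)) K))ᵒᵈ :=
    fun Z => OrderDual.toDual ⟨I Z, hprime Z⟩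
  have hJ : StrictMono J := by
    intro Z Z' hlt
    refine lt_of_le_of_ne (fun f hf w hw => hf w (hlt.le hw)) fun heq => hlt.not_ge fun w hw => ?_
    refine mem_of_forall_isPolyFun (X := E) Z.isClosed' w fun φ hφ h => ?_
    obtain ⟨f, hf⟩ := hcpoly φ hφ
    have h1 : f ∈ I Z := fun z hz => by rw [← hf]; exact h z hz
    have h2 : I Z = I Z' := congrArg (fun p => (OrderDual.ofDual p).asIdeal) heq
    rw [h2] at h1
    rw [hf]
    exact h1 w hw
  refine (Order.krullDim_le_of_strictMono J hJ).trans ?_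
  rw [Order.krullDim_orderDual]
  refine (MvPolynomial.ringKrullDim_of_isNoetherianRing (R := K) (ι := Fin (Module.finrank K S))).le.trans ?_
  simp

theorem krullDim_affine_eq [FiniteDimensional K W] (S : Submodule K W) {g : W → K}
    (hg : IsPolyFun K g) (E : Set W) (hE : E = {w | w ∈ S ∧ g w ≠ 0}) (hne : E.Nonempty) :
    @topologicalKrullDim E (zariskiOn K E) = Module.finrank K S :=
  le_antisymm (krullDim_affine_le S E fun w hw => by rw [hE] at hw; exact hw.1)
    (le_krullDim_affine S hg E hE hne)

/-- The group `H` of the units lying in a subalgebra `T` is an open subset of `T`, and so are the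
stabilizers of its action by conjugation: their dimension is that of a centralizer. -/
theorem stabilizerDim_eq {A : Type*} [Ring A] [Algebra K A] [FiniteDimensional K A]
    (H : Subgroup Aˣ) (T : Subalgebra K A) (hH : ∀ h : Aˣ, h ∈ H ↔ (h : A) ∈ T) (x : A) :
    stabilizerDim K H x =
      Module.finrank K (T ⊓ Subalgebra.centralizer K {x} : Subalgebra K A) := by
  -- An element is a unit exactly when left multiplication by it has nonzero determinant, and this
  -- determinant is a polynomial function.
  refine krullDim_affine_eq (Subalgebra.toSubmodule (T ⊓ Subalgebra.centralizer K {x}))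
    (g := fun a => (LinearMap.mulLeft K a).det) ?_ _ ?_ ⟨1, 1, H.one_mem, by simp, by simp⟩
  · let b := Module.finBasis K A
    have : ∀ a : A, (LinearMap.mulLeft K a).det =
        (LinearMap.toMatrix b b (LinearMap.mulLeft K a)).det := fun a =>
      (LinearMap.det_toMatrix b _).symm
    simp_rw [this]
    exact IsPolyFun.det (IsPolyMap.linear ((LinearMap.toMatrix b b).toLinearMap ∘ₗ LinearMap.mul K A))
  · ext a
    have hunit : (LinearMap.mulLeft K a).det ≠ 0 ↔ IsUnit a := by
      rw [← isUnit_iff_ne_zero, ← LinearMap.isUnit_iff_isUnit_det]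
      constructor
      · intro h
        obtain ⟨c, hc⟩ := (Module.End.isUnit_iff _).mp h |>.2 1
        have hca : c * a = 1 := by
          apply ((Module.End.isUnit_iff _).mp h).1
          simp only [LinearMap.mulLeft_apply] at hc ⊢
          rw [← mul_assoc, hc, one_mul, mul_one]
        exact ⟨⟨a, c, hc, hca⟩, rfl⟩
      · rintro ⟨u, rfl⟩
        rw [Module.End.isUnit_iff]
        exact (Units.mulLeft u).bijective
    simp only [stabilizerIn, Set.mem_ofPred_eq, hunit]
    constructor
    · rintro ⟨h, hh, hx, rfl⟩
      exact ⟨⟨(hH h).mp hh, by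
        refine (Subalgebra.mem_centralizer_iff K).mpr ?_
        rintro _ rfl
        exact hx.symm⟩, h.isUnit⟩
    · rintro ⟨⟨haT, hax⟩, u, rfl⟩
      exact ⟨u, (hH u).mpr haT, (Subalgebra.mem_centralizer_iff K |>.mp hax x rfl).symm, rfl⟩

end KrullDimension

/-! ### Splitting a central division algebra -/

section CentralSimple

/-- The base change of a central division algebra to a field extension is a simple ring. -/
theorem isSimpleRing_tensorProduct_right (F K D : Type*) [Field F] [Field K] [Algebra F K]
    [DivisionRing D] [Algebra F D] [Algebra.IsCentral F D] : IsSimpleRing (D ⊗[F] K) := by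
  classical
  let b := Module.Basis.ofVectorSpace F K
  let B := Algebra.TensorProduct.basis D b
  have hB : ∀ i, B i = 1 ⊗ₜ b i := fun i => Algebra.TensorProduct.basis_apply ..
  have hleft : ∀ (e : D) (y : D ⊗[F] K) i, B.repr ((e ⊗ₜ 1) * y) i = e * B.repr y i := by
    intro e y i
    have : (e ⊗ₜ[F] (1 : K)) * y = e • y := by
      induction y with
      | zero => simp
      | tmul a k => simp [TensorProduct.smul_tmul']
      | add y z hy hz => rw [mul_add, hy, hz, smul_add]
    rw [this]
    simp
  have hright : ∀ (e : D) (y : D ⊗[F] K) i, B.repr (y * (e ⊗ₜ 1)) i = B.repr y i * e := by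
    intro e y i
    induction y with
    | zero => simp
    | tmul a k =>
      rw [Algebra.TensorProduct.tmul_mul_tmul, mul_one, Algebra.TensorProduct.basis_repr_tmul,
        Algebra.TensorProduct.basis_repr_tmul]
      simp [mul_assoc, Algebra.commutes]
    | add y z hy hz => rw [add_mul, map_add, map_add, Finsupp.add_apply, Finsupp.add_apply, hy, hz,
        add_mul]
  refine ⟨{ exists_pair_ne := ⟨⊥, ⊤, fun h => ?_⟩, eq_bot_or_eq_top := fun I => ?_ }⟩
  · have h1 : (1 : D ⊗[F] K) ∈ (⊥ : TwoSidedIdeal (D ⊗[F] K)) := by rw [h]; trivial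
    exact one_ne_zero h1
  · refine or_iff_not_imp_left.mpr fun hI => ?_
    -- Choose a nonzero element of `I` with the fewest nonzero coordinates, scaled to have one
    -- coordinate equal to `1`. Its commutators with `D` have smaller support, hence vanish; so its
    -- coordinates are central and it lies in `1 ⊗ K`, where it is invertible.
    have hne : ∃ n, ∃ y ∈ I, y ≠ 0 ∧ (B.repr y).support.card = n := by
      by_contra! h
      refine hI (le_antisymm (fun y hy => ?_) bot_le)
      by_contra hy0
      exact h _ y hy hy0 rfl
    obtain ⟨y, hy, hy0, hyn⟩ := Nat.find_spec hne
    have hmin : ∀ z ∈ I, (B.repr z).support.card < (B.repr y).support.card → z = 0 := by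
      intro z hz hlt
      by_contra hz0
      rw [hyn] at hlt
      exact Nat.find_min hne hlt ⟨z, hz, hz0, rfl⟩
    obtain ⟨i₀, hi₀⟩ : ∃ i, B.repr y i ≠ 0 := by
      by_contra! h
      exact hy0 (B.repr.map_eq_zero_iff.mp (Finsupp.ext h))
    let y' := (((B.repr y i₀)⁻¹ ⊗ₜ[F] (1 : K)) * y)
    have hy' : y' ∈ I := I.mul_mem_left _ _ hy
    have hrepr : ∀ i, B.repr y' i = (B.repr y i₀)⁻¹ * B.repr y i := hleft _ y
    have hcentral : ∀ i, B.repr y' i ∈ Subalgebra.center F D := by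
      intro i
      rw [Subalgebra.mem_center_iff]
      intro e
      have hz : (e ⊗ₜ 1) * y' - y' * (e ⊗ₜ 1) = 0 := by
        refine hmin _ (I.sub_mem (I.mul_mem_left _ _ hy') (I.mul_mem_right _ _ hy')) ?_
        refine Finset.card_lt_card ((Finset.ssubset_iff_of_subset fun j hj => ?_).mpr
          ⟨i₀, by simpa using hi₀, ?_⟩)
        · rw [Finsupp.mem_support_iff] at hj ⊢
          contrapose! hj
          rw [map_sub, Finsupp.sub_apply, hleft, hright, hrepr, hj]
          simp
        · rw [Finsupp.notMem_support_iff, map_sub, Finsupp.sub_apply, hleft, hright, hrepr,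
            inv_mul_cancel₀ hi₀]
          simp
      have := congrArg (fun z => B.repr z i) hz
      simp only [map_sub, Finsupp.sub_apply, hleft, hright, map_zero, Finsupp.zero_apply] at this
      exact sub_eq_zero.mp this
    have hF : ∀ i, ∃ c : F, algebraMap F D c = B.repr y' i := fun i =>
      Algebra.mem_bot.mp (Algebra.IsCentral.out (hcentral i))
    choose c hc using hF
    have hyk : ∃ k : K, y' = 1 ⊗ₜ k := by
      refine ⟨(B.repr y').sum fun i _ => c i • b i, ?_⟩
      conv_lhs => rw [← B.linearCombination_repr y']
      rw [Finsupp.linearCombination_apply, Finsupp.sum, Finsupp.sum, TensorProduct.tmul_sum]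
      refine Finset.sum_congr rfl fun i _ => ?_
      rw [hB, ← hc, TensorProduct.smul_tmul', smul_eq_mul, mul_one, Algebra.algebraMap_eq_smul_one,
        TensorProduct.smul_tmul]
    obtain ⟨k, hk⟩ := hyk
    have hk0 : k ≠ 0 := by
      rintro rfl
      have := hrepr i₀
      rw [hk, inv_mul_cancel₀ hi₀] at this
      simp at this
    have h1 : (1 : D ⊗[F] K) ∈ I := by
      have := I.mul_mem_left (1 ⊗ₜ k⁻¹) _ hy'
      rwa [hk, Algebra.TensorProduct.tmul_mul_tmul, inv_mul_cancel₀ hk0, one_mul,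
        ← Algebra.TensorProduct.one_def] at this
    refine le_antisymm le_top fun z _ => ?_
    simpa using I.mul_mem_left z 1 h1

theorem isSimpleRing_tensorProduct (F K D : Type*) [Field F] [Field K] [Algebra F K]
    [DivisionRing D] [Algebra F D] [Algebra.IsCentral F D] : IsSimpleRing (K ⊗[F] D) :=
  have := isSimpleRing_tensorProduct_right F K D
  .of_ringEquiv (Algebra.TensorProduct.comm F D K).toRingEquiv this

theorem exists_splitting (F K D : Type*) [Field F] [Field K] [IsAlgClosed K] [Algebra F K]
    [DivisionRing D] [Algebra F D] [Algebra.IsCentral F D] [FiniteDimensional F D]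
    (d : ℕ) (hd : d ^ 2 = Module.finrank F D) :
    Nonempty ((K ⊗[F] D) ≃ₐ[K] Matrix (Fin d) (Fin d) K) := by
  have := isSimpleRing_tensorProduct F K D
  obtain ⟨n, -, ⟨e⟩⟩ := IsSimpleRing.exists_algEquiv_matrix_of_isAlgClosed K (K ⊗[F] D)
  have h := e.toLinearEquiv.finrank_eq
  rw [Module.finrank_baseChange, ← hd, Module.finrank_matrix] at h
  simp only [Fintype.card_fin, Module.finrank_self, mul_one, ← sq] at h
  obtain rfl : d = n := by simpa using h
  exact ⟨e⟩

/-- Two isomorphisms with the same matrix algebra define the same characteristic polynomials. -/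
theorem charpoly_algEquiv_eq {K B m : Type*} [Field K] [Ring B] [Algebra K B] [Fintype m]
    [DecidableEq m] (e e' : B ≃ₐ[K] Matrix m m K) (b : B) : (e b).charpoly = (e' b).charpoly := by
  -- Skolem–Noether: an automorphism of a matrix algebra is inner.
  obtain ⟨T, hT⟩ := AlgEquiv.eq_linearEquivConjAlgEquiv
    ((Matrix.toLinAlgEquiv' (R := K) (n := m)).symm.trans
      ((e.symm.trans e').trans Matrix.toLinAlgEquiv'))
  have h := congrArg (fun f => f (Matrix.toLinAlgEquiv' (e b))) hT
  simp only [AlgEquiv.trans_apply, AlgEquiv.symm_apply_apply] at h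
  have h1 : ∀ M : Matrix m m K, (Matrix.toLinAlgEquiv' M).charpoly = M.charpoly := fun M =>
    Matrix.charpoly_mulVecLin M
  rw [← h1, ← h1, h]
  exact (LinearEquiv.charpoly_conj T _).symm

end CentralSimple

/-! ### Matrices over a split algebra -/

section Splitting

variable {K R : Type*} [Field K] [Ring R] [Algebra K R] {d : ℕ}

/-- Matrices over an algebra which is isomorphic to `M_d(K)`, viewed as matrices over `K`. -/
noncomputable def splitEquiv (ψ : R ≃ₐ[K] Matrix (Fin d) (Fin d) K) (n : Type*) [Fintype n]
    [DecidableEq n] : Matrix n n R ≃ₐ[K] Matrix (n × Fin d) (n × Fin d) K :=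
  ψ.mapMatrix.trans (Matrix.compAlgEquiv n (Fin d) K K)

theorem splitEquiv_apply (ψ : R ≃ₐ[K] Matrix (Fin d) (Fin d) K) {n : Type*} [Fintype n]
    [DecidableEq n] (x : Matrix n n R) (i j : n) (k l : Fin d) :
    splitEquiv ψ n x (i, k) (j, l) = ψ (x i j) k l := rfl

end Splitting

/-! ### The reduced characteristic polynomial -/

section ReducedCharpoly

variable {F : Type*} [Field F] {D : Type*} [DivisionRing D] [Algebra F D] {d : ℕ}
  {n : Type*} [Fintype n] [DecidableEq n]

/-- The existential over splittings in the definition may be tested on any one splitting, because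
two of them give the same characteristic polynomials. -/
theorem isReducedCharpoly_iff (ψ : (AlgebraicClosure F ⊗[F] D) ≃ₐ[AlgebraicClosure F]
      Matrix (Fin d) (Fin d) (AlgebraicClosure F)) (x : Matrix n n D) (P : F[X]) :
    IsReducedCharpoly F d x P ↔
      P.map (algebraMap F (AlgebraicClosure F)) = (splitEquiv ψ n (geomPoint F x)).charpoly := by
  constructor
  · rintro ⟨ψ', h⟩
    rw [h]
    exact charpoly_algEquiv_eq (splitEquiv ψ' n) (splitEquiv ψ n) _
  · exact fun h => ⟨ψ, h⟩

/-- Galois descent. Twisting `ψ` by `σ` gives another splitting, in which the matrix of `x` is the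
`σ`-transform of the original one. Independence of the splitting makes the coefficients invariant
under `σ`, hence elements of `F`. -/
theorem exists_isReducedCharpoly [CharZero F] (ψ : (AlgebraicClosure F ⊗[F] D) ≃ₐ[AlgebraicClosure F]
      Matrix (Fin d) (Fin d) (AlgebraicClosure F)) (x : Matrix n n D) :
    ∃ P : F[X], IsReducedCharpoly F d x P := by
  have hgal : ∀ (σ : AlgebraicClosure F ≃ₐ[F] AlgebraicClosure F) (k : ℕ),
      σ ((splitEquiv ψ n (geomPoint F x)).charpoly.coeff k) =
        (splitEquiv ψ n (geomPoint F x)).charpoly.coeff k := by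
    intro σ k
    let ρ : (AlgebraicClosure F ⊗[F] D) ≃+* Matrix (Fin d) (Fin d) (AlgebraicClosure F) :=
      ((Algebra.TensorProduct.congr σ.symm AlgEquiv.refl).toRingEquiv.trans ψ.toRingEquiv).trans
        σ.toRingEquiv.mapMatrix
    let ψ' : (AlgebraicClosure F ⊗[F] D) ≃ₐ[AlgebraicClosure F]
        Matrix (Fin d) (Fin d) (AlgebraicClosure F) := AlgEquiv.ofRingEquiv (f := ρ) (by
      intro c
      change ((ψ (Algebra.TensorProduct.congr σ.symm AlgEquiv.refl (c ⊗ₜ 1))).map σ) = _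
      have : Algebra.TensorProduct.congr σ.symm (AlgEquiv.refl (R := F) (A₁ := D)) (c ⊗ₜ 1) =
        algebraMap (AlgebraicClosure F) _ (σ.symm c) := by
        simp [Algebra.TensorProduct.algebraMap_apply]
      rw [this, AlgEquiv.commutes]
      ext i j
      simp [Matrix.algebraMap_matrix_apply, apply_ite σ])
    have h1 : splitEquiv ψ' n (geomPoint F x) =
        (splitEquiv ψ n (geomPoint F x)).map (σ : AlgebraicClosure F →+* AlgebraicClosure F) := by
      ext ⟨i, k⟩ ⟨j, l⟩
      rw [Matrix.map_apply, splitEquiv_apply, splitEquiv_apply]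
      change σ (ψ (Algebra.TensorProduct.congr σ.symm (AlgEquiv.refl (R := F) (A₁ := D))
        (1 ⊗ₜ x i j)) k l) = σ (ψ (1 ⊗ₜ x i j) k l)
      simp
    have h2 := charpoly_algEquiv_eq (splitEquiv ψ n) (splitEquiv ψ' n) (geomPoint F x)
    conv_rhs => rw [h2, h1, Matrix.charpoly_map, Polynomial.coeff_map]
    rfl
  have : ∃ P : F[X], P.map (algebraMap F (AlgebraicClosure F)) =
      (splitEquiv ψ n (geomPoint F x)).charpoly := by
    rw [← Set.mem_range, ← Polynomial.coe_mapRingHom, ← RingHom.coe_range, SetLike.mem_coe,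
      Polynomial.mem_map_range]
    intro k
    exact (InfiniteGalois.mem_range_algebraMap_iff_fixed _).mpr fun σ => hgal σ k
  obtain ⟨P, hP⟩ := this
  exact ⟨P, ψ, hP⟩

theorem map_reducedCharpoly [CharZero F] (ψ : (AlgebraicClosure F ⊗[F] D) ≃ₐ[AlgebraicClosure F]
      Matrix (Fin d) (Fin d) (AlgebraicClosure F)) (x : Matrix n n D) :
    (reducedCharpoly F d x).map (algebraMap F (AlgebraicClosure F)) =
      (splitEquiv ψ n (geomPoint F x)).charpoly := by
  classical
  rw [← isReducedCharpoly_iff, reducedCharpoly]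
  convert! (exists_isReducedCharpoly ψ x).choose_spec
  exact dif_pos _

end ReducedCharpoly

/-! ### Block equations for S and for the group G^θ -/

section Blocks

variable {R : Type*} [Ring R]

theorem two_nsmul_eq_zero_of_isUnit {m n : Type*} (h2 : IsUnit (2 : R)) {M : Matrix m n R}
    (h : M = -M) : M = 0 := by
  ext i j
  have h1 : M i j = -M i j := congrFun (congrFun h i) j
  have : (2 : R) * M i j = 0 := by
    rw [two_mul]; nth_rewrite 2 [h1]; exact add_neg_cancel _
  exact (h2.mul_right_eq_zero).mp this

theorem thetaMat_eq (p q : ℕ) : thetaMat R p q p = Matrix.fromBlocks 1 0 0 (-1) := by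
  rw [thetaMat, ← Matrix.diagonal_one, ← Matrix.diagonal_one (n := Fin q), Matrix.diagonal_neg,
    Matrix.fromBlocks_diagonal]
  congr 1
  ext i
  rcases i with i | i <;> simp

theorem thetaMat_mul_self (p q p' : ℕ) : thetaMat R p q p' * thetaMat R p q p' = 1 := by
  rw [thetaMat, Matrix.diagonal_mul_diagonal, ← Matrix.diagonal_one]
  congr 1
  ext i
  split_ifs <;> simp

variable {p q : ℕ}

theorem fromBlocks_mem_symSpace {a : Matrix (Fin p) (Fin p) R} {b : Matrix (Fin p) (Fin q) R}
    {c : Matrix (Fin q) (Fin p) R} {e : Matrix (Fin q) (Fin q) R} :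
    Matrix.fromBlocks a b c e ∈ symSpace R p q ↔
      a * a - b * c = 1 ∧ a * b = b * e ∧ c * a = e * c ∧ e * e - c * b = 1 := by
  simp only [symSpace, Set.mem_ofPred_eq, thetaMat_eq, Matrix.fromBlocks_multiply, sq,
    Matrix.mul_one, Matrix.mul_zero, add_zero, zero_add, Matrix.mul_neg, Matrix.neg_mul, neg_neg]
  rw [← Matrix.fromBlocks_one, Matrix.fromBlocks_inj]
  simp only [← sub_eq_add_neg, neg_add_eq_sub, sub_eq_zero]
  rw [eq_comm (a := b * e)]

theorem mem_fixedGroup_iff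
    (h : (Matrix (Fin p ⊕ Fin q) (Fin p ⊕ Fin q) R)ˣ) :
    h ∈ fixedGroup R p q ↔
      (h : Matrix (Fin p ⊕ Fin q) (Fin p ⊕ Fin q) R) * thetaMat R p q p =
        thetaMat R p q p * h := by
  rw [fixedGroup, Submonoid.mem_units_iff, Submonoid.mem_centralizer_iff,
    Submonoid.mem_centralizer_iff]
  simp only [Set.mem_singleton_iff, forall_eq]
  constructor
  · exact fun h => h.1.symm
  · intro hc
    refine ⟨hc.symm, ?_⟩
    have : Commute (h : Matrix (Fin p ⊕ Fin q) (Fin p ⊕ Fin q) R) (thetaMat R p q p) := hc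
    exact this.units_inv_left.eq.symm

theorem commute_thetaMat_iff (h2 : IsUnit (2 : R)) (M : Matrix (Fin p ⊕ Fin q) (Fin p ⊕ Fin q) R) :
    M * thetaMat R p q p = thetaMat R p q p * M ↔ M.toBlocks₁₂ = 0 ∧ M.toBlocks₂₁ = 0 := by
  conv_lhs => rw [← Matrix.fromBlocks_toBlocks M, thetaMat_eq]
  simp only [Matrix.fromBlocks_multiply, Matrix.fromBlocks_inj, Matrix.mul_one, Matrix.one_mul,
    Matrix.mul_zero, Matrix.zero_mul, add_zero, zero_add, Matrix.mul_neg, Matrix.neg_mul,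
    true_and, and_true]
  constructor
  · exact fun h => ⟨two_nsmul_eq_zero_of_isUnit h2 h.1.symm, two_nsmul_eq_zero_of_isUnit h2 h.2⟩
  · rintro ⟨h, h'⟩
    simp [h, h']

/-- The conjugates of a block matrix under the group of block diagonal matrices. -/
theorem mem_conjOrbit_fixedGroup (h2 : IsUnit (2 : R)) {x y : Matrix (Fin p ⊕ Fin q) (Fin p ⊕ Fin q) R} :
    y ∈ conjOrbit (fixedGroup R p q) x ↔
      ∃ (g : (Matrix (Fin p) (Fin p) R)ˣ) (h : (Matrix (Fin q) (Fin q) R)ˣ),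
        y = Matrix.fromBlocks (g.1 * x.toBlocks₁₁ * (g⁻¹).1)
          (g.1 * x.toBlocks₁₂ * (h⁻¹).1)
          (h.1 * x.toBlocks₂₁ * (g⁻¹).1)
          (h.1 * x.toBlocks₂₂ * (h⁻¹).1) := by
  constructor
  · rintro ⟨u, hu, rfl⟩
    have hu' := (commute_thetaMat_iff h2 _).mp ((mem_fixedGroup_iff _).mp hu)
    have hu'' := (commute_thetaMat_iff h2 _).mp
      ((mem_fixedGroup_iff _).mp ((fixedGroup R p q).inv_mem hu))
    have h1 : (u : Matrix (Fin p ⊕ Fin q) (Fin p ⊕ Fin q) R) =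
        Matrix.fromBlocks u.1.toBlocks₁₁ 0 0 u.1.toBlocks₂₂ := by
      conv_lhs => rw [← Matrix.fromBlocks_toBlocks u.1, hu'.1, hu'.2]
    have h1' : ((u⁻¹ : (Matrix (Fin p ⊕ Fin q) (Fin p ⊕ Fin q) R)ˣ) :
        Matrix (Fin p ⊕ Fin q) (Fin p ⊕ Fin q) R) =
        Matrix.fromBlocks (u⁻¹).1.toBlocks₁₁ 0 0 (u⁻¹).1.toBlocks₂₂ := by
      conv_lhs => rw [← Matrix.fromBlocks_toBlocks (u⁻¹).1, hu''.1, hu''.2]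
    have e1 := u.mul_inv
    have e2 := u.inv_mul
    rw [h1, h1', Matrix.fromBlocks_multiply, ← Matrix.fromBlocks_one, Matrix.fromBlocks_inj] at e1 e2
    simp only [Matrix.mul_zero, Matrix.zero_mul, add_zero, zero_add] at e1 e2
    refine ⟨⟨_, _, e1.1, e2.1⟩, ⟨_, _, e1.2.2.2, e2.2.2.2⟩, ?_⟩
    conv_lhs => rw [h1, h1', ← Matrix.fromBlocks_toBlocks x, Matrix.fromBlocks_multiply,
      Matrix.fromBlocks_multiply]
    simp
  · rintro ⟨g, h, rfl⟩
    refine ⟨⟨Matrix.fromBlocks g 0 0 h, Matrix.fromBlocks (g⁻¹).1 0 0 (h⁻¹).1, ?_, ?_⟩, ?_, ?_⟩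
    · simp [Matrix.fromBlocks_multiply]
    · simp [Matrix.fromBlocks_multiply]
    · rw [mem_fixedGroup_iff, commute_thetaMat_iff h2]
      simp
    · change _ = Matrix.fromBlocks g.1 0 0 h.1 * x * Matrix.fromBlocks (g⁻¹).1 0 0 (h⁻¹).1
      conv_rhs => rw [← Matrix.fromBlocks_toBlocks x, Matrix.fromBlocks_multiply,
        Matrix.fromBlocks_multiply]
      simp

/-! ### Block decomposition of the normal forms -/

/-- The block diagonal matrix `diag(A, 1, -1)`. -/
def signBlock {μ : Type*} (A : Matrix μ μ R) (β ρ : Type*) [DecidableEq β] [DecidableEq ρ] :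
    Matrix (μ ⊕ (β ⊕ ρ)) (μ ⊕ (β ⊕ ρ)) R :=
  Matrix.fromBlocks A 0 0 (Matrix.fromBlocks 1 0 0 (-1))

/-- The identification of `{0, …, a - 1}` with a disjoint union of three intervals. -/
def blockEquiv {m β ρ a : ℕ} (h : m + (β + ρ) = a) : Fin m ⊕ (Fin β ⊕ Fin ρ) ≃ Fin a :=
  ((Equiv.sumCongr (Equiv.refl _) finSumFinEquiv).trans finSumFinEquiv).trans (finCongr h)

variable {m : ℕ}

theorem corner_submatrix {β ρ a β' ρ' a' : ℕ} (h : m + (β + ρ) = a) (h' : m + (β' + ρ') = a')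
    (A : Matrix (Fin m) (Fin m) R) :
    (corner a a' A).submatrix (blockEquiv h) (blockEquiv h') = Matrix.fromBlocks A 0 0 0 := by
  ext i j
  rcases i with i | i | i <;> rcases j with j | j | j <;> simp [corner, blockEquiv]

theorem diagBlock_submatrix {β ρ a : ℕ} (h : m + (β + ρ) = a) (A : Matrix (Fin m) (Fin m) R) :
    (diagBlock a ρ A).submatrix (blockEquiv h) (blockEquiv h) = signBlock A (Fin β) (Fin ρ) := by
  rw [diagBlock, Matrix.submatrix_add, Pi.add_apply, Pi.add_apply, corner_submatrix, signBlock,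
    Matrix.submatrix_diagonal_equiv]
  have : Matrix.diagonal ((fun i : Fin a =>
      if (i : ℕ) < m then (0 : R) else if (i : ℕ) + ρ < a then 1 else -1) ∘ blockEquiv h) =
      Matrix.fromBlocks 0 0 0 (Matrix.fromBlocks 1 0 0 (-1)) := by
    rw [← Matrix.diagonal_one, ← Matrix.diagonal_one (n := Fin ρ), Matrix.diagonal_neg,
      Matrix.fromBlocks_diagonal, ← Matrix.diagonal_zero, Matrix.fromBlocks_diagonal]
    congr 1
    ext i
    rcases i with i | i | i
    · simp [blockEquiv]
    · have : m + i + ρ < a := by omega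
      simp [blockEquiv]
      omega
    · have : ¬ (m + (β + i) + ρ < a) := by omega
      simp [blockEquiv]
      omega
  rw [this, Matrix.fromBlocks_add]
  simp

theorem diagBlock_eq {β ρ a : ℕ} (h : m + (β + ρ) = a) (A : Matrix (Fin m) (Fin m) R) :
    diagBlock a ρ A =
      (signBlock A (Fin β) (Fin ρ)).submatrix (blockEquiv h).symm (blockEquiv h).symm := by
  rw [← diagBlock_submatrix h A, Matrix.submatrix_submatrix]
  simp

theorem corner_eq {β ρ a β' ρ' a' : ℕ} (h : m + (β + ρ) = a) (h' : m + (β' + ρ') = a')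
    (A : Matrix (Fin m) (Fin m) R) : corner a a' A =
      (Matrix.fromBlocks A 0 0 0 : Matrix (Fin m ⊕ (Fin β ⊕ Fin ρ)) (Fin m ⊕ (Fin β' ⊕ Fin ρ'))
        R).submatrix (blockEquiv h).symm (blockEquiv h').symm := by
  rw [← corner_submatrix h h' A, Matrix.submatrix_submatrix]
  simp

variable {μ β ρ μ' β' ρ' : Type*} [Fintype μ] [DecidableEq μ] [Fintype β] [DecidableEq β]
  [Fintype ρ] [DecidableEq ρ] [Fintype μ'] [DecidableEq μ'] [Fintype β'] [DecidableEq β']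
  [Fintype ρ'] [DecidableEq ρ']

/-- The matrices intertwining `diag(A, 1, -1)` and `diag(A', 1, -1)` are block diagonal. -/
theorem signBlock_intertwine (h2 : IsUnit (2 : R)) {A : Matrix μ μ R} {A' : Matrix μ' μ' R}
    (hA : IsUnit (A * A - 1)) (hA' : IsUnit (A' * A' - 1))
    (U : Matrix (μ ⊕ (β ⊕ ρ)) (μ' ⊕ (β' ⊕ ρ')) R) :
    signBlock A β ρ * U = U * signBlock A' β' ρ' ↔
      ∃ u v w, U = Matrix.fromBlocks u 0 0 (Matrix.fromBlocks v 0 0 w) ∧ A * u = u * A' := by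
  constructor
  · intro h
    obtain ⟨u, B, C, V, rfl⟩ : ∃ u B C V, U = Matrix.fromBlocks u B C V :=
      ⟨_, _, _, _, (Matrix.fromBlocks_toBlocks U).symm⟩
    obtain ⟨v, x, y, w, rfl⟩ : ∃ v x y w, V = Matrix.fromBlocks v x y w :=
      ⟨_, _, _, _, (Matrix.fromBlocks_toBlocks V).symm⟩
    simp only [signBlock, Matrix.fromBlocks_multiply, Matrix.fromBlocks_inj, Matrix.zero_mul,
      Matrix.mul_zero, add_zero, zero_add, Matrix.one_mul, Matrix.mul_one, Matrix.neg_mul,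
      Matrix.mul_neg, true_and, and_true] at h
    obtain ⟨h1, hB, hC, hx, hy⟩ := h
    have hs : (Matrix.fromBlocks 1 0 0 (-1) : Matrix (β ⊕ ρ) (β ⊕ ρ) R) *
        Matrix.fromBlocks 1 0 0 (-1) = 1 := by simp [Matrix.fromBlocks_multiply]
    have hs' : (Matrix.fromBlocks 1 0 0 (-1) : Matrix (β' ⊕ ρ') (β' ⊕ ρ') R) *
        Matrix.fromBlocks 1 0 0 (-1) = 1 := by simp [Matrix.fromBlocks_multiply]
    -- If `A B = B s` with `s² = 1`, then `(A² - 1) B = 0`. The same argument on the other side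
    -- kills `C`.
    have hB0 : B = 0 := by
      obtain ⟨W, hW⟩ := hA.exists_left_inv
      have : (A * A - 1) * B = 0 := by
        rw [Matrix.sub_mul, Matrix.mul_assoc, hB, ← Matrix.mul_assoc, hB, Matrix.mul_assoc, hs',
          Matrix.mul_one, Matrix.one_mul, sub_self]
      rw [← Matrix.one_mul B, ← hW, Matrix.mul_assoc, this, Matrix.mul_zero]
    have hC0 : C = 0 := by
      obtain ⟨W, hW⟩ := hA'.exists_right_inv
      have : C * (A' * A' - 1) = 0 := by
        rw [Matrix.mul_sub, ← Matrix.mul_assoc, ← hC, Matrix.mul_assoc, ← hC, ← Matrix.mul_assoc, hs,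
          Matrix.mul_one, Matrix.one_mul, sub_self]
      rw [← Matrix.mul_one C, ← hW, ← Matrix.mul_assoc, this, Matrix.zero_mul]
    exact ⟨u, v, w, by rw [hB0, hC0, two_nsmul_eq_zero_of_isUnit h2 hx,
      two_nsmul_eq_zero_of_isUnit h2 hy.symm], h1⟩
  · rintro ⟨u, v, w, rfl, h⟩
    simp [signBlock, Matrix.fromBlocks_multiply, h]

theorem signBlock_mul_self_sub_one (A : Matrix μ μ R) :
    signBlock A β ρ * signBlock A β ρ - 1 = Matrix.fromBlocks (A * A - 1) 0 0 0 := by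
  rw [signBlock, Matrix.fromBlocks_multiply, ← Matrix.fromBlocks_one]
  simp only [Matrix.fromBlocks_multiply, sub_eq_add_neg, Matrix.fromBlocks_neg,
    Matrix.fromBlocks_add, Matrix.mul_zero, Matrix.zero_mul, add_zero, zero_add, neg_zero,
    Matrix.one_mul, Matrix.neg_mul, Matrix.mul_neg, neg_neg]
  rw [Matrix.fromBlocks_one, add_neg_cancel]

theorem isUnit_mul_self_sub_one_iff (A : Matrix μ μ R) :
    IsUnit (A * A - 1) ↔ IsUnit (A - 1) ∧ IsUnit (A + 1) := by
  have hc : Commute (A - 1) (A + 1) := by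
    simp [Commute, SemiconjBy, sub_mul, mul_add, mul_sub, add_mul]
    abel
  rw [← hc.isUnit_mul_iff]
  congr! 1
  noncomm_ring

end Blocks

/-! ### Splitting off the eigenvalues ±1 over a division ring -/

section DivisionRing

open scoped Matrix

variable {E : Type*} [DivisionRing E]

/-- Row vectors are used because they form a left vector space on which matrices act linearly from
the right. -/
theorem isUnit_of_vecMul_injective {n : Type*} [Fintype n] [DecidableEq n] {M : Matrix n n E}
    (h : ∀ v, v ᵥ* M = 0 → v = 0) : IsUnit M := by
  have hinj : Function.Injective M.vecMulLinear := by
    rw [← LinearMap.ker_eq_bot, LinearMap.ker_eq_bot']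
    exact h
  let e := LinearEquiv.ofInjectiveEndo _ hinj
  have h1 : LinearMap.toMatrixRight' e.symm.toLinearMap * M = 1 := by
    apply Matrix.toLinearMapRight'.injective
    rw [Matrix.toLinearMapRight'_mul, Matrix.toLinearMapRight'_one]
    ext v : 1
    have : ∀ w, (LinearMap.toMatrixRight' e.symm.toLinearMap).toLinearMapRight' w = e.symm w :=
      fun w => by rw [LinearEquiv.symm_apply_apply]; rfl
    ext w
    simp only [LinearMap.comp_apply, this]
    exact congrFun (e.apply_symm_apply _) w
  exact IsUnit.of_mul_eq_one_right _ h1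

/-- A square matrix `a` over a division ring such that `a² - 1` is semisimple at `0` is conjugate
to a matrix `diag(A, 1, -1)`, where `A² - 1` is invertible. -/
theorem exists_signBlock (h2 : (2 : E) ≠ 0) {p : ℕ} (a : Matrix (Fin p) (Fin p) E)
    (ha : ∀ v, v ᵥ* ((a * a - 1) * (a * a - 1)) = 0 → v ᵥ* (a * a - 1) = 0) :
    ∃ (m β ρ : ℕ) (_ : m + (β + ρ) = p) (A : Matrix (Fin m) (Fin m) E)
      (G : Matrix (Fin m ⊕ (Fin β ⊕ Fin ρ)) (Fin p) E)
      (G' : Matrix (Fin p) (Fin m ⊕ (Fin β ⊕ Fin ρ)) E),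
      IsUnit (A * A - 1) ∧ G * G' = 1 ∧ G' * G = 1 ∧ G * a = signBlock A (Fin β) (Fin ρ) * G := by
  set z := a * a - 1 with hz
  -- The row space is the direct sum of the image of `z = a² - 1` and of the eigenspaces of `a` for
  -- `1` and `-1`: by hypothesis image and kernel of `z` meet trivially, and `v = (v + va)/2 + (v -
  -- va)/2` splits the kernel.
  let U₀ := LinearMap.range z.vecMulLinear
  let U₁ := LinearMap.ker (a - 1).vecMulLinear
  let U₂ := LinearMap.ker (a + 1).vecMulLinear
  have hU₀ : ∀ v, v ∈ U₀ ↔ ∃ w, w ᵥ* z = v := fun v => Iff.rfl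
  have hU₁ : ∀ v, v ∈ U₁ ↔ v ᵥ* a = v := fun v => by
    simp [U₁, sub_eq_zero]
  have hU₂ : ∀ v, v ∈ U₂ ↔ v ᵥ* a = -v := fun v => by
    simp [U₂, add_eq_zero_iff_eq_neg]
  have hzv : ∀ v, v ᵥ* z = v ᵥ* a ᵥ* a - v := fun v => by
    rw [hz, Matrix.vecMul_sub, Matrix.vecMul_one, Matrix.vecMul_vecMul]
  have h2v : ∀ v : Fin p → E, v = -v → v = 0 := fun v hv => by
    ext i
    have h1 : v i = -v i := congrFun hv i
    have : (2 : E) * v i = 0 := by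
      rw [two_mul]; nth_rewrite 2 [h1]; exact add_neg_cancel _
    exact (mul_eq_zero.mp this).resolve_left h2
  have hker : ∀ v, v ᵥ* z = 0 → ∃ v₁ ∈ U₁, ∃ v₂ ∈ U₂, v = v₁ + v₂ := by
    intro v hv
    rw [hzv, sub_eq_zero] at hv
    refine ⟨(2 : E)⁻¹ • (v + v ᵥ* a), ?_, (2 : E)⁻¹ • (v - v ᵥ* a), ?_, ?_⟩
    · rw [hU₁, Matrix.smul_vecMul, Matrix.add_vecMul, hv, add_comm]
    · rw [hU₂, Matrix.smul_vecMul, Matrix.sub_vecMul, hv, ← smul_neg, neg_sub]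
    · rw [← smul_add, add_add_sub_cancel, ← two_smul E v, smul_smul, inv_mul_cancel₀ h2, one_smul]
  have hdisj : Disjoint (LinearMap.ker z.vecMulLinear) U₀ := by
    rw [Submodule.disjoint_def]
    rintro v hv ⟨w, rfl⟩
    simp only [LinearMap.mem_ker, Matrix.vecMulLinear_apply, Matrix.vecMul_vecMul] at hv ⊢
    exact ha w hv
  have hcompl : IsCompl (LinearMap.ker z.vecMulLinear) U₀ :=
    (Submodule.isCompl_iff_disjoint _ _ (by
      rw [add_comm]; exact (LinearMap.finrank_range_add_finrank_ker _).ge)).mpr hdisj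
  let f : (U₀ × (U₁ × U₂)) →ₗ[E] (Fin p → E) :=
    U₀.subtype.coprod (U₁.subtype.coprod U₂.subtype)
  have hf : ∀ u, f u = u.1.1 + (u.2.1.1 + u.2.2.1) := fun u => rfl
  have hfinj : Function.Injective f := by
    rw [← LinearMap.ker_eq_bot, LinearMap.ker_eq_bot']
    rintro ⟨u₀, u₁, u₂⟩ hu
    simp only [hf] at hu
    have hu₁ := (hU₁ _).mp u₁.2
    have hu₂ := (hU₂ _).mp u₂.2
    have h0 : (u₁.1 + u₂.1) ᵥ* z = 0 := by
      rw [hzv, Matrix.add_vecMul, hu₁, hu₂, Matrix.add_vecMul, Matrix.neg_vecMul, hu₁, hu₂, neg_neg,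
        sub_self]
    have h12 : u₁.1 + u₂.1 = 0 := by
      refine (Submodule.disjoint_def.mp hdisj) _ h0 ?_
      rw [← neg_eq_of_add_eq_zero_right hu]
      exact U₀.neg_mem u₀.2
    have h00 : u₀.1 = 0 := by rwa [h12, add_zero] at hu
    have h21 : u₂.1 = -u₁.1 := (neg_eq_of_add_eq_zero_right h12).symm
    have h10 : u₁.1 = 0 := by
      apply h2v
      rw [← h21]
      have := hu₂
      rw [h21, Matrix.neg_vecMul, hu₁, neg_neg] at this
      rw [h21]; exact this.symm
    have h20 : u₂.1 = 0 := by rw [h21, h10, neg_zero]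
    ext1
    · exact Subtype.ext h00
    · ext1
      · exact Subtype.ext h10
      · exact Subtype.ext h20
  have hfsurj : Function.Surjective f := by
    intro v
    have : v ∈ LinearMap.ker z.vecMulLinear ⊔ U₀ := by rw [hcompl.sup_eq_top]; trivial
    obtain ⟨k, hk, u₀, hu₀, rfl⟩ := Submodule.mem_sup.mp this
    obtain ⟨v₁, hv₁, v₂, hv₂, rfl⟩ := hker k hk
    exact ⟨⟨⟨u₀, hu₀⟩, ⟨v₁, hv₁⟩, ⟨v₂, hv₂⟩⟩, by rw [hf]; exact add_comm _ _⟩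
  have hfbij : Function.Bijective f := ⟨hfinj, hfsurj⟩
  let b₀ := Module.finBasis E U₀
  let b₁ := Module.finBasis E U₁
  let b₂ := Module.finBasis E U₂
  let B := (b₀.prod (b₁.prod b₂)).map (LinearEquiv.ofBijective f hfbij)
  have hB₀ : ∀ i, B (Sum.inl i) = b₀ i := fun i => by
    rw [Module.Basis.map_apply, LinearEquiv.ofBijective_apply, hf]
    simp
  have hB₁ : ∀ i, B (Sum.inr (Sum.inl i)) = b₁ i := fun i => by
    rw [Module.Basis.map_apply, LinearEquiv.ofBijective_apply, hf]
    simp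
  have hB₂ : ∀ i, B (Sum.inr (Sum.inr i)) = b₂ i := fun i => by
    rw [Module.Basis.map_apply, LinearEquiv.ofBijective_apply, hf]
    simp
  have hcard := Module.finrank_eq_card_basis B
  simp only [Module.finrank_fin_fun, Fintype.card_sum, Fintype.card_fin] at hcard
  have hstab : ∀ v ∈ U₀, v ᵥ* a ∈ U₀ := by
    rintro _ ⟨w, rfl⟩
    refine ⟨w ᵥ* a, ?_⟩
    simp only [Matrix.vecMulLinear_apply, Matrix.vecMul_vecMul, hz]
    congr 1
    noncomm_ring
  let A : Matrix (Fin (Module.finrank E U₀)) (Fin (Module.finrank E U₀)) E :=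
    Matrix.of fun i j => b₀.repr ⟨b₀ i ᵥ* a, hstab _ (b₀ i).2⟩ j
  -- The rows of `G` are the adapted basis; those of `G'` are the coordinates of the standard basis
  -- in it.
  let G : Matrix (Fin (Module.finrank E U₀) ⊕ (Fin (Module.finrank E U₁) ⊕ Fin (Module.finrank E U₂)))
    (Fin p) E := Matrix.of fun i j => B i j
  let G' : Matrix (Fin p) (Fin (Module.finrank E U₀) ⊕ (Fin (Module.finrank E U₁) ⊕
    Fin (Module.finrank E U₂))) E := Matrix.of fun j i => B.repr (Pi.single j 1) i
  have hrepr : ∀ v : Fin p → E, ∀ i, B.repr v i = ∑ j, v j * B.repr (Pi.single j 1) i := by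
    intro v i
    conv_lhs => rw [pi_eq_sum_univ' v]
    simp [map_sum, Finsupp.finsetSum_apply]
  have hGG' : G * G' = 1 := by
    ext i j
    rw [Matrix.mul_apply]
    simp only [G, G', Matrix.of_apply]
    rw [← hrepr, B.repr_self, Matrix.one_apply, Finsupp.single_apply]
  have hG'G : G' * G = 1 := by
    ext i j
    rw [Matrix.mul_apply]
    simp only [G, G', Matrix.of_apply]
    have := congrFun (B.sum_repr (Pi.single i 1)) j
    rw [Finset.sum_apply] at this
    simp only [Pi.smul_apply, smul_eq_mul] at this
    rw [this, Matrix.one_apply, Pi.single_apply]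
    simp [eq_comm]
  have hGa : G * a = signBlock A (Fin (Module.finrank E U₁)) (Fin (Module.finrank E U₂)) * G := by
    have hrow : ∀ i j, (G * a) i j = (B i ᵥ* a) j := fun i j => rfl
    ext i j
    rw [hrow]
    rcases i with i | i | i
    · rw [hB₀]
      have h1 := congrArg (fun u : U₀ => u.1 j) (b₀.sum_repr ⟨b₀ i ᵥ* a, hstab _ (b₀ i).2⟩)
      simp only [Submodule.coe_sum, Submodule.coe_smul, Finset.sum_apply, Pi.smul_apply,
        smul_eq_mul] at h1
      rw [← h1]
      simp [signBlock, Matrix.mul_apply, A, G, hB₀]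
    · rw [hB₁, (hU₁ _).mp (b₁ i).2]
      simp [signBlock, Matrix.mul_apply, G, Matrix.one_apply, hB₁]
    · rw [hB₂, (hU₂ _).mp (b₂ i).2]
      simp [signBlock, Matrix.mul_apply, G, Matrix.one_apply, hB₂]
  refine ⟨_, _, _, hcard.symm, A, G, G', ?_, hGG', hG'G, hGa⟩
  -- `A² - 1` is the restriction of `z` to its own image, which meets the kernel of `z` trivially.
  refine isUnit_of_vecMul_injective fun v hv => ?_
  have hGz : G * z = (Matrix.fromBlocks (A * A - 1) 0 0 0 : Matrix
      (Fin (Module.finrank E U₀) ⊕ (Fin (Module.finrank E U₁) ⊕ Fin (Module.finrank E U₂)))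
      (Fin (Module.finrank E U₀) ⊕ (Fin (Module.finrank E U₁) ⊕ Fin (Module.finrank E U₂))) E) *
        G := by
    rw [← signBlock_mul_self_sub_one, hz, Matrix.mul_sub, Matrix.sub_mul, Matrix.mul_one,
      Matrix.one_mul, ← Matrix.mul_assoc, hGa, Matrix.mul_assoc, hGa, Matrix.mul_assoc]
  have h1 : (Sum.elim v 0 ᵥ* G) ᵥ* z = 0 := by
    rw [Matrix.vecMul_vecMul, hGz, ← Matrix.vecMul_vecMul]
    have : Sum.elim v 0 ᵥ* (Matrix.fromBlocks (A * A - 1) 0 0 0 : Matrix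
        (Fin (Module.finrank E U₀) ⊕ (Fin (Module.finrank E U₁) ⊕ Fin (Module.finrank E U₂)))
        (Fin (Module.finrank E U₀) ⊕ (Fin (Module.finrank E U₁) ⊕ Fin (Module.finrank E U₂))) E) = 0 := by
      rw [Matrix.vecMul_fromBlocks]
      ext i
      rcases i with i | i <;> simp [hv]
    rw [this, Matrix.zero_vecMul]
  have h3 : Sum.elim v 0 ᵥ* G ∈ U₀ := by
    have : Sum.elim v 0 ᵥ* G = ∑ i, v i • (b₀ i).1 := by
      ext j
      simp [Matrix.vecMul, dotProduct, G, hB₀]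
    rw [this]
    exact U₀.sum_mem fun i _ => U₀.smul_mem _ (b₀ i).2
  have h4 := Submodule.disjoint_def.mp hdisj _ h1 h3
  have h5 : Sum.elim v (0 : Fin (Module.finrank E U₁) ⊕ Fin (Module.finrank E U₂) → E) = 0 := by
    rw [← Matrix.vecMul_one (Sum.elim v 0), ← hGG', ← Matrix.vecMul_vecMul, h4, Matrix.zero_vecMul]
  ext i
  exact congrFun h5 (Sum.inl i)

end DivisionRing

/-! ### Existence and uniqueness of the normal forms x(A, r, t) -/

section NormalForm

/-- An invertible rectangular matrix, after reindexing, as a unit. -/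
def unitOfInverse {R : Type*} [Ring R] {ι n : Type*} [Fintype ι] [DecidableEq ι] [Fintype n]
    [DecidableEq n] (e : ι ≃ n) (G : Matrix ι n R) (G' : Matrix n ι R) (h : G * G' = 1)
    (h' : G' * G = 1) : (Matrix n n R)ˣ where
  val := G'.submatrix id e.symm
  inv := G.submatrix e.symm id
  val_inv := by rw [Matrix.submatrix_mul_equiv, h', Matrix.submatrix_id_id]
  inv_val := by
    rw [← Matrix.submatrix_mul _ _ _ id _ Function.bijective_id, h, Matrix.submatrix_one_equiv]

variable {R : Type*} [Ring R] {p q m β ρ δ τ : ℕ}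

/-- A criterion for being conjugate to a normal form, with rectangular block matrices. -/
theorem mem_conjOrbit_xMat (h2 : IsUnit (2 : R)) (hp : m + (β + ρ) = p) (hq : m + (δ + τ) = q)
    {a : Matrix (Fin p) (Fin p) R} {b : Matrix (Fin p) (Fin q) R} {c : Matrix (Fin q) (Fin p) R}
    {e : Matrix (Fin q) (Fin q) R} {A : Matrix (Fin m) (Fin m) R}
    {G : Matrix (Fin m ⊕ (Fin β ⊕ Fin ρ)) (Fin p) R}
    {G' : Matrix (Fin p) (Fin m ⊕ (Fin β ⊕ Fin ρ)) R}
    {H : Matrix (Fin m ⊕ (Fin δ ⊕ Fin τ)) (Fin q) R}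
    {H' : Matrix (Fin q) (Fin m ⊕ (Fin δ ⊕ Fin τ)) R}
    (hG : G * G' = 1) (hG' : G' * G = 1) (hH : H * H' = 1) (hH' : H' * H = 1)
    (ha : a = G' * signBlock A (Fin β) (Fin ρ) * G)
    (hb : b = G' * (Matrix.fromBlocks (A - 1) 0 0 0 :
      Matrix (Fin m ⊕ (Fin β ⊕ Fin ρ)) (Fin m ⊕ (Fin δ ⊕ Fin τ)) R) * H)
    (hc : c = H' * (Matrix.fromBlocks (A + 1) 0 0 0 :
      Matrix (Fin m ⊕ (Fin δ ⊕ Fin τ)) (Fin m ⊕ (Fin β ⊕ Fin ρ)) R) * G)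
    (he : e = H' * signBlock A (Fin δ) (Fin τ) * H) :
    Matrix.fromBlocks a b c e ∈ conjOrbit (fixedGroup R p q) (xMat p q A ρ τ) := by
  rw [mem_conjOrbit_fixedGroup h2]
  refine ⟨unitOfInverse (blockEquiv hp) G G' hG hG', unitOfInverse (blockEquiv hq) H H' hH hH', ?_⟩
  simp only [xMat, Matrix.toBlocks_fromBlocks₁₁, Matrix.toBlocks_fromBlocks₁₂,
    Matrix.toBlocks_fromBlocks₂₁, Matrix.toBlocks_fromBlocks₂₂, unitOfInverse, Units.inv_mk,
    diagBlock_eq hp, diagBlock_eq hq, corner_eq hp hq, corner_eq hq hp, Matrix.submatrix_mul_equiv,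
    Matrix.submatrix_id_id, ha, hb, hc, he]

/-- Conjugate normal forms have conjugate parameters. -/
theorem signBlock_conj [Nontrivial R] [InvariantBasisNumber R] (h2 : IsUnit (2 : R)) {m' β' ρ' : ℕ}
    (hp : m + (β + ρ) = p) (hp' : m' + (β' + ρ') = p) {A : Matrix (Fin m) (Fin m) R}
    {A' : Matrix (Fin m') (Fin m') R} (hA : IsUnit (A * A - 1)) (hA' : IsUnit (A' * A' - 1))
    (g : (Matrix (Fin p) (Fin p) R)ˣ)
    (hg : diagBlock p ρ A = g.1 * diagBlock p ρ' A' * (g⁻¹).1) :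
    m = m' ∧ ρ = ρ' ∧ ∃ (u : Matrix (Fin m) (Fin m') R) (u' : Matrix (Fin m') (Fin m) R),
      u * u' = 1 ∧ u' * u = 1 ∧ A = u * A' * u' := by
  let U := g.1.submatrix (blockEquiv hp) (blockEquiv hp')
  let U' := (g⁻¹).1.submatrix (blockEquiv hp') (blockEquiv hp)
  have hUU' : U * U' = 1 := by
    rw [Matrix.submatrix_mul_equiv, Units.mul_inv, Matrix.submatrix_one_equiv]
  have hU'U : U' * U = 1 := by
    rw [Matrix.submatrix_mul_equiv, Units.inv_mul, Matrix.submatrix_one_equiv]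
  have h1 : signBlock A (Fin β) (Fin ρ) = U * signBlock A' (Fin β') (Fin ρ') * U' := by
    rw [← diagBlock_submatrix hp, ← diagBlock_submatrix hp', Matrix.submatrix_mul_equiv,
      Matrix.submatrix_mul_equiv, hg]
  have hI : signBlock A (Fin β) (Fin ρ) * U = U * signBlock A' (Fin β') (Fin ρ') := by
    rw [h1, Matrix.mul_assoc, hU'U, Matrix.mul_one]
  have hI' : signBlock A' (Fin β') (Fin ρ') * U' = U' * signBlock A (Fin β) (Fin ρ) := by
    rw [h1, Matrix.mul_assoc, ← Matrix.mul_assoc U', hU'U, Matrix.one_mul]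
  -- Both `U` and `U'` are block diagonal, so their blocks are mutually inverse and the invariant
  -- basis number makes the sizes agree.
  obtain ⟨u, v, w, hU, hu⟩ := (signBlock_intertwine h2 hA hA' U).mp hI
  obtain ⟨u', v', w', hU', hu'⟩ := (signBlock_intertwine h2 hA' hA U').mp hI'
  rw [hU, hU', Matrix.fromBlocks_multiply, ← Matrix.fromBlocks_one, Matrix.fromBlocks_inj] at hUU' hU'U
  simp only [Matrix.mul_zero, Matrix.zero_mul, add_zero, zero_add, Matrix.fromBlocks_multiply,
    ← Matrix.fromBlocks_one, Matrix.fromBlocks_inj] at hUU' hU'U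
  have hm := Matrix.square_of_invertible _ _ hUU'.1 hU'U.1
  have hρ := Matrix.square_of_invertible _ _ hUU'.2.2.2.2.2.2 hU'U.2.2.2.2.2.2
  refine ⟨by simpa using hm, by simpa using hρ, u, u', hUU'.1, hU'U.1, ?_⟩
  rw [← hu, Matrix.mul_assoc, hUU'.1, Matrix.mul_one]

/-- The diagonal blocks suffice: the upper one determines `m`, `r` and the class of `A`, the lower
one determines `t`. -/
theorem xMat_conj [Nontrivial R] [InvariantBasisNumber R] (h2 : IsUnit (2 : R)) {m' r r' t t' : ℕ}
    (hp : m + r ≤ p) (hq : m + t ≤ q) (hp' : m' + r' ≤ p) (hq' : m' + t' ≤ q)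
    {A : Matrix (Fin m) (Fin m) R}
    {A' : Matrix (Fin m') (Fin m') R} (hA : IsUnit (A * A - 1)) (hA' : IsUnit (A' * A' - 1))
    (h : xMat p q A r t ∈ conjOrbit (fixedGroup R p q) (xMat p q A' r' t')) :
    m = m' ∧ r = r' ∧ t = t' ∧ ∃ (u : Matrix (Fin m) (Fin m') R) (u' : Matrix (Fin m') (Fin m) R),
      u * u' = 1 ∧ u' * u = 1 ∧ A = u * A' * u' := by
  obtain ⟨g, h, hgh⟩ := (mem_conjOrbit_fixedGroup h2).mp h
  simp only [xMat, Matrix.toBlocks_fromBlocks₁₁, Matrix.toBlocks_fromBlocks₁₂,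
    Matrix.toBlocks_fromBlocks₂₁, Matrix.toBlocks_fromBlocks₂₂, Matrix.fromBlocks_inj] at hgh
  obtain ⟨hm, hr, hu⟩ := signBlock_conj h2 (β := p - m - r) (β' := p - m' - r') (by omega) (by omega)
    hA hA' g hgh.1
  obtain ⟨-, ht, -⟩ := signBlock_conj h2 (β := q - m - t) (β' := q - m' - t') (by omega) (by omega)
    hA hA' h hgh.2.2.2
  exact ⟨hm, hr, ht, hu⟩

theorem xMat_mem_conjOrbit (h2 : IsUnit (2 : R)) {r t : ℕ} (hp : m + r ≤ p) (hq : m + t ≤ q)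
    {A A' : Matrix (Fin m) (Fin m) R} (h : A ∈ conjOrbit ⊤ A') :
    xMat p q A r t ∈ conjOrbit (fixedGroup R p q) (xMat p q A' r t) := by
  obtain ⟨u, -, rfl⟩ := h
  have hp' : m + ((p - m - r) + r) = p := by omega
  have hq' : m + ((q - m - t) + t) = q := by omega
  have key : ∀ β ρ : ℕ, (Matrix.fromBlocks u.1 0 0 1 : Matrix (Fin m ⊕ (Fin β ⊕ Fin ρ))
      (Fin m ⊕ (Fin β ⊕ Fin ρ)) R) * Matrix.fromBlocks (u⁻¹).1 0 0 1 = 1 := by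
    intro β ρ
    rw [Matrix.fromBlocks_multiply]
    simp
  have key' : ∀ β ρ : ℕ, (Matrix.fromBlocks (u⁻¹).1 0 0 1 : Matrix (Fin m ⊕ (Fin β ⊕ Fin ρ))
      (Fin m ⊕ (Fin β ⊕ Fin ρ)) R) * Matrix.fromBlocks u.1 0 0 1 = 1 := by
    intro β ρ
    rw [Matrix.fromBlocks_multiply]
    simp
  have h1 : ∀ ε : Matrix (Fin m) (Fin m) R, u.1 * (A' + ε) * (u⁻¹).1 =
    u.1 * A' * (u⁻¹).1 + u.1 * ε * (u⁻¹).1 := fun ε => by noncomm_ring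
  refine mem_conjOrbit_xMat h2 hp' hq'
    (G := (Matrix.fromBlocks (u⁻¹).1 0 0 1).submatrix id (blockEquiv hp').symm)
    (G' := (Matrix.fromBlocks u.1 0 0 1).submatrix (blockEquiv hp').symm id)
    (H := (Matrix.fromBlocks (u⁻¹).1 0 0 1).submatrix id (blockEquiv hq').symm)
    (H' := (Matrix.fromBlocks u.1 0 0 1).submatrix (blockEquiv hq').symm id) ?_ ?_ ?_ ?_ ?_ ?_ ?_ ?_
  · rw [Matrix.submatrix_mul_equiv, key', Matrix.submatrix_id_id]
  · rw [← Matrix.submatrix_mul _ _ _ id _ Function.bijective_id, key, Matrix.submatrix_one_equiv]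
  · rw [Matrix.submatrix_mul_equiv, key', Matrix.submatrix_id_id]
  · rw [← Matrix.submatrix_mul _ _ _ id _ Function.bijective_id, key, Matrix.submatrix_one_equiv]
  · rw [diagBlock_eq hp', signBlock, signBlock, ← Matrix.submatrix_id_id (Matrix.fromBlocks A' _ _ _),
      ← Matrix.submatrix_mul _ _ _ id _ Function.bijective_id,
      ← Matrix.submatrix_mul _ _ _ id _ Function.bijective_id, Matrix.fromBlocks_multiply,
      Matrix.fromBlocks_multiply]
    simp
  · rw [corner_eq hp' hq', ← Matrix.submatrix_id_id (Matrix.fromBlocks (A' - 1) _ _ _),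
      ← Matrix.submatrix_mul _ _ _ id _ Function.bijective_id,
      ← Matrix.submatrix_mul _ _ _ id _ Function.bijective_id, Matrix.fromBlocks_multiply,
      Matrix.fromBlocks_multiply]
    simp [mul_sub, sub_mul]
  · rw [corner_eq hq' hp', ← Matrix.submatrix_id_id (Matrix.fromBlocks (A' + 1) _ _ _),
      ← Matrix.submatrix_mul _ _ _ id _ Function.bijective_id,
      ← Matrix.submatrix_mul _ _ _ id _ Function.bijective_id, Matrix.fromBlocks_multiply,
      Matrix.fromBlocks_multiply]
    simp [mul_add, add_mul]
  · rw [diagBlock_eq hq', signBlock, signBlock, ← Matrix.submatrix_id_id (Matrix.fromBlocks A' _ _ _),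
      ← Matrix.submatrix_mul _ _ _ id _ Function.bijective_id,
      ← Matrix.submatrix_mul _ _ _ id _ Function.bijective_id, Matrix.fromBlocks_multiply,
      Matrix.fromBlocks_multiply]
    simp

theorem xMat_mem_symSpace {r t : ℕ} (hp : m + r ≤ p) (hq : m + t ≤ q)
    (A : Matrix (Fin m) (Fin m) R) : xMat p q A r t ∈ symSpace R p q := by
  have hp' : m + ((p - m - r) + r) = p := by omega
  have hq' : m + ((q - m - t) + t) = q := by omega
  rw [xMat, fromBlocks_mem_symSpace, diagBlock_eq hp', diagBlock_eq hq', corner_eq hp' hq',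
    corner_eq hq' hp']
  simp only [Matrix.submatrix_mul_equiv]
  rw [← Matrix.submatrix_one_equiv (blockEquiv hp').symm,
    ← Matrix.submatrix_one_equiv (blockEquiv hq').symm]
  simp only [← Matrix.submatrix_sub, ← Pi.sub_apply]
  have h1 : ∀ β ρ δ τ : ℕ, signBlock A (Fin β) (Fin ρ) * signBlock A (Fin β) (Fin ρ) -
      (Matrix.fromBlocks (A - 1) 0 0 0 : Matrix (Fin m ⊕ (Fin β ⊕ Fin ρ))
        (Fin m ⊕ (Fin δ ⊕ Fin τ)) R) *
      (Matrix.fromBlocks (A + 1) 0 0 0 : Matrix (Fin m ⊕ (Fin δ ⊕ Fin τ))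
        (Fin m ⊕ (Fin β ⊕ Fin ρ)) R) = 1 := by
    intro β ρ δ τ
    rw [sub_eq_iff_eq_add, add_comm, ← sub_eq_iff_eq_add, signBlock_mul_self_sub_one,
      Matrix.fromBlocks_multiply]
    simp [sub_mul, mul_add]
  have h1' : ∀ β ρ δ τ : ℕ, signBlock A (Fin β) (Fin ρ) * signBlock A (Fin β) (Fin ρ) -
      (Matrix.fromBlocks (A + 1) 0 0 0 : Matrix (Fin m ⊕ (Fin β ⊕ Fin ρ))
        (Fin m ⊕ (Fin δ ⊕ Fin τ)) R) *
      (Matrix.fromBlocks (A - 1) 0 0 0 : Matrix (Fin m ⊕ (Fin δ ⊕ Fin τ))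
        (Fin m ⊕ (Fin β ⊕ Fin ρ)) R) = 1 := by
    intro β ρ δ τ
    rw [sub_eq_iff_eq_add, add_comm, ← sub_eq_iff_eq_add, signBlock_mul_self_sub_one,
      Matrix.fromBlocks_multiply]
    simp [mul_sub, add_mul]
    abel
  refine ⟨?_, ?_, ?_, ?_⟩
  · exact congrArg (fun M => M.submatrix (blockEquiv hp').symm (blockEquiv hp').symm) (h1 _ _ _ _)
  · congr 1
    simp [signBlock, Matrix.fromBlocks_multiply, mul_sub, sub_mul]
  · congr 1
    simp [signBlock, Matrix.fromBlocks_multiply, mul_add, add_mul]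
  · exact congrArg (fun M => M.submatrix (blockEquiv hq').symm (blockEquiv hq').symm) (h1' _ _ _ _)

open scoped Matrix in
/-- The normal form of a point `x` of the symmetric space over a division ring, when
`x - θ x θ` is semisimple at `0`. -/
theorem exists_normalForm {E : Type*} [DivisionRing E] (h2 : (2 : E) ≠ 0)
    {a : Matrix (Fin p) (Fin p) E} {b : Matrix (Fin p) (Fin q) E} {c : Matrix (Fin q) (Fin p) E}
    {e : Matrix (Fin q) (Fin q) E} (hx : Matrix.fromBlocks a b c e ∈ symSpace E p q)
    (hbc : ∀ v, v ᵥ* (b * c) = 0 → v ᵥ* b = 0) (hcb : ∀ v, v ᵥ* (c * b) = 0 → v ᵥ* c = 0) :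
    ∃ (m r t : ℕ) (A : Matrix (Fin m) (Fin m) E), m + r ≤ p ∧ m + t ≤ q ∧ IsUnit (A * A - 1) ∧
      Matrix.fromBlocks a b c e ∈ conjOrbit (fixedGroup E p q) (xMat p q A r t) := by
  have h2' : IsUnit (2 : E) := isUnit_iff_ne_zero.mpr h2
  obtain ⟨haa, hab, hca, hee⟩ := fromBlocks_mem_symSpace.mp hx
  have haz : a * a - 1 = b * c := by rw [← haa]; abel
  have hez : e * e - 1 = c * b := by rw [← hee]; abel
  -- Semisimplicity of `bc = a² - 1` at `0` comes from the two kernel hypotheses in turn: `v(bc)(bc)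
  -- = 0` gives `vbcb = 0`, and then `vbc = 0`.
  obtain ⟨m, β, ρ, hp, A, G, G', hA, hG, hG', hGa⟩ := exists_signBlock h2 a (by
    rw [haz]
    intro v hv
    have h1 : v ᵥ* (b * c) ᵥ* b = 0 := hbc _ (by rwa [Matrix.vecMul_vecMul])
    have h3 : (v ᵥ* b) ᵥ* c = 0 := hcb _ (by
      rwa [Matrix.vecMul_vecMul, ← Matrix.mul_assoc, ← Matrix.vecMul_vecMul])
    rwa [Matrix.vecMul_vecMul] at h3)
  obtain ⟨m', δ, τ, hq, A', H, H', hA', hH, hH', hHe⟩ := exists_signBlock h2 e (by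
    rw [hez]
    intro v hv
    have h1 : v ᵥ* (c * b) ᵥ* c = 0 := hcb _ (by rwa [Matrix.vecMul_vecMul])
    have h3 : (v ᵥ* c) ᵥ* b = 0 := hbc _ (by
      rwa [Matrix.vecMul_vecMul, ← Matrix.mul_assoc, ← Matrix.vecMul_vecMul])
    rwa [Matrix.vecMul_vecMul] at h3)
  have hGa' : a * G' = G' * signBlock A (Fin β) (Fin ρ) := by
    rw [← Matrix.one_mul (a * G'), ← hG', Matrix.mul_assoc, ← Matrix.mul_assoc G, hGa,
      Matrix.mul_assoc, hG, Matrix.mul_one]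
  have hHe' : e * H' = H' * signBlock A' (Fin δ) (Fin τ) := by
    rw [← Matrix.one_mul (e * H'), ← hH', Matrix.mul_assoc, ← Matrix.mul_assoc H, hHe,
      Matrix.mul_assoc, hH, Matrix.mul_one]
  -- In the adapted bases `b` and `c` intertwine the diagonal blocks, so they are block diagonal.
  have hbI : signBlock A (Fin β) (Fin ρ) * (G * b * H') =
      (G * b * H') * signBlock A' (Fin δ) (Fin τ) := by
    rw [Matrix.mul_assoc, Matrix.mul_assoc G, Matrix.mul_assoc b, ← hHe', ← Matrix.mul_assoc b,
      ← hab, ← Matrix.mul_assoc, ← hGa]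
    simp only [Matrix.mul_assoc]
  have hcI : signBlock A' (Fin δ) (Fin τ) * (H * c * G') =
      (H * c * G') * signBlock A (Fin β) (Fin ρ) := by
    rw [Matrix.mul_assoc, Matrix.mul_assoc H, Matrix.mul_assoc c, ← hGa', ← Matrix.mul_assoc c,
      hca, ← Matrix.mul_assoc, ← hHe]
    simp only [Matrix.mul_assoc]
  obtain ⟨b₁, b₂, b₃, hb, hAb⟩ := (signBlock_intertwine h2' hA hA' _).mp hbI
  obtain ⟨c₁, c₂, c₃, hc, hAc⟩ := (signBlock_intertwine h2' hA' hA _).mp hcI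
  have hbcG : (G * b * H') * (H * c * G') = Matrix.fromBlocks (A * A - 1) 0 0 0 := by
    rw [← signBlock_mul_self_sub_one, Matrix.mul_assoc, Matrix.mul_assoc H, ← Matrix.mul_assoc H',
      hH', Matrix.one_mul, Matrix.mul_assoc, ← Matrix.mul_assoc b, ← haz, Matrix.sub_mul,
      Matrix.mul_sub, Matrix.one_mul, hG, Matrix.mul_assoc, hGa', ← Matrix.mul_assoc, hGa,
      Matrix.mul_assoc, ← Matrix.mul_assoc G, hG, Matrix.one_mul]
  have hcbG : (H * c * G') * (G * b * H') = Matrix.fromBlocks (A' * A' - 1) 0 0 0 := by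
    rw [← signBlock_mul_self_sub_one, Matrix.mul_assoc, Matrix.mul_assoc G, ← Matrix.mul_assoc G',
      hG', Matrix.one_mul, Matrix.mul_assoc, ← Matrix.mul_assoc c, ← hez, Matrix.sub_mul,
      Matrix.mul_sub, Matrix.one_mul, hH, Matrix.mul_assoc, hHe', ← Matrix.mul_assoc, hHe,
      Matrix.mul_assoc, ← Matrix.mul_assoc H, hH, Matrix.one_mul]
  -- On the part where `a` is `±1` the product `bc = a² - 1` vanishes, and the kernel hypothesis
  -- kills `b` itself there.
  have hb0 : Matrix.fromBlocks b₂ 0 0 b₃ = 0 := by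
    ext i j
    have h1 : ((G * b * H') * (H * c * G')) (Sum.inr i) = 0 := by
      rw [hbcG]; ext j; rcases j with j | j <;> rfl
    have h3 : G (Sum.inr i) ᵥ* b = 0 := by
      apply hbc
      have h4 : (G (Sum.inr i) ᵥ* (b * c)) ᵥ* G' = 0 := by
        rw [← h1, Matrix.mul_assoc, Matrix.mul_assoc H, ← Matrix.mul_assoc H', hH', Matrix.one_mul,
          Matrix.mul_assoc, ← Matrix.mul_assoc b, Matrix.vecMul_vecMul]
        rfl
      rw [← Matrix.vecMul_one (G (Sum.inr i) ᵥ* (b * c)), ← hG', ← Matrix.vecMul_vecMul, h4,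
        Matrix.zero_vecMul]
    have h5 : (G * b * H') (Sum.inr i) (Sum.inr j) = ((G (Sum.inr i) ᵥ* b) ᵥ* H') (Sum.inr j) := by
      rw [Matrix.vecMul_vecMul, Matrix.mul_assoc]; rfl
    rw [h3, Matrix.zero_vecMul, hb] at h5
    exact h5
  have hc0 : Matrix.fromBlocks c₂ 0 0 c₃ = 0 := by
    ext i j
    have h1 : ((H * c * G') * (G * b * H')) (Sum.inr i) = 0 := by
      rw [hcbG]; ext j; rcases j with j | j <;> rfl
    have h3 : H (Sum.inr i) ᵥ* c = 0 := by
      apply hcb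
      have h4 : (H (Sum.inr i) ᵥ* (c * b)) ᵥ* H' = 0 := by
        rw [← h1, Matrix.mul_assoc, Matrix.mul_assoc G, ← Matrix.mul_assoc G', hG', Matrix.one_mul,
          Matrix.mul_assoc, ← Matrix.mul_assoc c, Matrix.vecMul_vecMul]
        rfl
      rw [← Matrix.vecMul_one (H (Sum.inr i) ᵥ* (c * b)), ← hH', ← Matrix.vecMul_vecMul, h4,
        Matrix.zero_vecMul]
    have h5 : (H * c * G') (Sum.inr i) (Sum.inr j) = ((H (Sum.inr i) ᵥ* c) ᵥ* G') (Sum.inr j) := by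
      rw [Matrix.vecMul_vecMul, Matrix.mul_assoc]; rfl
    rw [h3, Matrix.zero_vecMul, hc] at h5
    exact h5
  rw [hb, hc, hb0, hc0, Matrix.fromBlocks_multiply, Matrix.fromBlocks_inj] at hbcG
  rw [hb, hc, hb0, hc0, Matrix.fromBlocks_multiply, Matrix.fromBlocks_inj] at hcbG
  rw [hb0] at hb
  rw [hc0] at hc
  have hbc₁ : b₁ * c₁ = A * A - 1 := by simpa using hbcG.1
  have hcb₁ : c₁ * b₁ = A' * A' - 1 := by simpa using hcbG.1
  obtain ⟨Q, hQ⟩ := hA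
  obtain ⟨Q', hQ'⟩ := hA'
  -- `c₁` intertwines `A² - 1` and `A'² - 1`, so `(A² - 1)⁻¹ b₁` is an inverse of it on both sides;
  -- in particular `m' = m`.
  have hleft : ((Q⁻¹).1 * b₁) * c₁ = 1 := by rw [Matrix.mul_assoc, hbc₁, ← hQ, Units.inv_mul]
  have hright : c₁ * ((Q⁻¹).1 * b₁) = 1 := by
    have h1 : c₁ * Q.1 = Q'.1 * c₁ := by
      rw [hQ, hQ', ← hbc₁, ← hcb₁, Matrix.mul_assoc]
    have h3 : c₁ * (Q⁻¹).1 = (Q'⁻¹).1 * c₁ := by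
      calc c₁ * (Q⁻¹).1 = (Q'⁻¹).1 * (Q'.1 * c₁) * (Q⁻¹).1 := by
            rw [← Matrix.mul_assoc (Q'⁻¹).1, Units.inv_mul, Matrix.one_mul]
        _ = (Q'⁻¹).1 * c₁ := by
            rw [← h1, Matrix.mul_assoc, Matrix.mul_assoc, Units.mul_inv, Matrix.mul_one]
    rw [← Matrix.mul_assoc, h3, Matrix.mul_assoc, hcb₁, ← hQ', Units.inv_mul]
  have hmm : m' = m := by simpa using Matrix.square_of_invertible _ _ hright hleft
  subst hmm
  obtain ⟨⟨Am, hAm⟩, ⟨Ap, hAp⟩⟩ := (isUnit_mul_self_sub_one_iff A).mp ⟨Q, hQ⟩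
  set d₁ := (Q⁻¹).1 * b₁ with hd₁
  have hfac : (A - 1) * (A + 1) = b₁ * c₁ := by rw [hbc₁]; noncomm_ring
  have hbu : b₁ * (c₁ * (Ap⁻¹).1) = A - 1 := by
    rw [← Matrix.mul_assoc, ← hfac, ← hAp, Matrix.mul_assoc, Units.mul_inv, Matrix.mul_one]
  have hcomm : A * (Ap⁻¹).1 = (Ap⁻¹).1 * A := by
    have : Commute A Ap.1 := by
      rw [hAp]; exact (Commute.refl A).add_right (Commute.one_right A)
    exact this.units_inv_right.eq
  have hAu : Ap.1 * d₁ * A' * (c₁ * (Ap⁻¹).1) = A := by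
    rw [Matrix.mul_assoc, ← Matrix.mul_assoc A', hAc, Matrix.mul_assoc c₁, hcomm,
      Matrix.mul_assoc, ← Matrix.mul_assoc d₁, hleft, Matrix.one_mul, ← Matrix.mul_assoc,
      Units.mul_inv, Matrix.one_mul]
  have huu' : (Ap.1 * d₁) * (c₁ * (Ap⁻¹).1) = 1 := by
    rw [Matrix.mul_assoc, ← Matrix.mul_assoc d₁, hleft, Matrix.one_mul, Units.mul_inv]
  have hu'u : (c₁ * (Ap⁻¹).1) * (Ap.1 * d₁) = 1 := by
    rw [Matrix.mul_assoc, ← Matrix.mul_assoc (Ap⁻¹).1, Units.inv_mul, Matrix.one_mul, hright]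
  -- The change of basis `(A + 1) c₁⁻¹` on the second copy turns `c₁` into `A + 1`, and then `b₁`
  -- into `A - 1` because `b₁ c₁ = (A - 1)(A + 1)`.
  let T : Matrix (Fin m' ⊕ (Fin δ ⊕ Fin τ)) (Fin m' ⊕ (Fin δ ⊕ Fin τ)) E :=
    Matrix.fromBlocks (Ap.1 * d₁) 0 0 1
  let T' : Matrix (Fin m' ⊕ (Fin δ ⊕ Fin τ)) (Fin m' ⊕ (Fin δ ⊕ Fin τ)) E :=
    Matrix.fromBlocks (c₁ * (Ap⁻¹).1) 0 0 1
  have hTT' : T * T' = 1 := by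
    simp only [T, T', Matrix.fromBlocks_multiply, huu']
    simp
  have hT'T : T' * T = 1 := by
    simp only [T, T', Matrix.fromBlocks_multiply, hu'u]
    simp
  refine ⟨m', ρ, τ, A, by omega, by omega, ⟨Q, hQ⟩, mem_conjOrbit_xMat h2' hp hq (G := G) (G' := G')
    (H := T * H) (H' := H' * T') hG hG' ?_ ?_ ?_ ?_ ?_ ?_⟩
  · rw [Matrix.mul_assoc, ← Matrix.mul_assoc H, hH, Matrix.one_mul, hTT']
  · rw [Matrix.mul_assoc, ← Matrix.mul_assoc T', hT'T, Matrix.one_mul, hH']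
  · rw [← hGa', Matrix.mul_assoc, hG', Matrix.mul_one]
  · have h1 : (Matrix.fromBlocks (A - 1) 0 0 0 : Matrix (Fin m' ⊕ (Fin β ⊕ Fin ρ))
        (Fin m' ⊕ (Fin δ ⊕ Fin τ)) E) * T = G * b * H' := by
      rw [hb]
      simp only [T, Matrix.fromBlocks_multiply, ← hbu]
      rw [Matrix.mul_assoc b₁, hu'u]
      simp
    rw [← Matrix.mul_assoc, Matrix.mul_assoc G', h1]
    simp only [Matrix.mul_assoc, hH', Matrix.mul_one]
    rw [← Matrix.mul_assoc, hG', Matrix.one_mul]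
  · have h1 : T' * (Matrix.fromBlocks (A + 1) 0 0 0 : Matrix (Fin m' ⊕ (Fin δ ⊕ Fin τ))
        (Fin m' ⊕ (Fin β ⊕ Fin ρ)) E) = H * c * G' := by
      rw [hc]
      simp only [T', Matrix.fromBlocks_multiply, ← hAp]
      rw [Matrix.mul_assoc c₁, Units.inv_mul]
      simp
    rw [Matrix.mul_assoc H', h1]
    simp only [Matrix.mul_assoc, hG', Matrix.mul_one]
    rw [← Matrix.mul_assoc, hH', Matrix.one_mul]
  · have h1 : T' * signBlock A (Fin δ) (Fin τ) * T = signBlock A' (Fin δ) (Fin τ) := by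
      simp only [T, T', signBlock, Matrix.fromBlocks_multiply, Matrix.zero_mul, Matrix.mul_zero,
        add_zero, zero_add, Matrix.one_mul, Matrix.mul_one]
      congr 1
      rw [← hAu]
      calc _ = (c₁ * (Ap⁻¹).1) * (Ap.1 * d₁) * A' * ((c₁ * (Ap⁻¹).1) * (Ap.1 * d₁)) := by
            simp only [Matrix.mul_assoc]
        _ = A' := by rw [hu'u, Matrix.one_mul, Matrix.mul_one]
    rw [← Matrix.mul_assoc, Matrix.mul_assoc H', Matrix.mul_assoc H', h1, ← hHe', Matrix.mul_assoc,
      hH', Matrix.mul_one]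

end NormalForm

/-! ### The components S_{p'} and the trace -/

section Component

theorem trace_thetaMat {E : Type*} [Ring E] (p q p' : ℕ) (hp' : p' ≤ p + q) :
    (thetaMat E p q p').trace = 2 * p' - (p + q) := by
  have h : ∀ N : ℕ, p' ≤ N → ∑ i : Fin N, (if (i : ℕ) < p' then (1 : E) else -1) = 2 * p' - N := by
    intro N hN
    obtain ⟨k, rfl⟩ := Nat.exists_eq_add_of_le hN
    rw [Fin.sum_univ_add]
    simp [two_mul, sub_eq_add_neg]
    abel
  rw [thetaMat, Matrix.trace_diagonal, Equiv.sum_comp finSumFinEquiv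
    (fun i : Fin (p + q) => if (i : ℕ) < p' then (1 : E) else -1), h _ hp', Nat.cast_add]

/-- The trace over `F` of a matrix with coefficients in an `F`-algebra. -/
noncomputable def traceOver (F : Type*) [Field F] {E : Type*} [Ring E] [Algebra F E]
    {n : Type*} [Fintype n] (M : Matrix n n E) : F :=
  LinearMap.trace F E (LinearMap.mulLeft F M.trace)

section

variable {F : Type*} [Field F] {E : Type*} [Ring E] [Algebra F E] {n : Type*} [Fintype n]

theorem trace_fromBlocks {R l m : Type*} [AddCommMonoid R] [Fintype l] [Fintype m]
    (A : Matrix l l R) (B : Matrix l m R) (C : Matrix m l R) (D : Matrix m m R) :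
    (Matrix.fromBlocks A B C D).trace = A.trace + D.trace := by
  simp [Matrix.trace]

/-- The matrix trace itself is not symmetric over a noncommutative ring; following it by the trace
of left multiplication repairs this. -/
theorem traceOver_mul_comm (M N : Matrix n n E) : traceOver F (M * N) = traceOver F (N * M) := by
  have h : ∀ a b : E, LinearMap.trace F E (LinearMap.mulLeft F (a * b)) =
      LinearMap.trace F E (LinearMap.mulLeft F (b * a)) := fun a b => by
    rw [LinearMap.mulLeft_mul, LinearMap.mulLeft_mul]
    exact LinearMap.trace_mul_comm F _ _
  have hs : ∀ f : n → n → E, LinearMap.trace F E (LinearMap.mulLeft F (∑ i, ∑ j, f i j)) =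
      ∑ i, ∑ j, LinearMap.trace F E (LinearMap.mulLeft F (f i j)) := fun f => by
    have : ∀ a, LinearMap.trace F E (LinearMap.mulLeft F a) =
      (LinearMap.trace F E ∘ₗ LinearMap.mul F E) a := fun a => rfl
    simp only [this, map_sum]
  simp only [traceOver, Matrix.trace, Matrix.diag_apply, Matrix.mul_apply, hs]
  rw [Finset.sum_comm]
  simp only [h (M _ _)]

theorem traceOver_conj [DecidableEq n] (g : (Matrix n n E)ˣ) (M : Matrix n n E) :
    traceOver F (g.1 * M * (g⁻¹).1) = traceOver F M := by
  rw [traceOver_mul_comm, ← mul_assoc, Units.inv_mul, one_mul]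

theorem traceOver_of_trace_eq_intCast [FiniteDimensional F E] {M : Matrix n n E} {k : ℤ}
    (h : M.trace = k) : traceOver F M = k * Module.finrank F E := by
  have h1 : LinearMap.mulLeft F (k : E) = (k : F) • LinearMap.id := by
    ext a
    simp [Algebra.smul_def]
  rw [traceOver, h, h1, map_smul, LinearMap.trace_id, smul_eq_mul]

end

variable {F : Type*} [Field F] [CharZero F] {E : Type*} [DivisionRing E] [Algebra F E]
  [FiniteDimensional F E] {p q : ℕ}

theorem mul_thetaMat_mul_thetaMat {R : Type*} [Ring R]
    (x : Matrix (Fin p ⊕ Fin q) (Fin p ⊕ Fin q) R) :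
    x * thetaMat R p q p * thetaMat R p q p = x := by
  rw [mul_assoc, thetaMat_mul_self, mul_one]

theorem symComponent_subset_symSpace {R : Type*} [Ring R] (p' : ℕ) :
    symComponent R p q p' ⊆ symSpace R p q := by
  rintro _ ⟨g, rfl⟩
  rw [symSpace, Set.mem_ofPred_eq, mul_assoc _ (thetaMat R p q p), thetaMat_mul_self, mul_one, sq]
  calc _ = g.1 * thetaMat R p q p' * ((g⁻¹).1 * g.1) * thetaMat R p q p' * (g⁻¹).1 := by
        simp only [mul_assoc]
    _ = 1 := by rw [Units.inv_mul, mul_one, mul_assoc g.1, thetaMat_mul_self, mul_one, Units.mul_inv]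

omit [CharZero F] in
theorem traceOver_of_mem_symComponent {R : Type*} [Ring R] [Algebra F R] [FiniteDimensional F R]
    {p' : ℕ} (hp' : p' ≤ p + q) {x : Matrix (Fin p ⊕ Fin q) (Fin p ⊕ Fin q) R}
    (hx : x ∈ symComponent R p q p') :
    traceOver F (x * thetaMat R p q p) = (2 * p' - (p + q) : ℤ) * Module.finrank F R := by
  obtain ⟨g, rfl⟩ := hx
  rw [mul_thetaMat_mul_thetaMat, traceOver_conj]
  exact traceOver_of_trace_eq_intCast (by rw [trace_thetaMat p q p' hp']; push_cast; rfl)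

theorem mem_symComponent_of_mem_conjOrbit {R : Type*} [Ring R] {p' : ℕ}
    {x y : Matrix (Fin p ⊕ Fin q) (Fin p ⊕ Fin q) R} (hx : x ∈ symComponent R p q p')
    (h : y ∈ conjOrbit (fixedGroup R p q) x) : y ∈ symComponent R p q p' := by
  obtain ⟨k, rfl⟩ := hx
  obtain ⟨g, hg, rfl⟩ := h
  rw [mem_fixedGroup_iff] at hg
  have hg' : (g⁻¹).1 * thetaMat R p q p = thetaMat R p q p * (g⁻¹).1 :=
    (show Commute _ _ from hg).units_inv_left.eq
  refine ⟨g * k, ?_⟩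
  rw [mul_inv_rev, Units.val_mul, Units.val_mul]
  simp only [mul_assoc, hg']

/-- `x θ` is an involution, so it is conjugate to `diag(1, -1)`: the block `A` of `exists_signBlock`
satisfies `A² - 1 = 0`, which is invertible only in size `0`. The index `k` is the multiplicity of
the eigenvalue `1`. -/
theorem exists_mem_symComponent (h2 : (2 : E) ≠ 0)
    {x : Matrix (Fin p ⊕ Fin q) (Fin p ⊕ Fin q) E} (hx : x ∈ symSpace E p q) :
    ∃ k ≤ p + q, x ∈ symComponent E p q k := by
  let e := finSumFinEquiv (m := p) (n := q)
  set ε := x * thetaMat E p q p with hε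
  have hε2 : ε * ε = 1 := by rw [← sq]; exact hx
  let a := ε.submatrix e.symm e.symm
  have ha : a * a = 1 := by
    simp only [a, Matrix.submatrix_mul_equiv, hε2, Matrix.submatrix_one_equiv]
  obtain ⟨m, β, ρ, hN, A, G, G', hA, hG, hG', hGa⟩ := exists_signBlock h2 a (by simp [ha])
  have hsb : signBlock A (Fin β) (Fin ρ) * signBlock A (Fin β) (Fin ρ) = 1 := by
    have h1 : signBlock A (Fin β) (Fin ρ) = G * a * G' := by
      rw [hGa, Matrix.mul_assoc, hG, Matrix.mul_one]
    rw [h1, Matrix.mul_assoc, ← Matrix.mul_assoc G', ← Matrix.mul_assoc G', hG', Matrix.one_mul,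
      Matrix.mul_assoc, ← Matrix.mul_assoc a, ha, Matrix.one_mul, hG]
  have hA0 : A * A - 1 = 0 := by
    have h1 := signBlock_mul_self_sub_one (β := Fin β) (ρ := Fin ρ) A
    rw [hsb, sub_self, ← Matrix.fromBlocks_zero, Matrix.fromBlocks_inj] at h1
    exact h1.1.symm
  obtain rfl : m = 0 := by
    by_contra hm
    have : NeZero m := ⟨hm⟩
    rw [hA0] at hA
    exact not_isUnit_zero hA
  refine ⟨β, by omega, unitOfInverse ((blockEquiv hN).trans e.symm) (G.submatrix id e)
    (G'.submatrix e id) ?_ ?_, ?_⟩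
  · rw [Matrix.submatrix_mul_equiv, hG, Matrix.submatrix_id_id]
  · rw [← Matrix.submatrix_mul _ _ _ id _ Function.bijective_id, hG', Matrix.submatrix_one_equiv]
  · have hθ : thetaMat E p q β = (signBlock A (Fin β) (Fin ρ)).submatrix
        ((blockEquiv hN).trans e.symm).symm ((blockEquiv hN).trans e.symm).symm := by
      have h1 : thetaMat E p q β = (diagBlock (p + q) ρ A).submatrix e e := by
        rw [thetaMat, diagBlock, Matrix.submatrix_add, Pi.add_apply, Pi.add_apply,
          Matrix.submatrix_diagonal_equiv]
        ext i j
        have h3 : ((e i : ℕ) < β) ↔ ((e i : ℕ) + ρ < p + q) := by omega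
        simp [corner, Matrix.diagonal_apply, e, ← h3]
      rw [h1, diagBlock_eq hN, Matrix.submatrix_submatrix]
      rfl
    have hεa : ε = a.submatrix e e := by
      simp [a, Matrix.submatrix_submatrix]
    have haG : a = G' * signBlock A (Fin β) (Fin ρ) * G := by
      rw [Matrix.mul_assoc, ← hGa, ← Matrix.mul_assoc, hG', Matrix.one_mul]
    rw [← mul_thetaMat_mul_thetaMat x, ← hε, hθ, hεa, haG]
    congr 1
    simp only [unitOfInverse, Units.inv_mk, Matrix.submatrix_submatrix, Function.id_comp,
      Function.comp_id, Matrix.submatrix_mul_equiv]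

/-- In characteristic zero the trace of the involution `x θ` determines the multiplicity of its
eigenvalue `1`, hence the component. -/
theorem mem_symComponent_iff (F : Type*) [Field F] [CharZero F] [Algebra F E]
    [FiniteDimensional F E]
    {x : Matrix (Fin p ⊕ Fin q) (Fin p ⊕ Fin q) E} (hx : x ∈ symSpace E p q) {p' : ℕ}
    (hp' : p' ≤ p + q) : x ∈ symComponent E p q p' ↔
      traceOver F (x * thetaMat E p q p) = (2 * p' - (p + q) : ℤ) * Module.finrank F E := by
  refine ⟨traceOver_of_mem_symComponent hp', fun h => ?_⟩
  have h2 : (2 : E) ≠ 0 := by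
    have := (map_ne_zero (algebraMap F E)).mpr (two_ne_zero (α := F))
    rwa [map_ofNat] at this
  obtain ⟨k, hk, hxk⟩ := exists_mem_symComponent h2 hx
  rw [traceOver_of_mem_symComponent hk hxk] at h
  have h0 : (Module.finrank F E : F) ≠ 0 := by exact_mod_cast Module.finrank_pos.ne'
  have h1 := mul_right_cancel₀ h0 h
  rw [Int.cast_inj] at h1
  obtain rfl : k = p' := by omega
  exact hxk

/-- The two copies of `A` enter with opposite signs, so only the `±1` blocks contribute. -/
theorem trace_xMat_mul_thetaMat {R : Type*} [Ring R] {m r t : ℕ} (hp : m + r ≤ p) (hq : m + t ≤ q)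
    (A : Matrix (Fin m) (Fin m) R) :
    (xMat p q A r t * thetaMat R p q p).trace = ((p - q - 2 * r + 2 * t : ℤ) : R) := by
  have h : ∀ {β ρ a : ℕ} (h : m + (β + ρ) = a),
      (diagBlock a ρ A).trace = A.trace + ((β - ρ : ℤ) : R) := by
    intro β ρ a h
    rw [diagBlock_eq h]
    have : ((signBlock A (Fin β) (Fin ρ)).submatrix (blockEquiv h).symm (blockEquiv h).symm).trace =
        (signBlock A (Fin β) (Fin ρ)).trace :=
      Equiv.sum_comp (blockEquiv h).symm fun i => signBlock A (Fin β) (Fin ρ) i i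
    rw [this, signBlock, trace_fromBlocks, trace_fromBlocks]
    simp [sub_eq_add_neg]
  rw [xMat, thetaMat_eq, Matrix.fromBlocks_multiply, trace_fromBlocks]
  simp only [Matrix.mul_one, Matrix.mul_zero, add_zero, Matrix.mul_neg, zero_add, Matrix.trace_neg]
  rw [h (β := p - m - r) (by omega), h (β := q - m - t) (by omega), ← sub_eq_add_neg,
    add_sub_add_left_eq_sub, ← Int.cast_sub]
  congr 1
  omega

theorem xMat_mem_symComponent_iff (F : Type*) [Field F] [CharZero F] [Algebra F E]
    [FiniteDimensional F E] {p' : ℕ} (hp' : p' ≤ p + q) {m r t : ℕ} (hp : m + r ≤ p)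
    (hq : m + t ≤ q) (A : Matrix (Fin m) (Fin m) E) :
    xMat p q A r t ∈ symComponent E p q p' ↔ (t : ℤ) - r = (p' : ℤ) - p := by
  rw [mem_symComponent_iff F (xMat_mem_symSpace hp hq A) hp',
    traceOver_of_trace_eq_intCast (trace_xMat_mul_thetaMat hp hq A)]
  have h0 : (Module.finrank F E : F) ≠ 0 := by exact_mod_cast Module.finrank_pos.ne'
  rw [mul_left_inj' h0, Int.cast_inj]
  omega

end Component

theorem card_le_finrank_of_mem {K V ι : Type*} [Field K] [AddCommGroup V] [Module K V]
    [FiniteDimensional K V] [Fintype ι] (S : Submodule K V) {v : ι → V} (h : LinearIndependent K v)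
    (hv : ∀ i, v i ∈ S) : Fintype.card ι ≤ Module.finrank K S := by
  rw [← finrank_span_eq_card h]
  exact Submodule.finrank_mono (Submodule.span_le.mpr (by rintro _ ⟨i, rfl⟩; exact hv i))

/-! ### Semicontinuity along a line -/

section Generic

variable {K : Type*} [Field K]

/-- Linear independence of polynomial families of vectors is an open condition on a line. -/
theorem exists_forall_linearIndependent {W V ι : Type*} [AddCommGroup W] [Module K W]
    [AddCommGroup V] [Module K V] [Fintype ι] [DecidableEq ι] {v : W → ι → V}
    (hv : ∀ (l : V →ₗ[K] K) (i : ι), IsPolyFun K (fun w => l (v w i))) {w₀ w₁ : W} (s₀ : K)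
    (h : LinearIndependent K (v (w₀ + s₀ • w₁))) :
    ∃ f : K[X], f.eval s₀ ≠ 0 ∧ ∀ s, f.eval s ≠ 0 → LinearIndependent K (v (w₀ + s • w₁)) := by
  -- `Q` sends the vectors at `s₀` to the standard basis. The determinant of their `Q`-coordinates
  -- is polynomial along the line, equals `1` at `s₀`, and forces independence wherever it is
  -- nonzero.
  obtain ⟨Q, hQ⟩ := LinearMap.exists_leftInverse_of_injective
    (Fintype.linearCombination K (v (w₀ + s₀ • w₁)))
    (LinearMap.ker_eq_bot.mpr h.fintypeLinearCombination_injective)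
  obtain ⟨f, hf⟩ := (IsPolyFun.det (M := fun w => Matrix.of fun i j => Q (v w i) j)
    fun i j => hv (LinearMap.proj j ∘ₗ Q) i).exists_line w₀ w₁
  refine ⟨f, ?_, fun s hs => ?_⟩
  · have h1 : (Matrix.of fun i j => Q (v (w₀ + s₀ • w₁) i) j) = 1 := by
      ext i j
      have := congrFun (LinearMap.congr_fun hQ (Pi.single i 1)) j
      rw [LinearMap.comp_apply, Fintype.linearCombination_apply_single, one_smul] at this
      rw [Matrix.of_apply, this, Matrix.one_apply, LinearMap.id_apply, Pi.single_apply]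
      simp only [eq_comm]
    rw [hf]
    simp only [h1, Matrix.det_one, ne_eq, one_ne_zero, not_false_eq_true]
  · rw [hf] at hs
    exact LinearIndependent.of_comp Q (Matrix.linearIndependent_rows_of_det_ne_zero hs)

/-- Semicontinuity of the dimension of the kernel along a line. -/
theorem le_finrank_ker_of_line [Infinite K] {V W : Type*} [AddCommGroup V] [Module K V] [FiniteDimensional K V]
    [AddCommGroup W] [Module K W] [FiniteDimensional K W] (L₀ L₁ : V →ₗ[K] W) {k : ℕ} {f : K[X]}
    (hf : f ≠ 0) (h : ∀ s, f.eval s ≠ 0 → k ≤ Module.finrank K (LinearMap.ker (L₀ + s • L₁))) :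
    k ≤ Module.finrank K (LinearMap.ker L₀) := by
  -- Lifts by `S` of a basis of the range of `L₀` keep independent images for generic `s`. The
  -- generic rank is thus at least that of `L₀`, and the generic kernel is no larger.
  obtain ⟨S, hS⟩ := LinearMap.exists_rightInverse_of_surjective L₀.rangeRestrict
    (LinearMap.range_rangeRestrict L₀)
  let b := Module.finBasis K (LinearMap.range L₀)
  obtain ⟨g, hg0, hg⟩ := exists_forall_linearIndependent (K := K) (w₀ := L₀) (w₁ := L₁)
    (v := fun L i => L (S (b i))) (fun l i => IsPolyFun.linear
      (l ∘ₗ LinearMap.applyₗ (S (b i)) : (V →ₗ[K] W) →ₗ[K] K)) 0 (by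
      have : (fun i => (L₀ + (0 : K) • L₁) (S (b i))) = fun i => (b i : W) := by
        ext i
        rw [zero_smul, add_zero]
        exact congrArg Subtype.val (LinearMap.congr_fun hS (b i))
      rw [this]
      exact b.linearIndependent.map' (Submodule.subtype _) (Submodule.ker_subtype _))
  obtain ⟨s, hs⟩ := exists_eval_ne_zero (mul_ne_zero hf (by rintro rfl; simp at hg0 : g ≠ 0))
  rw [eval_mul] at hs
  have h1 := h s (left_ne_zero_of_mul hs)
  have h2 : Module.finrank K (LinearMap.range L₀) ≤ Module.finrank K (LinearMap.range (L₀ + s • L₁)) := by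
    have := (hg s (right_ne_zero_of_mul hs))
    have h3 : LinearIndependent K (fun i => (⟨(L₀ + s • L₁) (S (b i)), LinearMap.mem_range_self _ _⟩ :
        LinearMap.range (L₀ + s • L₁))) := LinearIndependent.of_comp (Submodule.subtype _) this
    simpa using h3.fintype_card_le_finrank
  have h3 := LinearMap.finrank_range_add_finrank_ker L₀
  have h4 := LinearMap.finrank_range_add_finrank_ker (L₀ + s • L₁)
  omega

end Generic

/-! ### Centralizers and conjugacy of diagonalizable matrices -/

section Centralizer

variable {K : Type*} [Field K]

theorem finrank_subalgebra_eq_of_algEquiv {A B : Type*} [Ring A] [Algebra K A] [Ring B] [Algebra K B]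
    (e : A ≃ₐ[K] B) {S : Subalgebra K A} {T : Subalgebra K B} (h : ∀ a, e a ∈ T ↔ a ∈ S) :
    Module.finrank K S = Module.finrank K T := by
  have h1 : S.toSubmodule.map (e.toLinearEquiv : A →ₗ[K] B) = T.toSubmodule := by
    ext b
    constructor
    · rintro ⟨a, ha, rfl⟩
      exact (h a).mpr ha
    · intro hb
      exact ⟨e.symm b, (h _).mp (by rwa [AlgEquiv.apply_symm_apply]), e.apply_symm_apply b⟩
  rw [← Subalgebra.finrank_toSubmodule, ← Subalgebra.finrank_toSubmodule, ← h1]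
  exact (e.toLinearEquiv.submoduleMap S.toSubmodule).finrank_eq

variable {m : ℕ}

theorem finrank_centralizer_diagonal {v : Fin m → K} (hv : Function.Injective v) :
    Module.finrank K (Subalgebra.centralizer K {Matrix.diagonal v}) = m := by
  have h : (Subalgebra.centralizer K {Matrix.diagonal v}).toSubmodule =
      LinearMap.range (Matrix.diagonalLinearMap (Fin m) K K) := by
    ext M
    rw [Subalgebra.mem_toSubmodule, Subalgebra.mem_centralizer_iff]
    simp only [Set.mem_singleton_iff, forall_eq]
    constructor
    · intro h
      refine ⟨M.diag, ?_⟩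
      ext i j
      have h1 := congrFun (congrFun h i) j
      rw [Matrix.diagonal_mul, Matrix.mul_diagonal, mul_comm] at h1
      by_cases hij : i = j
      · subst hij; simp
      · by_contra hne
        apply hij
        apply hv
        refine mul_left_cancel₀ (a := M i j) ?_ h1
        intro h0
        apply hne
        simp [Matrix.diagonal_apply_ne _ hij, h0]
    · rintro ⟨w, rfl⟩
      simp [Matrix.diagonal_mul_diagonal, mul_comm]
  have : Module.finrank K (Subalgebra.centralizer K {Matrix.diagonal v}).toSubmodule = m := by
    rw [h, LinearMap.finrank_range_of_inj Matrix.diagonal_injective]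
    simp
  exact this

/-- The `m` diagonal matrix units and the unit at `(i, j)` all commute with the matrix. -/
theorem lt_finrank_centralizer_diagonal {v : Fin m → K} {i j : Fin m} (hij : i ≠ j)
    (h : v i = v j) :
    m < Module.finrank K (Subalgebra.centralizer K {Matrix.diagonal v}) := by
  have h1 : LinearIndependent K (fun o : Option (Fin m) =>
      (o.elim (Matrix.single i j 1) (fun k => Matrix.single k k 1) : Matrix (Fin m) (Fin m) K)) := by
    have h2 := (Matrix.stdBasis K (Fin m) (Fin m)).linearIndependent.comp
      (fun o : Option (Fin m) => (o.elim (i, j) fun k => (k, k))) (by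
        rintro (_ | k) (_ | l) <;> simp
        · intro h1 h2; exact hij (h1.trans h2.symm)
        · intro h1 h2; exact hij (h1.symm.trans h2))
    have h3 : (fun o : Option (Fin m) => (o.elim (Matrix.single i j 1)
        (fun k => Matrix.single k k 1) : Matrix (Fin m) (Fin m) K)) =
        Matrix.stdBasis K (Fin m) (Fin m) ∘ fun o => (o.elim (i, j) fun k => (k, k)) := by
      ext o : 1
      rcases o with _ | k <;> simp [Matrix.stdBasis_eq_single]
    rw [h3]
    exact h2
  have h2 : ∀ o : Option (Fin m), (o.elim (Matrix.single i j 1) (fun k => Matrix.single k k 1) :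
      Matrix (Fin m) (Fin m) K) ∈ Subalgebra.centralizer K {Matrix.diagonal v} := by
    rintro (_ | k) <;> rw [Subalgebra.mem_centralizer_iff] <;>
      simp only [Set.mem_singleton_iff, forall_eq, Option.elim]
    · ext a b
      simp only [Matrix.diagonal_mul, Matrix.mul_diagonal, Matrix.single_apply]
      split_ifs with hab
      · rw [← hab.1, ← hab.2, h, mul_comm]
      · simp
    · ext a b
      simp only [Matrix.diagonal_mul, Matrix.mul_diagonal, Matrix.single_apply]
      split_ifs with hab
      · rw [← hab.1, ← hab.2, mul_comm]
      · simp
  have := card_le_finrank_of_mem (Subalgebra.centralizer K {Matrix.diagonal v}).toSubmodule h1 h2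
  rw [Fintype.card_option, Fintype.card_fin] at this
  exact this

/-- On the line from `B` to a diagonal matrix with distinct entries, the powers `1, C, …, C^(m-1)`
are generically independent and centralize `C`. Semicontinuity of the kernel of the commutator map
brings the bound back to `B`. -/
theorem le_finrank_centralizer [Infinite K] (B : Matrix (Fin m) (Fin m) K) :
    m ≤ Module.finrank K (Subalgebra.centralizer K {B}) := by
  let comm (C : Matrix (Fin m) (Fin m) K) : Matrix (Fin m) (Fin m) K →ₗ[K] Matrix (Fin m) (Fin m) K :=
    LinearMap.mulLeft K C - LinearMap.mulRight K C
  have hk : ∀ C, LinearMap.ker (comm C) = (Subalgebra.centralizer K {C}).toSubmodule := fun C => by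
    ext M
    simp [comm, Subalgebra.mem_centralizer_iff, sub_eq_zero]
  obtain ⟨v, hv⟩ : ∃ v : Fin m → K, Function.Injective v :=
    ⟨_, (Infinite.natEmbedding K).injective.comp Fin.val_injective⟩
  have hli : LinearIndependent K (fun i : Fin m => (Matrix.diagonal v) ^ (i : ℕ)) := by
    have h1 := Matrix.linearIndependent_rows_of_det_ne_zero
      (Matrix.det_transpose (Matrix.vandermonde v) ▸ Matrix.det_vandermonde_ne_zero_iff.mpr hv)
    have h2 := h1.map' (Matrix.diagonalLinearMap (Fin m) K K)
      (LinearMap.ker_eq_bot.mpr Matrix.diagonal_injective)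
    have h3 : (fun i : Fin m => (Matrix.diagonal v) ^ (i : ℕ)) =
        Matrix.diagonalLinearMap (Fin m) K K ∘ fun i => (Matrix.vandermonde v).transpose i := by
      ext i : 1
      rw [Matrix.diagonal_pow]
      rfl
    rw [h3]
    exact h2
  obtain ⟨f, hf1, hf⟩ := exists_forall_linearIndependent (K := K) (w₀ := B)
    (w₁ := Matrix.diagonal v - B) (v := fun C (i : Fin m) => C ^ (i : ℕ)) (fun l i => by
      have h1 := (IsPolyMap.linear (LinearMap.id (R := K) (M := Matrix (Fin m) (Fin m) K))).aeval
        (X ^ (i : ℕ))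
      have h2 : (fun w : Matrix (Fin m) (Fin m) K => l (w ^ (i : ℕ))) = fun w =>
          ∑ a, ∑ b, l (Matrix.single a b 1) * (aeval w (X ^ (i : ℕ) : K[X])) a b := by
        ext w
        conv_lhs => rw [Matrix.matrix_eq_sum_single (w ^ (i : ℕ))]
        simp only [map_sum, map_pow, aeval_X]
        refine Finset.sum_congr rfl fun a _ => Finset.sum_congr rfl fun b _ => ?_
        rw [← mul_one ((w ^ (i : ℕ)) a b), ← smul_eq_mul, ← Matrix.smul_single, map_smul, smul_eq_mul,
          smul_eq_mul, mul_one, mul_comm]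
      rw [h2]
      exact .sum _ fun a => .sum _ fun b => (IsPolyFun.const _).mul (h1 a b)) 1 (by simpa using hli)
  have := le_finrank_ker_of_line (comm B) (comm (Matrix.diagonal v - B)) (k := m)
    (f := f) (by rintro rfl; simp at hf1) (fun s hs => by
      have h1 : comm B + s • comm (Matrix.diagonal v - B) = comm (B + s • (Matrix.diagonal v - B)) := by
        ext M : 1
        simp [comm, add_mul, mul_add, smul_sub, sub_mul, mul_sub]
        abel
      rw [h1, hk]
      have h2 := hf s hs
      have h3 := card_le_finrank_of_mem
        (Subalgebra.centralizer K {B + s • (Matrix.diagonal v - B)}).toSubmodule h2 fun i =>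
          (Subalgebra.mem_toSubmodule (S := Subalgebra.centralizer K _)).mpr
            (pow_mem ((Subalgebra.mem_centralizer_iff K).mpr (by simp)) _)
      rwa [Fintype.card_fin] at h3)
  rw [hk] at this
  exact this

/-- Conjugation by a unit, with the two inverse elements given separately. -/
def conjEquiv {ι n : Type*} [Fintype ι] [DecidableEq ι] [Fintype n] [DecidableEq n]
    {u : Matrix ι n K} {u' : Matrix n ι K} (h : u * u' = 1) (h' : u' * u = 1) :
    Matrix n n K ≃ₐ[K] Matrix ι ι K :=
  AlgEquiv.ofAlgHom
    (AlgHom.ofLinearMap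
      { toFun := fun x => u * x * u'
        map_add' := fun x y => by rw [Matrix.mul_add, Matrix.add_mul]
        map_smul' := fun c x => by simp }
      (by simp [h])
      (fun x y => by
        change u * (x * y) * u' = u * x * u' * (u * y * u')
        rw [Matrix.mul_assoc (u * x), ← Matrix.mul_assoc u', ← Matrix.mul_assoc u', h',
          Matrix.one_mul]
        simp only [Matrix.mul_assoc]))
    (AlgHom.ofLinearMap
      { toFun := fun x => u' * x * u
        map_add' := fun x y => by rw [Matrix.mul_add, Matrix.add_mul]
        map_smul' := fun c x => by simp }
      (by simp [h'])
      (fun x y => by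
        change u' * (x * y) * u = u' * x * u * (u' * y * u)
        rw [Matrix.mul_assoc (u' * x), ← Matrix.mul_assoc u, ← Matrix.mul_assoc u, h,
          Matrix.one_mul]
        simp only [Matrix.mul_assoc]))
    (by
      ext1 x
      change u * (u' * x * u) * u' = x
      rw [← Matrix.mul_assoc, ← Matrix.mul_assoc, h, Matrix.one_mul, Matrix.mul_assoc, h,
        Matrix.mul_one])
    (by
      ext1 x
      change u' * (u * x * u') * u = x
      rw [← Matrix.mul_assoc, ← Matrix.mul_assoc, h', Matrix.one_mul, Matrix.mul_assoc, h',
        Matrix.mul_one])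

theorem conjEquiv_apply {ι n : Type*} [Fintype ι] [DecidableEq ι] [Fintype n] [DecidableEq n]
    {u : Matrix ι n K} {u' : Matrix n ι K} (h : u * u' = 1) (h' : u' * u = 1) (x : Matrix n n K) :
    conjEquiv h h' x = u * x * u' := rfl

theorem finrank_centralizer_algEquiv {A B : Type*} [Ring A] [Algebra K A] [Ring B] [Algebra K B]
    (e : A ≃ₐ[K] B) (x : A) : Module.finrank K (Subalgebra.centralizer K {e x}) =
      Module.finrank K (Subalgebra.centralizer K {x}) := by
  refine (finrank_subalgebra_eq_of_algEquiv e fun a => ?_).symm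
  simp only [Subalgebra.mem_centralizer_iff, Set.mem_singleton_iff, forall_eq, ← map_mul,
    e.injective.eq_iff]

/-- A matrix annihilated by a separable polynomial is diagonalizable over an algebraically closed
field. -/
theorem exists_diagonal_of_separable [IsAlgClosed K] {A : Matrix (Fin m) (Fin m) K} {f : K[X]}
    (hf : f.Separable) (hA : aeval A f = 0) :
    ∃ (u u' : Matrix (Fin m) (Fin m) K) (v : Fin m → K), u * u' = 1 ∧ u' * u = 1 ∧
      A = u * Matrix.diagonal v * u' := by
  let T : Module.End K (Fin m → K) := Matrix.toLin' A
  have hT : T.IsSemisimple := Module.End.isSemisimple_of_squarefree_aeval_eq_zero hf.squarefree (by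
    have := Polynomial.aeval_algHom_apply (Matrix.toLinAlgEquiv' (R := K) (n := Fin m)).toAlgHom A f
    rw [hA, map_zero] at this
    exact this)
  have hspan : ⊤ ≤ Submodule.span K {w : Fin m → K | ∃ c : K, T w = c • w} := by
    rw [← hT.iSup_eigenspace_eq_top, iSup_le_iff]
    exact fun c w hw => Submodule.subset_span ⟨c, Module.End.mem_eigenspace_iff.mp hw⟩
  let b₀ := Module.Basis.ofSpan hspan
  have : Fintype _ := FiniteDimensional.fintypeBasisIndex b₀
  let b := b₀.reindex (Fintype.equivFinOfCardEq (by
    rw [← Module.finrank_eq_card_basis b₀, Module.finrank_fin_fun]) : _ ≃ Fin m)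
  have hb : ∀ i, ∃ c : K, T (b i) = c • b i := fun i => by
    rw [Module.Basis.reindex_apply]
    exact Module.Basis.ofSpan_subset hspan ⟨_, rfl⟩
  choose v hv using hb
  let u : Matrix (Fin m) (Fin m) K := (Pi.basisFun K (Fin m)).toMatrix b
  let u' : Matrix (Fin m) (Fin m) K := b.toMatrix (Pi.basisFun K (Fin m))
  have h1 : u * u' = 1 := Module.Basis.toMatrix_mul_toMatrix_flip _ _
  have h2 : u' * u = 1 := Module.Basis.toMatrix_mul_toMatrix_flip _ _
  refine ⟨u, u', v, h1, h2, ?_⟩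
  have h3 : A * u = u * Matrix.diagonal v := by
    ext i j
    have := congrFun (hv j) i
    rw [Matrix.mul_diagonal, mul_comm]
    simpa [T, u, Matrix.mul_apply, Matrix.mulVec, dotProduct, Module.Basis.toMatrix_apply] using this
  rw [← h3, Matrix.mul_assoc, h1, Matrix.mul_one]

theorem charpoly_conj {n R : Type*} [Fintype n] [DecidableEq n] [CommRing R] {u u' : Matrix n n R}
    (h : u' * u = 1) (x : Matrix n n R) :
    (u * x * u').charpoly = x.charpoly := by
  rw [Matrix.charpoly_mul_comm, ← Matrix.mul_assoc, h, Matrix.one_mul]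

theorem exists_perm_of_map_univ_eq {n α : Type*} [Fintype n] {v z : n → α}
    (h : Finset.univ.val.map v = Finset.univ.val.map z) : ∃ σ : Equiv.Perm n, v = z ∘ σ := by
  classical
  have h1 : ∀ c, Nonempty ({i // v i = c} ≃ {i // z i = c}) := fun c => by
    rw [← Fintype.card_eq, Fintype.card_subtype, Fintype.card_subtype]
    have := congrArg (Multiset.count c) h
    rw [Multiset.count_map, Multiset.count_map] at this
    simpa only [Finset.card, Finset.filter_val, eq_comm] using this
  let e := fun c => (h1 c).some
  refine ⟨((Equiv.sigmaFiberEquiv v).symm.trans (Equiv.sigmaCongrRight e)).trans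
    (Equiv.sigmaFiberEquiv z), ?_⟩
  ext i
  exact (e (v i) ⟨i, rfl⟩).2.symm

/-- Diagonalizable matrices with the same characteristic polynomial are conjugate. -/
theorem mem_conjOrbit_of_charpoly_eq [IsAlgClosed K] {A A' : Matrix (Fin m) (Fin m) K} {f : K[X]}
    (hf : f.Separable) (hA : aeval A f = 0) (hA' : aeval A' f = 0) (h : A.charpoly = A'.charpoly) :
    A ∈ conjOrbit ⊤ A' := by
  obtain ⟨u, u', v, hu, hu', rfl⟩ := exists_diagonal_of_separable hf hA
  obtain ⟨w, w', z, hw, hw', rfl⟩ := exists_diagonal_of_separable hf hA'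
  rw [charpoly_conj hu', charpoly_conj hw', Matrix.charpoly_diagonal, Matrix.charpoly_diagonal] at h
  have h1 : Finset.univ.val.map v = Finset.univ.val.map z := by
    have h2 : ∀ v : Fin m → K, (∏ i, (X - C (v i))).roots = Finset.univ.val.map v := fun v => by
      rw [← Polynomial.roots_multiset_prod_X_sub_C (Finset.univ.val.map v), Multiset.map_map]
      rfl
    rw [← h2, ← h2, h]
  obtain ⟨σ, rfl⟩ : ∃ σ : Equiv.Perm (Fin m), v = z ∘ σ := exists_perm_of_map_univ_eq h1
  let P : Matrix (Fin m) (Fin m) K := (1 : Matrix (Fin m) (Fin m) K).submatrix σ id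
  let P' : Matrix (Fin m) (Fin m) K := (1 : Matrix (Fin m) (Fin m) K).submatrix id σ
  have hP : P * P' = 1 := by
    rw [← Matrix.submatrix_mul _ _ _ id _ Function.bijective_id, Matrix.mul_one,
      Matrix.submatrix_one_equiv]
  have hP' : P' * P = 1 := by
    rw [Matrix.submatrix_mul_equiv, Matrix.mul_one, Matrix.submatrix_id_id]
  have hd : Matrix.diagonal (z ∘ σ) = P * Matrix.diagonal z * P' := by
    rw [← Matrix.submatrix_diagonal_equiv]
    ext i j
    simp +contextual [P, P', Matrix.mul_apply, Matrix.one_apply, Matrix.diagonal_apply]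
  have e1 : (u * P * w') * (w * P' * u') = 1 := by
    calc _ = u * (P * (w' * w) * P') * u' := by simp only [Matrix.mul_assoc]
      _ = 1 := by rw [hw', Matrix.mul_one, hP, Matrix.mul_one, hu]
  have e2 : (w * P' * u') * (u * P * w') = 1 := by
    calc _ = w * (P' * (u' * u) * P) * w' := by simp only [Matrix.mul_assoc]
      _ = 1 := by rw [hu', Matrix.mul_one, hP', Matrix.mul_one, hw]
  refine ⟨⟨_, _, e1, e2⟩, trivial, ?_⟩
  change _ = u * P * w' * (w * Matrix.diagonal z * w') * (w * P' * u')
  calc _ = u * (P * Matrix.diagonal z * P') * u' := by rw [hd]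
    _ = u * P * ((w' * w) * Matrix.diagonal z * (w' * w)) * P' * u' := by
      rw [hw', Matrix.mul_one, Matrix.one_mul]; simp only [Matrix.mul_assoc]
    _ = _ := by simp only [Matrix.mul_assoc]

end Centralizer

/-! ### Degeneration inside a closed orbit -/

section ClosedOrbit

theorem aeval_mul_of_mul_eq {K A : Type*} [CommRing K] [Ring A] [Algebra K A] {w w' a : A}
    (h : w * a = a * w') (k : K[X]) : aeval w k * a = a * aeval w' k := by
  have hp : ∀ i : ℕ, w ^ i * a = a * w' ^ i := fun i => by
    induction i with
    | zero => simp
    | succ i ih => rw [pow_succ, mul_assoc, h, ← mul_assoc, ih, mul_assoc, ← pow_succ]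
  induction k using Polynomial.induction_on' with
  | add f g hf hg => rw [map_add, map_add, add_mul, mul_add, hf, hg]
  | monomial i c =>
    rw [aeval_monomial, aeval_monomial, mul_assoc, hp, ← mul_assoc, ← mul_assoc, Algebra.commutes]

variable {K : Type*} [Field K]

/-- Left multiplications by `z` and `z²` have the same kernel, hence by dimension the same range,
which contains `z`. -/
theorem eq_mul_self_mul_of_forall {A : Type*} [Ring A] [Algebra K A] [FiniteDimensional K A] {z : A}
    (h : ∀ v, z * (z * v) = 0 → z * v = 0) : ∃ w, z = z * z * w := by
  have h1 : LinearMap.range (LinearMap.mulLeft K (z * z)) = LinearMap.range (LinearMap.mulLeft K z) := by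
    apply Submodule.eq_of_le_of_finrank_eq
    · rintro _ ⟨v, rfl⟩
      exact ⟨z * v, (mul_assoc z z v).symm⟩
    · have h2 := LinearMap.finrank_range_add_finrank_ker (LinearMap.mulLeft K (z * z))
      have h3 := LinearMap.finrank_range_add_finrank_ker (LinearMap.mulLeft K z)
      have h4 : LinearMap.ker (LinearMap.mulLeft K (z * z)) = LinearMap.ker (LinearMap.mulLeft K z) := by
        ext v
        simp only [LinearMap.mem_ker, LinearMap.mulLeft_apply, mul_assoc]
        exact ⟨h v, fun h => by rw [h, mul_zero]⟩
      rw [h4] at h2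
      omega
  obtain ⟨w, hw⟩ : z ∈ LinearMap.range (LinearMap.mulLeft K (z * z)) := by
    rw [h1]
    exact ⟨1, mul_one z⟩
  exact ⟨w, hw.symm⟩

theorem exists_kernel_projector {n : Type*} [Fintype n] [DecidableEq n] (z : Matrix n n K) :
    ∃ π : Matrix n n K, z * π = 0 ∧ ∀ v : Matrix n n K, z * v = 0 → π * v = v := by
  obtain ⟨q, hq⟩ := LinearMap.exists_leftInverse_of_injective
    (LinearMap.ker (Matrix.toLin' z)).subtype (Submodule.ker_subtype _)
  have h0 : ∀ v, z.mulVec ((q v : n → K)) = 0 := fun v => (q v).2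
  refine ⟨LinearMap.toMatrix' ((LinearMap.ker (Matrix.toLin' z)).subtype ∘ₗ q), ?_, fun v hv => ?_⟩
  · apply (Matrix.toLin' (R := K) (m := n) (n := n)).injective
    rw [Matrix.toLin'_mul, Matrix.toLin'_toMatrix', map_zero]
    exact LinearMap.ext fun v => (q v).2
  · apply (Matrix.toLin' (R := K) (m := n) (n := n)).injective
    rw [Matrix.toLin'_mul, Matrix.toLin'_toMatrix']
    refine LinearMap.ext fun w => ?_
    have h1 : Matrix.toLin' v w ∈ LinearMap.ker (Matrix.toLin' z) := by
      rw [LinearMap.mem_ker, ← LinearMap.comp_apply, ← Matrix.toLin'_mul, hv, map_zero,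
        LinearMap.zero_apply]
    exact congrArg Subtype.val (LinearMap.congr_fun hq ⟨_, h1⟩)

/-- Average a projector onto the kernel over `{1, θ}`; the kernel is stable under `θ`, so the
average is still a projector onto it. -/
theorem exists_commute_kernel_projector {n : Type*} [Fintype n] [DecidableEq n] (h2 : (2 : K) ≠ 0)
    {θ : Matrix n n K} (hθ : θ * θ = 1) {z : Matrix n n K}
    (hz : ∀ v : Matrix n n K, z * v = 0 → z * (θ * v) = 0) :
    ∃ π : Matrix n n K, Commute θ π ∧ z * π = 0 ∧ ∀ v : Matrix n n K, z * v = 0 → π * v = v := by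
  obtain ⟨π, h0, h1⟩ := exists_kernel_projector z
  have hs : ∀ v : Matrix n n K, (2 : K)⁻¹ • (v + v) = v := fun v => by
    rw [← two_smul K v, smul_smul, inv_mul_cancel₀ h2, one_smul]
  refine ⟨(2 : K)⁻¹ • (π + θ * (π * θ)), ?_, ?_, fun v hv => ?_⟩
  · rw [Commute, SemiconjBy, mul_smul_comm, smul_mul_assoc, mul_add, add_mul, ← mul_assoc θ θ, hθ,
      one_mul, mul_assoc θ, mul_assoc π, hθ, mul_one, add_comm]
  · rw [mul_smul_comm, mul_add, h0, zero_add, hz _ (by rw [← mul_assoc, h0, zero_mul]), smul_zero]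
  · rw [smul_mul_assoc, add_mul, h1 v hv, mul_assoc θ, mul_assoc π, h1 _ (hz v hv), ← mul_assoc θ θ,
      hθ, one_mul, hs]

variable {p q : ℕ}

theorem conj_mem_symSpace {R : Type*} [Ring R]
    {g : (Matrix (Fin p ⊕ Fin q) (Fin p ⊕ Fin q) R)ˣ} (hg : g ∈ fixedGroup R p q)
    {y : Matrix (Fin p ⊕ Fin q) (Fin p ⊕ Fin q) R} (hy : y ∈ symSpace R p q) :
    g.1 * y * (g⁻¹).1 ∈ symSpace R p q := by
  rw [mem_fixedGroup_iff] at hg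
  have hg' : (g⁻¹).1 * thetaMat R p q p = thetaMat R p q p * (g⁻¹).1 :=
    (show Commute _ _ from hg).units_inv_left.eq
  have h1 : g.1 * y * (g⁻¹).1 * thetaMat R p q p = g.1 * (y * thetaMat R p q p) * (g⁻¹).1 := by
    rw [mul_assoc _ (g⁻¹).1, hg']
    simp only [mul_assoc]
  change (g.1 * y * (g⁻¹).1 * thetaMat R p q p) ^ 2 = 1
  have h2 : (y * thetaMat R p q p) ^ 2 = 1 := hy
  rw [h1, Units.conj_pow, h2, mul_one, Units.mul_inv]

/-- A Hilbert–Mumford argument. Let `π` project onto the kernel of `z = k(T y)`, commute with `θ`,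
and put `ρ = 1 - π`. Conjugation by `s π + ρ` moves `y = y₀ + N` to `y₀ + s N`, where `y₀ = π y π +
ρ y ρ`; letting `s → 0`, closedness puts `y₀` in the orbit. So `k(T y₀) = ρ z` is conjugate to `z`
and has the same kernel by dimension. If `z (z v) = 0`, then `ρ z v = 0`, hence `z v = 0`. `T` is
left free because it is needed for `T y = y` and for `T y = y + θ y θ`. -/
theorem exists_eq_of_hasClosedOrbit [Infinite K] (h2 : (2 : K) ≠ 0)
    {y : Matrix (Fin p ⊕ Fin q) (Fin p ⊕ Fin q) K} (hy : y ∈ symSpace K p q)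
    (hc : HasClosedOrbit K (fixedGroup K p q) (symSpace K p q) y)
    (T : Matrix (Fin p ⊕ Fin q) (Fin p ⊕ Fin q) K →ₗ[K] Matrix (Fin p ⊕ Fin q) (Fin p ⊕ Fin q) K)
    (hT : ∀ a b x, Commute (thetaMat K p q p) a → Commute (thetaMat K p q p) b →
      T (a * x * b) = a * T x * b) (k : K[X])
    (hz : ∀ v, aeval (T y) k * v = 0 → aeval (T y) k * (thetaMat K p q p * v) = 0)
    (hzy : Commute (aeval (T y) k) y) :
    ∃ w, aeval (T y) k = aeval (T y) k * aeval (T y) k * w := by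
  apply eq_mul_self_mul_of_forall (K := K)
  set θ := thetaMat K p q p with hθ_def
  set z := aeval (T y) k with hz_def
  have hθ : θ * θ = 1 := thetaMat_mul_self p q p
  have hyθ : y * θ * (y * θ) = 1 := by rw [← sq]; exact hy
  obtain ⟨π, hπθ, hzπ, hπ⟩ := exists_commute_kernel_projector h2 hθ hz
  obtain ⟨ρ, hρ⟩ : ∃ ρ, ρ = 1 - π := ⟨_, rfl⟩
  have hρθ : Commute θ ρ := hρ ▸ (Commute.one_right θ).sub_right hπθ
  have hππ : π * π = π := hπ π hzπ
  have hsum : π + ρ = 1 := by rw [hρ]; abel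
  have hπρ : π * ρ = 0 := by rw [hρ, mul_sub, mul_one, hππ, sub_self]
  have hρπ : ρ * π = 0 := by rw [hρ, sub_mul, one_mul, hππ, sub_self]
  have hρρ : ρ * ρ = ρ := by nth_rw 1 [hρ]; rw [sub_mul, one_mul, hπρ, sub_zero]
  have hyπ : π * y * π = y * π := by
    rw [mul_assoc]
    exact hπ _ (by rw [← mul_assoc, hzy.eq, mul_assoc, hzπ, mul_zero])
  have hρyπ : ρ * y * π = 0 := by
    rw [hρ, sub_mul, sub_mul, one_mul, hyπ, sub_self]
  have hρy : ρ * y * ρ = ρ * y := by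
    conv_rhs => rw [← mul_one (ρ * y), ← hsum, mul_add, hρyπ, zero_add]
  obtain ⟨N, hN⟩ : ∃ N, N = π * y * ρ := ⟨_, rfl⟩
  obtain ⟨y₀, hy₀⟩ : ∃ y₀, y₀ = π * y * π + ρ * y * ρ := ⟨_, rfl⟩
  have hy_eq : y = y₀ + N := by
    calc y = (π + ρ) * y * (π + ρ) := by rw [hsum, one_mul, mul_one]
      _ = _ := by rw [mul_add, add_mul π ρ, add_mul, add_mul, hρyπ, hy₀, hN]; abel
  -- Since `θ` commutes with `π` and `ρ`, the square of `y₀ θ` is the sum of its squares on the two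
  -- parts, namely `π + ρ`.
  have hy₀S : y₀ ∈ symSpace K p q := by
    have e1 : π * y * π * θ * (π * y * π * θ) = π := by
      calc _ = y * π * θ * (y * π * θ) := by rw [hyπ]
        _ = y * θ * (π * y * π) * θ := by simp only [mul_assoc]; rw [← mul_assoc π θ, ← hπθ.eq]; simp only [mul_assoc]
        _ = y * θ * (y * θ) * π := by rw [hyπ]; simp only [mul_assoc, hπθ.eq]
        _ = π := by rw [hyθ, one_mul]
    have e2 : ρ * y * ρ * θ * (ρ * y * ρ * θ) = ρ := by
      calc _ = ρ * y * ρ * θ * (ρ * y * θ) := by rw [hρy]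
        _ = ρ * y * (ρ * ρ) * θ * (y * θ) := by simp only [mul_assoc]; rw [← mul_assoc θ ρ, hρθ.eq]; simp only [mul_assoc]
        _ = ρ * (y * θ * (y * θ)) := by rw [hρρ, hρy]; simp only [mul_assoc]
        _ = ρ := by rw [hyθ, mul_one]
    have e3 : ∀ u v : Matrix (Fin p ⊕ Fin q) (Fin p ⊕ Fin q) K, u * π * θ * (ρ * v) = 0 := fun u v => by
      calc _ = u * (π * ρ) * θ * v := by simp only [mul_assoc]; rw [← mul_assoc θ ρ, hρθ.eq]; simp only [mul_assoc]
        _ = 0 := by rw [hπρ, mul_zero, zero_mul, zero_mul]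
    have e4 : ∀ u v : Matrix (Fin p ⊕ Fin q) (Fin p ⊕ Fin q) K, u * ρ * θ * (π * v) = 0 := fun u v => by
      calc _ = u * (ρ * π) * θ * v := by simp only [mul_assoc]; rw [← mul_assoc θ π, hπθ.eq]; simp only [mul_assoc]
        _ = 0 := by rw [hρπ, mul_zero, zero_mul, zero_mul]
    change (y₀ * θ) ^ 2 = 1
    rw [hy₀, sq, add_mul, mul_add, add_mul, add_mul, e1, e2]
    have e5 : ρ * y * ρ * θ * (π * y * π * θ) = 0 := by
      rw [mul_assoc π, mul_assoc π]; exact e4 _ _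
    have e6 : π * y * π * θ * (ρ * y * ρ * θ) = 0 := by
      rw [mul_assoc ρ, mul_assoc ρ]; exact e3 _ _
    rw [e5, e6, add_zero, zero_add, hsum]
  have horb : ∀ s : K, s ≠ 0 → y₀ + s • N ∈ conjOrbit (fixedGroup K p q) y := fun s hs => by
    have i1 : (s • π + ρ) * (s⁻¹ • π + ρ) = 1 := by
      simp only [add_mul, mul_add, Matrix.smul_mul, Matrix.mul_smul, hππ, hπρ, hρπ, hρρ, smul_smul,
        inv_mul_cancel₀ hs, smul_zero, one_smul, zero_add, add_zero, hsum]
    have i2 : (s⁻¹ • π + ρ) * (s • π + ρ) = 1 := by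
      simp only [add_mul, mul_add, Matrix.smul_mul, Matrix.mul_smul, hππ, hπρ, hρπ, hρρ, smul_smul,
        mul_inv_cancel₀ hs, smul_zero, one_smul, zero_add, add_zero, hsum]
    refine ⟨⟨_, _, i1, i2⟩, ?_, ?_⟩
    · rw [mem_fixedGroup_iff]
      exact ((hπθ.smul_right s).add_right hρθ).eq.symm
    · change _ = (s • π + ρ) * y * (s⁻¹ • π + ρ)
      simp only [add_mul, mul_add, Matrix.smul_mul, Matrix.mul_smul, hρyπ, smul_smul, smul_zero,
        inv_mul_cancel₀ hs, one_smul, hy₀, hN]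
      abel
  -- A polynomial function vanishing on the orbit vanishes at `y₀ + s N` for every `s ≠ 0`, hence
  -- also for `s = 0`.
  have hmem : y₀ ∈ conjOrbit (fixedGroup K p q) y := by
    refine mem_of_forall_isPolyFun hc ⟨y₀, hy₀S⟩ fun φ hφ h0 => ?_
    obtain ⟨f, hf⟩ := hφ.exists_line y₀ N
    have hf0 : f = 0 := by
      by_contra hne
      obtain ⟨s, hs⟩ := exists_eval_ne_zero (mul_ne_zero hne (X_ne_zero (R := K)))
      rw [eval_mul, eval_X] at hs
      have hs0 := right_ne_zero_of_mul hs
      apply left_ne_zero_of_mul hs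
      have hmem := horb s hs0
      obtain ⟨g, hg, hgy⟩ := hmem
      rw [hf]
      refine h0 ⟨y₀ + s • N, ?_⟩ ⟨g, hg, hgy⟩
      exact hgy ▸ conj_mem_symSpace hg hy
    have h1 := hf 0
    rw [hf0, eval_zero, zero_smul, add_zero] at h1
    exact h1.symm
  obtain ⟨g, hg, hgy⟩ := hmem
  rw [mem_fixedGroup_iff] at hg
  have hgθ : Commute θ g.1 := hg.symm
  have hTg : T y₀ = g.1 * T y * (g⁻¹).1 := by
    rw [hgy]
    exact hT _ _ _ hgθ hgθ.units_inv_right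
  have hTy : T y₀ = π * T y * π + ρ * T y * ρ := by
    rw [hy₀, map_add, hT _ _ _ hπθ hπθ, hT _ _ _ hρθ hρθ]
  have hTρπ : ρ * T y * π = 0 := by rw [← hT _ _ _ hρθ hπθ, hρyπ, map_zero]
  have hTπ : π * T y * π = T y * π := by
    have : (π + ρ) * T y * π = T y * π := by rw [hsum, one_mul]
    rw [← this, add_mul, add_mul, hTρπ, add_zero]
  have hTρ : ρ * T y * ρ = ρ * T y := by
    conv_rhs => rw [← mul_one (ρ * T y), ← hsum, mul_add, hTρπ, zero_add]
  have c1 : ρ * T y = T y₀ * ρ := by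
    rw [hTy, add_mul, mul_assoc _ π ρ, hπρ, mul_zero, zero_add, mul_assoc _ ρ ρ, hρρ, hTρ]
  have c2 : T y * π = π * T y₀ := by
    rw [hTy, mul_add, ← mul_assoc, ← mul_assoc, hππ, ← mul_assoc, ← mul_assoc, hπρ, zero_mul,
      zero_mul, add_zero, hTπ]
  have c3 : T y₀ * π = π * T y₀ := by
    rw [← c2, hTy, add_mul, mul_assoc _ π π, hππ, mul_assoc _ ρ π, hρπ, mul_zero, add_zero, hTπ]
  have hz0 : aeval (T y₀) k = ρ * z := by
    have d1 : aeval (T y₀) k * π = 0 := by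
      rw [aeval_mul_of_mul_eq c3, ← aeval_mul_of_mul_eq c2, ← hz_def, hzπ]
    rw [← mul_one (aeval (T y₀) k), ← hsum, mul_add, d1, zero_add, aeval_mul_of_mul_eq c1.symm]
  have hz1 : aeval (T y₀) k * g.1 = g.1 * z :=
    aeval_mul_of_mul_eq (by rw [hTg, mul_assoc, Units.inv_mul, mul_one]) k
  intro v hv
  -- The kernel of `z` lies in that of `ρ z`; conjugation by `g` shows that the ranks agree.
  have hker : LinearMap.ker (LinearMap.mulLeft K z) = LinearMap.ker (LinearMap.mulLeft K (ρ * z)) := by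
    apply Submodule.eq_of_le_of_finrank_eq
    · intro w hw
      rw [LinearMap.mem_ker, LinearMap.mulLeft_apply] at hw ⊢
      rw [mul_assoc, hw, mul_zero]
    · have h3 : LinearMap.mulLeft K (ρ * z) ∘ₗ LinearMap.mulLeft K g.1 =
          LinearMap.mulLeft K g.1 ∘ₗ LinearMap.mulLeft K z := by
        rw [← hz0, ← LinearMap.mulLeft_mul, hz1, LinearMap.mulLeft_mul]
      have hinj : Function.Injective (LinearMap.mulLeft K g.1) := fun a b hab => by
        have := congrArg (fun c => (g⁻¹).1 * c) hab
        simpa only [LinearMap.mulLeft_apply, ← mul_assoc, Units.inv_mul, one_mul] using this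
      have hsurj : Function.Surjective (LinearMap.mulLeft K g.1) := fun a =>
        ⟨(g⁻¹).1 * a, by rw [LinearMap.mulLeft_apply, ← mul_assoc, Units.mul_inv, one_mul]⟩
      have r1 := LinearMap.finrank_range_add_finrank_ker (LinearMap.mulLeft K z)
      have r2 := LinearMap.finrank_range_add_finrank_ker (LinearMap.mulLeft K (ρ * z))
      have r3 : Module.finrank K (LinearMap.range (LinearMap.mulLeft K (ρ * z))) =
          Module.finrank K (LinearMap.range (LinearMap.mulLeft K z)) := by
        rw [← LinearMap.range_comp_of_range_eq_top _ (LinearMap.range_eq_top.mpr hsurj), h3,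
          LinearMap.range_comp]
        exact LinearEquiv.finrank_map_eq (LinearEquiv.ofBijective _ ⟨hinj, hsurj⟩) _
      omega
  have h4 : v ∈ LinearMap.ker (LinearMap.mulLeft K z) := by
    rw [hker, LinearMap.mem_ker, LinearMap.mulLeft_apply, mul_assoc, hρ, sub_mul, one_mul, hπ _ hv,
      sub_self]
  exact h4

end ClosedOrbit

/-! ### A kernel criterion for normal forms -/

section NormalFormCriterion

variable {p q : ℕ}

theorem conjOrbit_eq_of_mem {A : Type*} [Monoid A] {H : Subgroup Aˣ} {x y : A}
    (h : x ∈ conjOrbit H y) : conjOrbit H x = conjOrbit H y := by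
  obtain ⟨g, hg, rfl⟩ := h
  ext z
  constructor
  · rintro ⟨k, hk, rfl⟩
    exact ⟨k * g, H.mul_mem hk hg, by simp only [mul_inv_rev, Units.val_mul, mul_assoc]⟩
  · rintro ⟨k, hk, rfl⟩
    refine ⟨k * g⁻¹, H.mul_mem hk (H.inv_mem hg), ?_⟩
    simp only [mul_inv_rev, Units.val_mul, mul_assoc, inv_inv, Units.inv_mul_cancel_left]

theorem mem_conjOrbit_self {A : Type*} [Monoid A] (H : Subgroup Aˣ) (x : A) : x ∈ conjOrbit H x :=
  ⟨1, H.one_mem, by simp⟩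

open scoped Matrix in
theorem vecMul_eq_zero_of_forall {R : Type*} [Ring R] {m n : Type*} [Fintype m] [DecidableEq m]
    [Fintype n] {b : Matrix m n R} {c : Matrix n m R}
    (h : ∀ V : Matrix m m R, V * (b * c) = 0 → V * b = 0) (v : m → R) (hv : v ᵥ* (b * c) = 0) :
    v ᵥ* b = 0 := by
  rcases isEmpty_or_nonempty m with hm | ⟨⟨i⟩⟩
  · ext j
    simp [Matrix.vecMul, dotProduct]
  · have := h (Matrix.of fun _ => v) (by
      ext j k
      exact congrFun hv k)
    ext k
    exact congrFun (congrFun this i) k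

/-- The block equations say that the off-diagonal part `N` commutes with `x` and that `x² - 1 =
2Nx`. As `x` is invertible, kernel and rank conditions on `x² - 1` become conditions on `b` and `c`.
-/
theorem mul_self_sub_one_eq {R : Type*} [Ring R] {x : Matrix (Fin p ⊕ Fin q) (Fin p ⊕ Fin q) R}
    (hx : x ∈ symSpace R p q) :
    x * x - 1 = Matrix.fromBlocks 0 x.toBlocks₁₂ x.toBlocks₂₁ 0 * (x + x) ∧
      Matrix.fromBlocks 0 x.toBlocks₁₂ x.toBlocks₂₁ 0 * x =
        x * Matrix.fromBlocks 0 x.toBlocks₁₂ x.toBlocks₂₁ 0 := by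
  obtain ⟨a, b, c, e, rfl⟩ : ∃ a b c e, x = Matrix.fromBlocks a b c e :=
    ⟨_, _, _, _, (Matrix.fromBlocks_toBlocks x).symm⟩
  obtain ⟨haa, hab, hca, hee⟩ := fromBlocks_mem_symSpace.mp hx
  simp only [Matrix.toBlocks_fromBlocks₁₂, Matrix.toBlocks_fromBlocks₂₁]
  constructor
  · rw [← Matrix.fromBlocks_one, sub_eq_add_neg, Matrix.fromBlocks_neg, mul_add]
    simp only [Matrix.fromBlocks_multiply, Matrix.zero_mul, zero_add, add_zero,
      Matrix.fromBlocks_add, Matrix.fromBlocks_inj]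
    rw [← haa, hab, ← hca, ← hee]
    refine ⟨?_, ?_, ?_, ?_⟩ <;> abel
  · simp only [Matrix.fromBlocks_multiply, Matrix.zero_mul, Matrix.mul_zero, zero_add, add_zero,
      hab, hca]

/-- Cancelling the invertible factor `2x` from `x² - 1 = 2Nx` leaves `W N² = 0 → W N = 0`; taking
`W` supported in one diagonal block gives the two hypotheses of `exists_normalForm`. -/
theorem exists_normalForm_of_forall {E : Type*} [DivisionRing E] (h2 : (2 : E) ≠ 0)
    {x : Matrix (Fin p ⊕ Fin q) (Fin p ⊕ Fin q) E} (hx : x ∈ symSpace E p q)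
    (hz : ∀ W, W * (x * x - 1) * (x * x - 1) = 0 → W * (x * x - 1) = 0) :
    ∃ (m r t : ℕ) (A : Matrix (Fin m) (Fin m) E), m + r ≤ p ∧ m + t ≤ q ∧ IsUnit (A * A - 1) ∧
      x ∈ conjOrbit (fixedGroup E p q) (xMat p q A r t) := by
  have hunit : ∀ W, W * x = 0 → W = 0 := fun W hW => by
    have h1 : (x * thetaMat E p q p) ^ 2 = 1 := hx
    rw [← mul_one W, ← h1, sq]
    simp only [← mul_assoc, hW, zero_mul]
  obtain ⟨N, hN⟩ : ∃ N, N = Matrix.fromBlocks 0 x.toBlocks₁₂ x.toBlocks₂₁ 0 := ⟨_, rfl⟩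
  obtain ⟨hzN, hNx⟩ := mul_self_sub_one_eq hx
  rw [← hN] at hzN hNx
  have hNN : ∀ W, W * N * N = 0 → W * N = 0 := fun W hW => by
    have h1 : W * (x * x - 1) * (x * x - 1) = 0 := by
      calc _ = W * N * ((x + x) * N) * (x + x) := by
            rw [hzN]
            simp only [mul_assoc]
        _ = W * N * N * (x + x) * (x + x) := by
            rw [add_mul, ← hNx, ← mul_add]
            simp only [mul_assoc]
        _ = 0 := by rw [hW, zero_mul, zero_mul]
    have h3 := hz W h1
    rw [hzN, mul_add, mul_add] at h3
    have h4 := two_nsmul_eq_zero_of_isUnit (isUnit_iff_ne_zero.mpr h2)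
      (M := W * (N * x)) (eq_neg_of_add_eq_zero_left h3)
    exact hunit _ (by rw [mul_assoc]; exact h4)
  rw [← Matrix.fromBlocks_toBlocks x] at hx ⊢
  refine exists_normalForm h2 hx (vecMul_eq_zero_of_forall fun V hV => ?_)
    (vecMul_eq_zero_of_forall fun V hV => ?_)
  · have := hNN (Matrix.fromBlocks V 0 0 0) (by
      rw [hN]
      simp [Matrix.fromBlocks_multiply, Matrix.mul_assoc, hV])
    rw [hN, ← Matrix.fromBlocks_zero] at this
    simp only [Matrix.fromBlocks_multiply, Matrix.fromBlocks_inj] at this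
    simpa using this.2.1
  · have := hNN (Matrix.fromBlocks 0 0 0 V) (by
      rw [hN]
      simp [Matrix.fromBlocks_multiply, Matrix.mul_assoc, hV])
    rw [hN, ← Matrix.fromBlocks_zero] at this
    simp only [Matrix.fromBlocks_multiply, Matrix.fromBlocks_inj] at this
    simpa using this.2.2.1

end NormalFormCriterion

/-! ### Two consequences of a closed orbit -/

section Closed

variable {K : Type*} [Field K] {p q : ℕ}

/-- The degeneration with `T = id` and `k = X² - 1`; the kernel of `y² - 1` is stable under `θ`
because `y θ y = θ`. -/
theorem sub_one_eq_mul_of_hasClosedOrbit [Infinite K] (h2 : (2 : K) ≠ 0)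
    {y : Matrix (Fin p ⊕ Fin q) (Fin p ⊕ Fin q) K} (hy : y ∈ symSpace K p q)
    (hc : HasClosedOrbit K (fixedGroup K p q) (symSpace K p q) y) :
    ∃ w, y * y - 1 = (y * y - 1) * (y * y - 1) * w := by
  have h1 : aeval (LinearMap.id (R := K) y) (X * X - 1 : K[X]) = y * y - 1 := by simp
  have hyθ : y * thetaMat K p q p * (y * thetaMat K p q p) = 1 := by rw [← sq]; exact hy
  have hθ := thetaMat_mul_self (R := K) p q p
  have h3 : y * thetaMat K p q p * y = thetaMat K p q p := by
    rw [← mul_one (y * thetaMat K p q p * y), ← hθ, ← mul_assoc, mul_assoc _ y, hyθ, one_mul]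
  have := exists_eq_of_hasClosedOrbit h2 hy hc LinearMap.id (fun _ _ _ _ _ => rfl) (X * X - 1)
    (by
      rw [h1]
      intro v hv
      rw [sub_mul, one_mul, sub_eq_zero] at hv ⊢
      calc _ = y * (y * thetaMat K p q p * y) * (y * v) := by
            conv_lhs => rw [← hv]
            simp only [mul_assoc]
        _ = y * thetaMat K p q p * (y * v) := by rw [h3]
        _ = y * thetaMat K p q p * y * v := by simp only [mul_assoc]
        _ = _ := by rw [h3])
    (by
      rw [h1]
      exact ((Commute.refl y).mul_left (Commute.refl y)).sub_left (Commute.one_left y))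
  rwa [h1] at this

/-- The degeneration with `T y = y + θ y θ`. As `θ y θ` is the inverse of `y`, `T y` commutes with
`y` and `θ`, so every polynomial in it qualifies. It is twice the block diagonal part of `y`, which
gives access to polynomials in `A`. -/
theorem aeval_eq_mul_of_hasClosedOrbit [Infinite K] (h2 : (2 : K) ≠ 0)
    {y : Matrix (Fin p ⊕ Fin q) (Fin p ⊕ Fin q) K} (hy : y ∈ symSpace K p q)
    (hc : HasClosedOrbit K (fixedGroup K p q) (symSpace K p q) y) (k : K[X]) :
    ∃ w, aeval (y + thetaMat K p q p * y * thetaMat K p q p) k =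
      aeval (y + thetaMat K p q p * y * thetaMat K p q p) k *
        aeval (y + thetaMat K p q p * y * thetaMat K p q p) k * w := by
  have hyθ : y * thetaMat K p q p * (y * thetaMat K p q p) = 1 := by rw [← sq]; exact hy
  set θ := thetaMat K p q p
  have hθ : θ * θ = 1 := thetaMat_mul_self (R := K) p q p
  have h3 : y * (θ * y * θ) = 1 := by rw [← hyθ]; simp only [mul_assoc]
  have h4 : θ * y * θ * y = 1 := by
    calc _ = θ * (y * θ * (y * θ)) * θ := by
          simp only [mul_assoc, hθ, mul_one]
      _ = 1 := by rw [hyθ, mul_one, hθ]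
  let T : Matrix (Fin p ⊕ Fin q) (Fin p ⊕ Fin q) K →ₗ[K] Matrix (Fin p ⊕ Fin q) (Fin p ⊕ Fin q) K :=
    LinearMap.id + LinearMap.mulLeftRight K (θ, θ)
  have hT : ∀ x, T x = x + θ * x * θ := fun x => rfl
  rw [← hT]
  have hcθ : Commute (T y) θ := by
    rw [hT, Commute, SemiconjBy, add_mul, mul_add, mul_assoc _ θ θ, hθ, mul_one, ← mul_assoc θ,
      ← mul_assoc θ θ, hθ, one_mul, add_comm]
  have hcy : Commute (T y) y := by
    rw [hT, Commute, SemiconjBy, add_mul, mul_add, h3, h4]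
  refine exists_eq_of_hasClosedOrbit h2 hy hc T (fun a b x (ha : Commute θ a) (hb : Commute θ b) => ?_) k (fun v hv => ?_) ?_
  · rw [hT, hT, mul_add, add_mul]
    congr 1
    calc _ = (θ * a) * x * (b * θ) := by simp only [mul_assoc]
      _ = _ := by rw [ha.eq, ← hb.eq]; simp only [mul_assoc]
  · rw [← mul_assoc, aeval_mul_of_mul_eq hcθ.eq, mul_assoc, hv, mul_zero]
  · exact aeval_mul_of_mul_eq hcy.eq k

theorem aeval_mul_rect {R m n : Type*} [CommRing R] [Fintype m] [DecidableEq m] [Fintype n]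
    [DecidableEq n] {A : Matrix m m R} {B : Matrix n n R} {J : Matrix m n R} (h : A * J = J * B)
    (k : R[X]) : aeval A k * J = J * aeval B k := by
  have hp : ∀ i : ℕ, A ^ i * J = J * B ^ i := fun i => by
    induction i with
    | zero => simp
    | succ i ih =>
      rw [pow_succ, Matrix.mul_assoc, h, ← Matrix.mul_assoc, ih, Matrix.mul_assoc, ← pow_succ]
  induction k using Polynomial.induction_on' with
  | add f g hf hg => rw [map_add, map_add, Matrix.add_mul, Matrix.mul_add, hf, hg]
  | monomial i c =>
    rw [aeval_monomial, aeval_monomial, Algebra.algebraMap_eq_smul_one, Algebra.algebraMap_eq_smul_one,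
      Matrix.smul_mul, Matrix.smul_mul, Matrix.smul_mul, one_mul, hp, Matrix.mul_smul, one_mul]

theorem aeval_fromBlocks_diagonal {R m n : Type*} [CommRing R] [Fintype m] [DecidableEq m] [Fintype n]
    [DecidableEq n] (A : Matrix m m R) (B : Matrix n n R) (k : R[X]) :
    aeval (Matrix.fromBlocks A 0 0 B) k = Matrix.fromBlocks (aeval A k) 0 0 (aeval B k) := by
  have hp : ∀ i : ℕ, (Matrix.fromBlocks A 0 0 B) ^ i = Matrix.fromBlocks (A ^ i) 0 0 (B ^ i) := fun i => by
    induction i with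
    | zero => simp
    | succ i ih => simp [pow_succ, ih, Matrix.fromBlocks_multiply]
  induction k using Polynomial.induction_on' with
  | add f g hf hg => simp only [map_add, hf, hg, Matrix.fromBlocks_add, add_zero]
  | monomial i c =>
    rw [aeval_monomial, aeval_monomial, aeval_monomial, Algebra.algebraMap_eq_smul_one,
      Algebra.algebraMap_eq_smul_one, Algebra.algebraMap_eq_smul_one, hp]
    simp [Matrix.fromBlocks_smul]

theorem aeval_diagBlock {R : Type*} [CommRing R] {m r : ℕ} {a : ℕ} (ha : m + ((a - m - r) + r) = a)
    (A : Matrix (Fin m) (Fin m) R) (k : R[X]) :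
    aeval (diagBlock a r A) k = (Matrix.fromBlocks (aeval A k) 0 0
      (aeval (Matrix.fromBlocks 1 0 0 (-1) : Matrix (Fin (a - m - r) ⊕ Fin r) _ R) k)).submatrix
        (blockEquiv ha).symm (blockEquiv ha).symm := by
  rw [← aeval_fromBlocks_diagonal, diagBlock_eq ha]
  exact Polynomial.aeval_algHom_apply
    (Matrix.reindexAlgEquiv R R (blockEquiv ha)).toAlgHom (signBlock A _ _) k

theorem corner_mul_aeval_diagBlock {R : Type*} [CommRing R] {m r : ℕ} {a b : ℕ} (h : m + r ≤ a)
    (hb : m ≤ b) (A B : Matrix (Fin m) (Fin m) R) (k : R[X]) :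
    corner b a B * aeval (diagBlock a r A) k = corner b a (B * aeval A k) := by
  have ha : m + ((a - m - r) + r) = a := by omega
  have hb' : m + ((b - m) + 0) = b := by omega
  rw [aeval_diagBlock ha, corner_eq hb' ha, corner_eq hb' ha, Matrix.submatrix_mul_equiv]
  simp [Matrix.fromBlocks_multiply]

theorem charpoly_diagBlock {R : Type*} [CommRing R] {m r : ℕ} {a : ℕ} (h : m + r ≤ a)
    (A : Matrix (Fin m) (Fin m) R) :
    (diagBlock a r A).charpoly = A.charpoly * ((X - 1) ^ (a - m - r) * (X + 1) ^ r) := by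
  have ha : m + ((a - m - r) + r) = a := by omega
  rw [diagBlock_eq ha]
  have := Matrix.charpoly_reindex (blockEquiv ha) (signBlock A (Fin (a - m - r)) (Fin r))
  rw [Matrix.reindex_apply] at this
  rw [this, signBlock, Matrix.charpoly_fromBlocks_zero₁₂, Matrix.charpoly_fromBlocks_zero₁₂,
    Matrix.charpoly_one]
  congr 2
  · simp
  · rw [← Matrix.diagonal_one, Matrix.diagonal_neg, Matrix.charpoly_diagonal]
    simp

end Closed

/-! ### Closed conditions and transport of closed orbits -/

section Topology

variable {K : Type*} [Field K]

theorem isClosed_isPolyMap_eq_zero {W m n : Type*} [AddCommGroup W] [Module K W] (X : Set W)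
    {M : W → Matrix m n K} (h : IsPolyMap K M) : IsClosed[zariskiOn K X] {w : X | M w = 0} := by
  let := zariskiOn K X
  have h1 : {w : X | M w = 0} = ⋂ i, ⋂ j, {w : X | M w i j = 0} := by
    ext w
    simp only [Set.mem_ofPred_eq, Set.mem_iInter]
    exact ⟨fun h i j => by rw [h]; rfl, fun h => Matrix.ext h⟩
  rw [h1]
  exact isClosed_iInter fun i => isClosed_iInter fun j => isClosed_zeroSet_on X (h i j)

theorem isClosed_charpoly_eq {W n : Type*} [AddCommGroup W] [Module K W] [Fintype n] [DecidableEq n]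
    (X : Set W) {M : W → Matrix n n K} (h : IsPolyMap K M) (P : K[X]) :
    IsClosed[zariskiOn K X] {w : X | (M w).charpoly = P} := by
  let := zariskiOn K X
  have h1 : {w : X | (M w).charpoly = P} = ⋂ i, {w : X | (M w).charpoly.coeff i - P.coeff i = 0} := by
    ext w
    simp only [Set.mem_ofPred_eq, Set.mem_iInter, sub_eq_zero]
    exact Polynomial.ext_iff
  rw [h1]
  exact isClosed_iInter fun i =>
    isClosed_zeroSet_on X ((IsPolyFun.charpoly_coeff h i).sub (.const _))

theorem hasClosedOrbit_iff_of_subset {A : Type*} [Ring A] [Algebra K A] {H : Subgroup Aˣ}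
    {X X' : Set A} {x : A} (hX : X' ⊆ X) (hc : IsClosed[zariskiOn K X] {y : X | (y : A) ∈ X'})
    (hx : ∀ y ∈ X, y ∈ conjOrbit H x → y ∈ X') :
    HasClosedOrbit K H X' x ↔ HasClosedOrbit K H X x := by
  let := zariski K A
  constructor
  · intro h
    obtain ⟨t, ht, hts⟩ := isClosed_induced_iff.mp h
    have h1 : {y : X | (y : A) ∈ conjOrbit H x} = {y : X | (y : A) ∈ X'} ∩ Subtype.val ⁻¹' t := by
      ext ⟨y, hy⟩
      have h2 : ∀ hy' : y ∈ X', y ∈ t ↔ y ∈ conjOrbit H x := fun hy' => by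
        have := Set.ext_iff.mp hts ⟨y, hy'⟩
        exact this
      exact ⟨fun h => ⟨hx y hy h, (h2 (hx y hy h)).mpr h⟩, fun h => (h2 h.1).mp h.2⟩
    change IsClosed _
    rw [h1]
    exact IsClosed.inter hc (ht.preimage continuous_subtype_val)
  · intro h
    have h1 : Continuous (Set.inclusion hX) := continuous_inclusion hX
    exact IsClosed.preimage h1 h

theorem continuous_zariski {W W' : Type*} [AddCommGroup W] [Module K W] [AddCommGroup W']
    [Module K W'] (L : W →ₗ[K] W') : Continuous[zariski K W, zariski K W'] L := by
  let := zariski K W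
  rw [continuous_generateFrom_iff]
  rintro _ ⟨f, rfl⟩
  have h : IsPolyFun K fun w : W' => MvPolynomial.eval (fun l : Module.Dual K W' => l w) f :=
    ⟨f, fun _ => rfl⟩
  exact (isClosed_zeroSet (IsPolyFun.comp_linear h L)).isOpen_compl

theorem HasClosedOrbit.of_algEquiv {A B : Type*} [Ring A] [Algebra K A] [Ring B] [Algebra K B]
    (e : A ≃ₐ[K] B) {H : Subgroup Aˣ} {H' : Subgroup Bˣ} {X : Set A} {X' : Set B} {x : A}
    (hX : ∀ y ∈ X, e y ∈ X') (hH : ∀ y, e y ∈ conjOrbit H' (e x) ↔ y ∈ conjOrbit H x)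
    (h : HasClosedOrbit K H' X' (e x)) : HasClosedOrbit K H X x := by
  let := zariski K A
  let := zariski K B
  have h1 : Continuous (fun y : X => (⟨e y, hX y y.2⟩ : X')) :=
    ((continuous_zariski (e.toLinearEquiv : A →ₗ[K] B)).comp continuous_subtype_val).subtype_mk _
  have h2 := IsClosed.preimage h1 h
  have h3 : {y : X | (y : A) ∈ conjOrbit H x} = (fun y : X => (⟨e y, hX y y.2⟩ : X')) ⁻¹'
      {y : X' | (y : B) ∈ conjOrbit H' (e x)} := by
    ext y
    exact (hH y).symm
  change IsClosed _
  rw [h3]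
  exact h2

end Topology

/-! ### Orbits of semisimple normal forms are closed -/

section ClosedNormalForm

variable {K : Type*} [Field K] {p q : ℕ}

theorem isCoprime_mul_self_sub_one {f : K[X]} (h1 : f.eval 1 ≠ 0) (h1' : f.eval (-1) ≠ 0) :
    IsCoprime f (X * X - 1) := by
  have h : ∀ c : K, f.eval c ≠ 0 → IsCoprime f (X - C c) := fun c hc =>
    (((irreducible_X_sub_C c).coprime_iff_not_dvd).mpr (by rwa [dvd_iff_isRoot])).symm
  have := (h 1 h1).mul_right (h (-1) h1')
  convert this using 1
  simp only [map_neg, map_one]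
  ring

theorem isUnit_of_aeval_eq_zero {B : Type*} [Ring B] [Algebra K B] {A : B} {f : K[X]}
    (hA : aeval A f = 0) (h1 : f.eval 1 ≠ 0) (h1' : f.eval (-1) ≠ 0) : IsUnit (A * A - 1) := by
  obtain ⟨u, w, h⟩ := isCoprime_mul_self_sub_one h1 h1'
  have h2 := congrArg (aeval A) h
  have h3 := congrArg (aeval A) ((mul_comm _ _).trans (eq_sub_of_add_eq' h))
  simp only [map_add, map_mul, map_sub, map_one, aeval_X, hA, mul_zero, zero_add, sub_zero] at h2 h3
  exact ⟨⟨_, _, h3, h2⟩, rfl⟩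

theorem eval_charpoly_ne_zero {m : ℕ} {A : Matrix (Fin m) (Fin m) K} (hA : IsUnit (A * A - 1)) :
    A.charpoly.eval 1 ≠ 0 ∧ A.charpoly.eval (-1) ≠ 0 := by
  obtain ⟨h1, h2⟩ := (isUnit_mul_self_sub_one_iff A).mp hA
  rw [Matrix.eval_charpoly, Matrix.eval_charpoly]
  rw [Matrix.isUnit_iff_isUnit_det, isUnit_iff_ne_zero] at h1 h2
  constructor
  · rw [map_one, ← neg_sub, Matrix.det_neg]
    exact mul_ne_zero (by simp) h1
  · rw [map_neg, map_one, ← neg_add', Matrix.det_neg, add_comm]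
    exact mul_ne_zero (by simp) h2

theorem rootMultiplicity_mul_pow (h2 : (2 : K) ≠ 0) {P : K[X]} (a b : ℕ)
    (hP : P.eval 1 ≠ 0 ∧ P.eval (-1) ≠ 0) :
    (P * ((X - 1) ^ a * (X + 1) ^ b)).rootMultiplicity 1 = a ∧
      (P * ((X - 1) ^ a * (X + 1) ^ b)).rootMultiplicity (-1) = b := by
  have e1 : (X - 1 : K[X]) = X - C 1 := by simp
  have e2 : (X + 1 : K[X]) = X - C (-1) := by simp
  have n1 : (1 : K) ≠ -1 := fun h => h2 (by rw [← one_add_one_eq_two]; nth_rw 2 [h]; simp)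
  have hP0 : P ≠ 0 := by rintro rfl; simp at hP
  rw [e1, e2]
  have hne : (X - C (1 : K)) ^ a * (X - C (-1)) ^ b ≠ 0 :=
    mul_ne_zero (pow_ne_zero _ (X_sub_C_ne_zero _)) (pow_ne_zero _ (X_sub_C_ne_zero _))
  have h0 : ∀ {c d : K} {k : ℕ}, c ≠ d → ((X - C d) ^ k).rootMultiplicity c = 0 := fun hcd =>
    rootMultiplicity_eq_zero (by
      rw [IsRoot, eval_pow, eval_sub, eval_X, eval_C]
      exact pow_ne_zero _ (sub_ne_zero.mpr hcd))
  rw [rootMultiplicity_mul (mul_ne_zero hP0 hne), rootMultiplicity_mul hne,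
    rootMultiplicity_X_sub_C_pow, h0 n1, rootMultiplicity_eq_zero hP.1,
    rootMultiplicity_mul (mul_ne_zero hP0 hne), rootMultiplicity_mul hne,
    rootMultiplicity_X_sub_C_pow, h0 n1.symm, rootMultiplicity_eq_zero hP.2]
  simp

/-- The exponents are the root multiplicities at `1` and `-1`. -/
theorem eq_of_mul_pow_eq (h2 : (2 : K) ≠ 0) {P P' : K[X]} {a b a' b' : ℕ}
    (h : P * ((X - 1) ^ a * (X + 1) ^ b) = P' * ((X - 1) ^ a' * (X + 1) ^ b'))
    (hP : P.eval 1 ≠ 0 ∧ P.eval (-1) ≠ 0) (hP' : P'.eval 1 ≠ 0 ∧ P'.eval (-1) ≠ 0) :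
    a = a' ∧ b = b' ∧ P = P' := by
  obtain rfl : a = a' := by
    rw [← (rootMultiplicity_mul_pow h2 a b hP).1, h, (rootMultiplicity_mul_pow h2 a' b' hP').1]
  obtain rfl : b = b' := by
    rw [← (rootMultiplicity_mul_pow h2 a b hP).2, h, (rootMultiplicity_mul_pow h2 a b' hP').2]
  have e1 : (X - 1 : K[X]) = X - C 1 := by simp
  have e2 : (X + 1 : K[X]) = X - C (-1) := by simp
  refine ⟨rfl, rfl, mul_right_cancel₀ ?_ h⟩
  rw [e1, e2]
  exact mul_ne_zero (pow_ne_zero _ (X_sub_C_ne_zero _)) (pow_ne_zero _ (X_sub_C_ne_zero _))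

theorem corner_eq_zero_iff {R : Type*} [Ring R] {m a b : ℕ} (ha : m ≤ a) (hb : m ≤ b)
    {A : Matrix (Fin m) (Fin m) R} : corner a b A = 0 ↔ A = 0 := by
  have ha' : m + ((a - m) + 0) = a := by omega
  have hb' : m + ((b - m) + 0) = b := by omega
  constructor
  · intro h
    have h1 := corner_submatrix ha' hb' A
    rw [h, Matrix.submatrix_zero, Pi.zero_apply, Pi.zero_apply, ← Matrix.fromBlocks_zero,
      Matrix.fromBlocks_inj] at h1
    exact h1.1.symm
  · rintro rfl
    ext i j
    simp [corner]

theorem toBlocks₁₁_mem_conjOrbit {R : Type*} [Ring R] (h2 : IsUnit (2 : R))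
    {x y : Matrix (Fin p ⊕ Fin q) (Fin p ⊕ Fin q) R}
    (h : y ∈ conjOrbit (fixedGroup R p q) x) : y.toBlocks₁₁ ∈ conjOrbit ⊤ x.toBlocks₁₁ := by
  obtain ⟨g, h, rfl⟩ := (mem_conjOrbit_fixedGroup h2).mp h
  exact ⟨g, trivial, by rw [Matrix.toBlocks_fromBlocks₁₁]⟩

theorem charpoly_eq_of_mem_conjOrbit {n : ℕ} {x y : Matrix (Fin n) (Fin n) K}
    (h : y ∈ conjOrbit ⊤ x) : y.charpoly = x.charpoly := by
  obtain ⟨g, -, rfl⟩ := h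
  exact charpoly_conj g.inv_mul x

theorem mul_aeval_conj_eq_zero_iff {m n : Type*} [Fintype m] [DecidableEq m] [Fintype n]
    [DecidableEq n] (c : Matrix n m K) (a : Matrix m m K) (g : (Matrix m m K)ˣ)
    (h : (Matrix n n K)ˣ) (f : K[X]) :
    h.1 * c * (g⁻¹).1 * aeval (g.1 * a * (g⁻¹).1) f = 0 ↔ c * aeval a f = 0 := by
  have h1 : aeval a f * (g⁻¹).1 = (g⁻¹).1 * aeval (g.1 * a * (g⁻¹).1) f :=
    aeval_mul_of_mul_eq (by rw [← mul_assoc, ← mul_assoc, Units.inv_mul, one_mul]) f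
  rw [Matrix.mul_assoc, ← h1]
  constructor
  · intro h0
    have := congrArg (fun M => (h⁻¹).1 * (M * g.1)) h0
    simpa only [Matrix.mul_assoc, Units.inv_mul, Matrix.mul_one, Matrix.zero_mul, Matrix.mul_zero,
      ← Matrix.mul_assoc (h⁻¹).1 h.1, Matrix.one_mul] using this
  · intro h0
    rw [Matrix.mul_assoc, ← Matrix.mul_assoc c, h0, Matrix.zero_mul, Matrix.mul_zero]

/-- The orbit of a normal form with diagonalizable parameter `A` is closed. -/
theorem hasClosedOrbit_xMat [IsAlgClosed K] (h2 : (2 : K) ≠ 0) {m r t : ℕ} (hp : m + r ≤ p)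
    (hq : m + t ≤ q) {A : Matrix (Fin m) (Fin m) K} {f : K[X]} (hf : f.Separable)
    (hA : aeval A f = 0) (h1 : f.eval 1 ≠ 0) (h1' : f.eval (-1) ≠ 0) :
    HasClosedOrbit K (fixedGroup K p q) (symSpace K p q) (xMat p q A r t) := by
  have h2' : IsUnit (2 : K) := isUnit_iff_ne_zero.mpr h2
  have hAu := isUnit_of_aeval_eq_zero hA h1 h1'
  let := zariskiOn K (symSpace K p q)
  have e1 : IsPolyMap K fun y : Matrix (Fin p ⊕ Fin q) (Fin p ⊕ Fin q) K => y.toBlocks₁₁ :=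
    fun i j => .linear (Matrix.entryLinearMap K K (Sum.inl i) (Sum.inl j))
  have e2 : IsPolyMap K fun y : Matrix (Fin p ⊕ Fin q) (Fin p ⊕ Fin q) K => y.toBlocks₁₂ :=
    fun i j => .linear (Matrix.entryLinearMap K K (Sum.inl i) (Sum.inr j))
  have e3 : IsPolyMap K fun y : Matrix (Fin p ⊕ Fin q) (Fin p ⊕ Fin q) K => y.toBlocks₂₁ :=
    fun i j => .linear (Matrix.entryLinearMap K K (Sum.inr i) (Sum.inl j))
  have e4 : IsPolyMap K fun y : Matrix (Fin p ⊕ Fin q) (Fin p ⊕ Fin q) K => y.toBlocks₂₂ :=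
    fun i j => .linear (Matrix.entryLinearMap K K (Sum.inr i) (Sum.inr j))
  -- Equations of the orbit. The two matrix equations produce a normal form whose parameter `A'` is
  -- annihilated by `f`; the two characteristic polynomials fix `m`, `r`, `t` and the characteristic
  -- polynomial of `A'`, which determines a diagonalizable matrix up to conjugacy.
  have hset : {y : symSpace K p q | (y : Matrix (Fin p ⊕ Fin q) (Fin p ⊕ Fin q) K) ∈
      conjOrbit (fixedGroup K p q) (xMat p q A r t)} =
      ({y : symSpace K p q | y.1.toBlocks₂₁ * aeval y.1.toBlocks₁₁ f = 0} ∩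
        {y : symSpace K p q | y.1.toBlocks₁₂ * aeval y.1.toBlocks₂₂ f = 0}) ∩
      ({y : symSpace K p q | y.1.toBlocks₁₁.charpoly = (diagBlock p r A).charpoly} ∩
        {y : symSpace K p q | y.1.toBlocks₂₂.charpoly = (diagBlock q t A).charpoly}) := by
    ext ⟨y, hy⟩
    simp only [Set.mem_inter_iff, Set.mem_ofPred_eq]
    constructor
    · intro hy
      obtain ⟨g, h, rfl⟩ := (mem_conjOrbit_fixedGroup h2').mp hy
      simp only [Matrix.toBlocks_fromBlocks₁₁, Matrix.toBlocks_fromBlocks₁₂,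
        Matrix.toBlocks_fromBlocks₂₁, Matrix.toBlocks_fromBlocks₂₂, xMat, mul_aeval_conj_eq_zero_iff,
        corner_mul_aeval_diagBlock hp (show m ≤ q by omega),
        corner_mul_aeval_diagBlock hq (show m ≤ p by omega), hA, mul_zero]
      refine ⟨⟨?_, ?_⟩, charpoly_conj g.inv_mul _, charpoly_conj h.inv_mul _⟩ <;>
        exact (corner_eq_zero_iff (by omega) (by omega)).mpr rfl
    · rintro ⟨⟨hc, hb⟩, ha, he⟩
      obtain ⟨a, b, c, e, rfl⟩ : ∃ a b c e, y = Matrix.fromBlocks a b c e :=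
        ⟨_, _, _, _, (Matrix.fromBlocks_toBlocks y).symm⟩
      simp only [Matrix.toBlocks_fromBlocks₁₁, Matrix.toBlocks_fromBlocks₁₂,
        Matrix.toBlocks_fromBlocks₂₁, Matrix.toBlocks_fromBlocks₂₂] at hc hb ha he
      obtain ⟨haa, hab, hca, hee⟩ := fromBlocks_mem_symSpace.mp hy
      have hcop := isCoprime_mul_self_sub_one h1 h1'
      -- `f` is coprime to `X² - 1`. Since `f(a) b = b f(e) = 0` and `V (a² - 1) = 0`, a Bézout
      -- relation evaluated at `a` gives `V b = 0`.
      have key : ∀ {n n' : ℕ} {a : Matrix (Fin n) (Fin n) K} {b : Matrix (Fin n) (Fin n') K}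
          {c : Matrix (Fin n') (Fin n) K} {e : Matrix (Fin n') (Fin n') K},
          a * a - b * c = 1 → a * b = b * e → b * aeval e f = 0 →
          ∀ V : Matrix (Fin n) (Fin n) K, V * (b * c) = 0 → V * b = 0 := by
        intro n n' a b c e haa hab hb V hV
        obtain ⟨u, w, huw⟩ := hcop
        have h3 : aeval a f * b = 0 := by rw [aeval_mul_rect hab, hb]
        have h4 : V * (a * a - 1) = 0 := by rw [← haa, sub_sub_cancel, hV]
        have h5 : aeval a u * aeval a f + (a * a - 1) * aeval a w = 1 := by
          have := congrArg (aeval a) (mul_comm w (X * X - 1) ▸ huw)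
          simpa only [map_add, map_mul, map_sub, map_one, aeval_X] using this
        rw [← Matrix.mul_one V, ← h5, Matrix.mul_add, ← Matrix.mul_assoc V (a * a - 1), h4,
          Matrix.zero_mul, add_zero, Matrix.mul_assoc, Matrix.mul_assoc, h3, Matrix.mul_zero,
          Matrix.mul_zero]
      obtain ⟨m', r', t', A', hp', hq', hA'u, hA'⟩ := exists_normalForm h2 hy
        (vecMul_eq_zero_of_forall (key haa hab hb)) (vecMul_eq_zero_of_forall (key hee hca.symm hc))
      obtain ⟨g, h, hgh⟩ := (mem_conjOrbit_fixedGroup h2').mp hA'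
      simp only [Matrix.toBlocks_fromBlocks₁₁, Matrix.toBlocks_fromBlocks₁₂,
        Matrix.toBlocks_fromBlocks₂₁, Matrix.toBlocks_fromBlocks₂₂, xMat, Matrix.fromBlocks_inj] at hgh
      -- In the normal form `c f(a) = 0` reads `(A' + 1) f(A') = 0`, and `A' + 1` is invertible.
      have hA'f : aeval A' f = 0 := by
        rw [hgh.1, hgh.2.2.1, mul_aeval_conj_eq_zero_iff, corner_mul_aeval_diagBlock hp' (by omega),
          corner_eq_zero_iff (by omega) (by omega)] at hc
        obtain ⟨w, hw⟩ := ((isUnit_mul_self_sub_one_iff A').mp hA'u).2.exists_left_inv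
        rw [← one_mul (aeval A' f), ← hw, mul_assoc, hc, mul_zero]
      rw [hgh.1, charpoly_conj g.inv_mul, charpoly_diagBlock hp', charpoly_diagBlock hp] at ha
      rw [hgh.2.2.2, charpoly_conj h.inv_mul, charpoly_diagBlock hq', charpoly_diagBlock hq] at he
      obtain ⟨-, rfl, hchar⟩ := eq_of_mul_pow_eq h2 ha (eval_charpoly_ne_zero hA'u)
        (eval_charpoly_ne_zero hAu)
      obtain ⟨-, rfl, -⟩ := eq_of_mul_pow_eq h2 he (eval_charpoly_ne_zero hA'u)
        (eval_charpoly_ne_zero hAu)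
      obtain rfl : m' = m := by
        have := congrArg natDegree hchar
        simpa using this
      rw [← conjOrbit_eq_of_mem
        (xMat_mem_conjOrbit h2' hp hq (mem_conjOrbit_of_charpoly_eq hf hA'f hA hchar))]
      exact hA'
  change IsClosed _
  rw [hset]
  exact IsClosed.inter
    (IsClosed.inter (isClosed_isPolyMap_eq_zero _ (e3.mul (e1.aeval f)))
      (isClosed_isPolyMap_eq_zero _ (e2.mul (e4.aeval f))))
    (IsClosed.inter (isClosed_charpoly_eq _ e1 _) (isClosed_charpoly_eq _ e4 _))

/-- `S_{p'}` is closed in `S`, being defined there by the trace of `x θ`, and it contains the orbit.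
-/
theorem hasClosedOrbit_symComponent_iff [CharZero K] {p' : ℕ} (hp' : p' ≤ p + q)
    {x : Matrix (Fin p ⊕ Fin q) (Fin p ⊕ Fin q) K} (hx : x ∈ symComponent K p q p') :
    HasClosedOrbit K (fixedGroup K p q) (symComponent K p q p') x ↔
      HasClosedOrbit K (fixedGroup K p q) (symSpace K p q) x := by
  let := zariskiOn K (symSpace K p q)
  have htr : ∀ y ∈ symSpace K p q, y ∈ symComponent K p q p' ↔
      traceOver K (y * thetaMat K p q p) = traceOver K (x * thetaMat K p q p) := fun y hy => by
    rw [mem_symComponent_iff K hy hp', ← traceOver_of_mem_symComponent hp' hx]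
  refine hasClosedOrbit_iff_of_subset (symComponent_subset_symSpace p') ?_ fun y _ hyx => ?_
  · have h1 : {y : symSpace K p q | (y : Matrix (Fin p ⊕ Fin q) (Fin p ⊕ Fin q) K) ∈
        symComponent K p q p'} = {y : symSpace K p q | (y.1 * thetaMat K p q p).trace -
          (x * thetaMat K p q p).trace = 0} := by
      ext ⟨y, hy⟩
      simp only [Set.mem_ofPred_eq, htr y hy, sub_eq_zero]
      have : ∀ M : Matrix (Fin p ⊕ Fin q) (Fin p ⊕ Fin q) K, traceOver K M = M.trace := fun M => by
        have h : LinearMap.mulLeft K M.trace = M.trace • LinearMap.id := by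
          ext
          simp
        rw [traceOver, h, map_smul, LinearMap.trace_id]
        simp
      rw [this, this]
    rw [h1]
    exact isClosed_zeroSet_on _ ((IsPolyFun.linear (Matrix.traceLinearMap _ K K ∘ₗ
      LinearMap.mulRight K (thetaMat K p q p))).sub (.const _))
  · exact mem_symComponent_of_mem_conjOrbit hx hyx

end ClosedNormalForm

/-! ### Factorization from equality of ranks -/

section Rank

variable {K : Type*} [Field K]

theorem exists_eq_mul_of_rank_le {l m n : Type*} [Fintype l] [DecidableEq l] [Fintype m] [DecidableEq m] [Fintype n]
    [DecidableEq n] {b : Matrix l m K} {c : Matrix m n K} (h : b.rank ≤ (b * c).rank) :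
    ∃ w : Matrix n m K, b = b * c * w := by
  have h1 : LinearMap.range (b * c).mulVecLin = LinearMap.range b.mulVecLin := by
    apply Submodule.eq_of_le_of_finrank_le
    · rw [Matrix.mulVecLin_mul]
      exact LinearMap.range_comp_le_range _ _
    · exact h
  have h2 : ∀ j, ∃ v, (b * c).mulVec v = b.mulVec (Pi.single j 1) := fun j => by
    have : b.mulVecLin (Pi.single j 1) ∈ LinearMap.range (b * c).mulVecLin := by
      rw [h1]
      exact LinearMap.mem_range_self _ _
    exact this
  choose v hv using h2
  refine ⟨Matrix.of fun i j => v j i, ?_⟩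
  ext i j
  have := congrFun (hv j) i
  rw [Matrix.mulVec_single_one] at this
  exact this.symm

end Rank

/-! ### Stabilizers of normal forms -/

section Stabilizer

variable {K : Type*} [Field K] {p q m r t : ℕ}

/-- The centralizer of a normal form in the centralizer of `θ`. -/
theorem finrank_stabilizer_xMat (h2 : (2 : K) ≠ 0) (hp : m + r ≤ p) (hq : m + t ≤ q)
    {A : Matrix (Fin m) (Fin m) K} (hA : IsUnit (A * A - 1)) :
    Module.finrank K (Subalgebra.centralizer K {thetaMat K p q p} ⊓
      Subalgebra.centralizer K {xMat p q A r t} : Subalgebra K _) =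
    Module.finrank K (Subalgebra.centralizer K {A}) +
      ((p - m - r) ^ 2 + r ^ 2 + ((q - m - t) ^ 2 + t ^ 2)) := by
  have h2' : IsUnit (2 : K) := isUnit_iff_ne_zero.mpr h2
  obtain ⟨β, hβ⟩ : ∃ β, β = p - m - r := ⟨_, rfl⟩
  obtain ⟨δ, hδ⟩ : ∃ δ, δ = q - m - t := ⟨_, rfl⟩
  rw [← hβ, ← hδ]
  have hp' : m + (β + r) = p := by omega
  have hq' : m + (δ + t) = q := by omega
  let e : Matrix (Fin p ⊕ Fin q) (Fin p ⊕ Fin q) K ≃ₐ[K] Matrix ((Fin m ⊕ (Fin β ⊕ Fin r)) ⊕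
      (Fin m ⊕ (Fin δ ⊕ Fin t))) ((Fin m ⊕ (Fin β ⊕ Fin r)) ⊕ (Fin m ⊕ (Fin δ ⊕ Fin t))) K :=
    Matrix.reindexAlgEquiv K K (Equiv.sumCongr (blockEquiv hp').symm (blockEquiv hq').symm)
  have heθ : e (thetaMat K p q p) = Matrix.fromBlocks 1 0 0 (-1) := by
    rw [thetaMat_eq]
    ext i j
    rcases i with i | i <;> rcases j with j | j <;>
      simp [e, Matrix.one_apply]
  have hex : e (xMat p q A r t) = Matrix.fromBlocks (signBlock A (Fin β) (Fin r))
      (Matrix.fromBlocks (A - 1) 0 0 0) (Matrix.fromBlocks (A + 1) 0 0 0)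
      (signBlock A (Fin δ) (Fin t)) := by
    rw [← diagBlock_submatrix hp', ← diagBlock_submatrix hq', ← corner_submatrix hp' hq',
      ← corner_submatrix hq' hp']
    ext i j
    rcases i with i | i <;> rcases j with j | j <;> rfl
  let L : (Matrix (Fin m) (Fin m) K × (Matrix (Fin β) (Fin β) K × Matrix (Fin r) (Fin r) K) ×
      (Matrix (Fin δ) (Fin δ) K × Matrix (Fin t) (Fin t) K)) →ₗ[K] Matrix ((Fin m ⊕ (Fin β ⊕ Fin r)) ⊕
      (Fin m ⊕ (Fin δ ⊕ Fin t))) ((Fin m ⊕ (Fin β ⊕ Fin r)) ⊕ (Fin m ⊕ (Fin δ ⊕ Fin t))) K :=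
    { toFun := fun z => Matrix.fromBlocks
        (Matrix.fromBlocks z.1 0 0 (Matrix.fromBlocks z.2.1.1 0 0 z.2.1.2)) 0 0
        (Matrix.fromBlocks z.1 0 0 (Matrix.fromBlocks z.2.2.1 0 0 z.2.2.2))
      map_add' := fun z w => by simp [Matrix.fromBlocks_add]
      map_smul' := fun c z => by simp [Matrix.fromBlocks_smul] }
  have hLinj : Function.Injective L := fun z w h => by
    simp only [L, LinearMap.coe_mk, AddHom.coe_mk, Matrix.fromBlocks_inj, true_and] at h
    exact Prod.ext h.1.1 (Prod.ext (Prod.ext h.1.2.1 h.1.2.2) (Prod.ext h.2.2.1 h.2.2.2))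
  let S : Submodule K (Matrix (Fin m) (Fin m) K × (Matrix (Fin β) (Fin β) K × Matrix (Fin r) (Fin r) K) ×
      (Matrix (Fin δ) (Fin δ) K × Matrix (Fin t) (Fin t) K)) :=
    (Subalgebra.centralizer K {A}).toSubmodule.prod ⊤
  -- A matrix commuting with `θ` is `diag(U, V)`. Commuting with the diagonal blocks makes `U` and
  -- `V` block diagonal; commuting with the corner `A - 1`, which is invertible, makes their first
  -- blocks equal.
  have hS : S.map L = ((Subalgebra.centralizer K {e (thetaMat K p q p)} ⊓
      Subalgebra.centralizer K {e (xMat p q A r t)} : Subalgebra K _)).toSubmodule := by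
    rw [heθ, hex]
    ext M
    rw [Subalgebra.mem_toSubmodule, Algebra.mem_inf, Subalgebra.mem_centralizer_iff,
      Subalgebra.mem_centralizer_iff]
    simp only [Set.mem_singleton_iff, forall_eq]
    constructor
    · rintro ⟨⟨u, ⟨v, w⟩, v', w'⟩, ⟨hu, -⟩, rfl⟩
      have hu' : A * u = u * A := (Subalgebra.mem_centralizer_iff K).mp hu A rfl
      constructor
      · simp [L, Matrix.fromBlocks_multiply]
      · simp [L, signBlock, Matrix.fromBlocks_multiply, mul_sub, mul_add, sub_mul, add_mul, hu']
    · rintro ⟨hM1, hM2⟩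
      obtain ⟨U, B, C, V, rfl⟩ : ∃ U B C V, M = Matrix.fromBlocks U B C V :=
        ⟨_, _, _, _, (Matrix.fromBlocks_toBlocks M).symm⟩
      simp only [Matrix.fromBlocks_multiply, Matrix.fromBlocks_inj, Matrix.zero_mul, Matrix.mul_zero,
        add_zero, zero_add, Matrix.one_mul, Matrix.mul_one, Matrix.neg_mul, Matrix.mul_neg, true_and,
        and_true] at hM1
      obtain rfl : B = 0 := two_nsmul_eq_zero_of_isUnit h2' hM1.1
      obtain rfl : C = 0 := two_nsmul_eq_zero_of_isUnit h2' hM1.2.symm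
      rw [Matrix.fromBlocks_multiply, Matrix.fromBlocks_multiply, Matrix.fromBlocks_inj] at hM2
      simp only [Matrix.zero_mul, Matrix.mul_zero, add_zero, zero_add] at hM2
      obtain ⟨hU, hUV, -, hV⟩ := hM2
      obtain ⟨u, v, w, rfl, hu⟩ := (signBlock_intertwine h2' hA hA U).mp hU
      obtain ⟨u', v', w', rfl, hu'⟩ := (signBlock_intertwine h2' hA hA V).mp hV
      obtain ⟨y, hy⟩ := ((isUnit_mul_self_sub_one_iff A).mp hA).1.exists_left_inv
      have huu : u' = u := by
        simp only [Matrix.fromBlocks_multiply, Matrix.fromBlocks_inj, Matrix.zero_mul,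
          Matrix.mul_zero, add_zero] at hUV
        have h3 : (A - 1) * u' = (A - 1) * u := by
          rw [hUV.1, mul_sub, sub_mul, hu, mul_one, one_mul]
        rw [← one_mul u', ← one_mul u, ← hy, mul_assoc, h3, mul_assoc]
      subst huu
      exact ⟨⟨u', ⟨v, w⟩, v', w'⟩, ⟨(Subalgebra.mem_centralizer_iff K).mpr (by simpa using hu),
        trivial⟩, rfl⟩
  rw [finrank_subalgebra_eq_of_algEquiv e (T := Subalgebra.centralizer K {e (thetaMat K p q p)} ⊓
      Subalgebra.centralizer K {e (xMat p q A r t)}) (fun a => by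
        simp only [Algebra.mem_inf, Subalgebra.mem_centralizer_iff, Set.mem_singleton_iff, forall_eq,
          ← map_mul, e.injective.eq_iff]), ← Subalgebra.finrank_toSubmodule, ← hS,
    ← (Submodule.equivMapOfInjective L hLinj S).finrank_eq,
    ← Subalgebra.finrank_toSubmodule]
  have h3 : Module.finrank K S = Module.finrank K ((Subalgebra.centralizer K {A}).toSubmodule ×
      (Matrix (Fin β) (Fin β) K × Matrix (Fin r) (Fin r) K) ×
      (Matrix (Fin δ) (Fin δ) K × Matrix (Fin t) (Fin t) K)) := by
    symm
    exact LinearEquiv.finrank_eq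
      { toFun := fun z => ⟨(z.1, z.2), z.1.2, trivial⟩
        map_add' := fun _ _ => rfl
        map_smul' := fun _ _ => rfl
        invFun := fun z => (⟨z.1.1, z.2.1⟩, z.1.2)
        left_inv := fun _ => rfl
        right_inv := fun _ => rfl }
  rw [h3]
  simp only [Module.finrank_prod, Module.finrank_matrix, Fintype.card_fin, Module.finrank_self, mul_one]
  ring

end Stabilizer

/-! ### Rank bounds on S_{p'} -/

section BlockRank

variable {K : Type*} [Field K] {p q p' : ℕ}

theorem rank_add_le {m n : Type*} [Fintype m] [Fintype n] (A B : Matrix m n K) :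
    (A + B).rank ≤ A.rank + B.rank := by
  refine le_trans (Submodule.finrank_mono ?_) (Submodule.finrank_add_le_finrank_add_finrank
    (LinearMap.range A.mulVecLin) (LinearMap.range B.mulVecLin))
  rw [Matrix.mulVecLin_add]
  exact LinearMap.range_add_le _ _

theorem rank_fromBlocks_off_diagonal_le {m n : Type*} [Fintype m] [DecidableEq m] [Fintype n]
    [DecidableEq n] (b : Matrix m n K) (c : Matrix n m K) :
    (Matrix.fromBlocks 0 b c 0).rank ≤ b.rank + c.rank := by
  have h1 : (Matrix.fromBlocks 0 b c 0 : Matrix (m ⊕ n) (m ⊕ n) K) =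
      (Matrix.fromRows 1 0 : Matrix (m ⊕ n) m K) * b * (Matrix.fromCols 0 1 : Matrix n (m ⊕ n) K) +
        (Matrix.fromRows 0 1 : Matrix (m ⊕ n) n K) * c *
          (Matrix.fromCols 1 0 : Matrix m (m ⊕ n) K) := by
    simp only [Matrix.fromRows_mul, Matrix.mul_fromCols, Matrix.one_mul, Matrix.zero_mul,
      Matrix.mul_one, Matrix.mul_zero]
    ext i j
    rcases i with i | i <;> rcases j with j | j <;> simp
  rw [h1]
  refine (rank_add_le _ _).trans (Nat.add_le_add ?_ ?_)
  · exact (Matrix.rank_mul_le_left _ _).trans (Matrix.rank_mul_le_right _ _)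
  · exact (Matrix.rank_mul_le_left _ _).trans (Matrix.rank_mul_le_right _ _)

/-- The eigenvalues of `x θ` bound the ranks of `x + θ` and `x - θ`. -/
theorem rank_add_thetaMat_le (hp' : p' ≤ p + q)
    {x : Matrix (Fin p ⊕ Fin q) (Fin p ⊕ Fin q) K} (hx : x ∈ symComponent K p q p') :
    (x + thetaMat K p q p).rank ≤ p' ∧ (x - thetaMat K p q p).rank ≤ p + q - p' := by
  classical
  obtain ⟨g, rfl⟩ := hx
  have h1 : ∀ M : Matrix (Fin p ⊕ Fin q) (Fin p ⊕ Fin q) K,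
      (g.1 * M * (g⁻¹).1 * thetaMat K p q p).rank ≤ M.rank := fun M =>
    ((Matrix.rank_mul_le_left _ _).trans (Matrix.rank_mul_le_left _ _)).trans
      (Matrix.rank_mul_le_right _ _)
  -- This writes `x ± θ` as `g (θ_{p'} ± 1) g⁻¹ θ`, so its rank is at most that of the diagonal
  -- matrix `θ_{p'} ± 1`.
  have h2 : thetaMat K p q p = g.1 * 1 * (g⁻¹).1 * thetaMat K p q p := by
    rw [mul_one, Units.mul_inv, one_mul]
  constructor
  · nth_rw 2 [h2]
    rw [← add_mul, ← add_mul, ← mul_add]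
    refine (h1 _).trans ?_
    rw [thetaMat, ← Matrix.diagonal_one, Matrix.diagonal_add, Matrix.rank_diagonal]
    calc _ ≤ Fintype.card (Fin p') := Fintype.card_le_of_injective
          (fun i => ⟨finSumFinEquiv i.1, by
            by_contra h
            apply i.2
            simp [h]⟩) (fun i j h => by
            rw [Fin.mk.injEq] at h
            exact Subtype.ext (finSumFinEquiv.injective (Fin.ext h)))
      _ = p' := Fintype.card_fin _
  · nth_rw 2 [h2]
    rw [← sub_mul, ← sub_mul, ← mul_sub]
    refine (h1 _).trans ?_
    rw [thetaMat, ← Matrix.diagonal_one, Matrix.diagonal_sub, Matrix.rank_diagonal]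
    have h3 : ∀ i : {i : Fin p ⊕ Fin q //
        (if (finSumFinEquiv i : ℕ) < p' then (1 : K) else -1) - 1 ≠ 0},
        p' ≤ (finSumFinEquiv i.1 : ℕ) := fun i => by
      by_contra h
      apply i.2
      rw [if_pos (by omega), sub_self]
    calc _ ≤ Fintype.card (Fin (p + q - p')) := Fintype.card_le_of_injective
          (fun i => ⟨(finSumFinEquiv i.1 : ℕ) - p', by
            have := (finSumFinEquiv i.1).2
            have := h3 i
            omega⟩) (fun i j h => by
            rw [Fin.mk.injEq] at h
            have hi := h3 i
            have hj := h3 j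
            exact Subtype.ext (finSumFinEquiv.injective (Fin.ext (by omega))))
      _ = p + q - p' := Fintype.card_fin _

/-- Since `θ` is block diagonal, `b` and `c` are submatrices of both `x + θ` and `x - θ`, so `p'`
and `q'` bound their ranks as well as `p` and `q`. The blocks `a ± 1` are submatrices too. -/
theorem rank_toBlocks_le (hp' : p' ≤ p + q)
    {x : Matrix (Fin p ⊕ Fin q) (Fin p ⊕ Fin q) K} (hx : x ∈ symComponent K p q p') :
    x.toBlocks₁₂.rank ≤ nu p q p' ∧ x.toBlocks₂₁.rank ≤ nu p q p' ∧
      (x.toBlocks₁₁ + 1).rank ≤ p' ∧ (x.toBlocks₁₁ - 1).rank ≤ p + q - p' := by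
  obtain ⟨h1, h2⟩ := rank_add_thetaMat_le hp' hx
  have e1 : (x + thetaMat K p q p).submatrix Sum.inl Sum.inr = x.toBlocks₁₂ := by
    ext i j
    simp [thetaMat_eq, Matrix.toBlocks₁₂]
  have e2 : (x - thetaMat K p q p).submatrix Sum.inl Sum.inr = x.toBlocks₁₂ := by
    ext i j
    simp [thetaMat_eq, Matrix.toBlocks₁₂]
  have e3 : (x + thetaMat K p q p).submatrix Sum.inr Sum.inl = x.toBlocks₂₁ := by
    ext i j
    simp [thetaMat_eq, Matrix.toBlocks₂₁]
  have e4 : (x - thetaMat K p q p).submatrix Sum.inr Sum.inl = x.toBlocks₂₁ := by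
    ext i j
    simp [thetaMat_eq, Matrix.toBlocks₂₁]
  have e5 : (x + thetaMat K p q p).submatrix Sum.inl Sum.inl = x.toBlocks₁₁ + 1 := by
    ext i j
    simp [thetaMat_eq, Matrix.toBlocks₁₁]
  have e6 : (x - thetaMat K p q p).submatrix Sum.inl Sum.inl = x.toBlocks₁₁ - 1 := by
    ext i j
    simp [thetaMat_eq, Matrix.toBlocks₁₁]
  refine ⟨le_min (le_min ?_ ?_) (le_min ?_ ?_), le_min (le_min ?_ ?_) (le_min ?_ ?_), ?_, ?_⟩
  · simpa using x.toBlocks₁₂.rank_le_height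
  · simpa using x.toBlocks₁₂.rank_le_width
  · exact e1 ▸ (Matrix.rank_submatrix_le _ _ _).trans h1
  · exact e2 ▸ (Matrix.rank_submatrix_le _ _ _).trans h2
  · simpa using x.toBlocks₂₁.rank_le_width
  · simpa using x.toBlocks₂₁.rank_le_height
  · exact e3 ▸ (Matrix.rank_submatrix_le _ _ _).trans h1
  · exact e4 ▸ (Matrix.rank_submatrix_le _ _ _).trans h2
  · exact e5 ▸ (Matrix.rank_submatrix_le _ _ _).trans h1
  · exact e6 ▸ (Matrix.rank_submatrix_le _ _ _).trans h2

theorem rank_mul_self_sub_one_le (hp' : p' ≤ p + q)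
    {x : Matrix (Fin p ⊕ Fin q) (Fin p ⊕ Fin q) K} (hx : x ∈ symComponent K p q p') :
    (x * x - 1).rank ≤ 2 * nu p q p' := by
  obtain ⟨h1, h2, -, -⟩ := rank_toBlocks_le hp' hx
  rw [(mul_self_sub_one_eq (symComponent_subset_symSpace p' hx)).1]
  have := (Matrix.rank_mul_le_left (Matrix.fromBlocks 0 x.toBlocks₁₂ x.toBlocks₂₁ 0) (x + x)).trans
    (rank_fromBlocks_off_diagonal_le _ _)
  omega

/-- Up to an invertible factor `x² - 1` is the off-diagonal part, which contains the invertible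
submatrix `diag(A - 1, A + 1)`. -/
theorem le_rank_xMat_mul_self_sub_one (h2 : (2 : K) ≠ 0) {m r t : ℕ} (hp : m + r ≤ p)
    (hq : m + t ≤ q) {A : Matrix (Fin m) (Fin m) K} (hA : IsUnit (A * A - 1)) :
    2 * m ≤ (xMat p q A r t * xMat p q A r t - 1).rank := by
  have hS := xMat_mem_symSpace hp hq A
  rw [(mul_self_sub_one_eq hS).1]
  have hu : IsUnit (xMat p q A r t + xMat p q A r t).det := by
    rw [← Matrix.isUnit_iff_isUnit_det, ← two_smul K]
    have h3 : xMat p q A r t * (thetaMat K p q p * xMat p q A r t * thetaMat K p q p) = 1 := by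
      have : (xMat p q A r t * thetaMat K p q p) ^ 2 = 1 := hS
      rw [← this, sq]
      simp only [mul_assoc]
    refine IsUnit.of_mul_eq_one ((2 : K)⁻¹ • (thetaMat K p q p * xMat p q A r t * thetaMat K p q p)) ?_
    rw [Matrix.smul_mul, Matrix.mul_smul, smul_smul, mul_inv_cancel₀ h2, one_smul, h3]
  rw [Matrix.rank_mul_eq_left_of_isUnit_det _ _ hu, xMat, Matrix.toBlocks_fromBlocks₁₂,
    Matrix.toBlocks_fromBlocks₂₁]
  let ιp : Fin m → Fin p := Fin.castLE (by omega)
  let ιq : Fin m → Fin q := Fin.castLE (by omega)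
  have hsub : (Matrix.fromBlocks 0 (corner p q (A - 1)) (corner q p (A + 1)) 0 :
      Matrix (Fin p ⊕ Fin q) (Fin p ⊕ Fin q) K).submatrix (Sum.map ιp ιq)
        (Sum.elim (Sum.inr ∘ ιq) (Sum.inl ∘ ιp)) = Matrix.fromBlocks (A - 1) 0 0 (A + 1) := by
    ext i j
    rcases i with i | i <;> rcases j with j | j <;> simp [corner, ιp, ιq] <;> rfl
  have hrk : (Matrix.fromBlocks (A - 1) 0 0 (A + 1)).rank = 2 * m := by
    rw [Matrix.rank_of_isUnit]
    · simp [two_mul]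
    · obtain ⟨h3, h4⟩ := (isUnit_mul_self_sub_one_iff A).mp hA
      rw [Matrix.isUnit_iff_isUnit_det] at h3 h4 ⊢
      rw [Matrix.det_fromBlocks_zero₂₁]
      exact h3.mul h4
  rw [← hrk, ← hsub]
  exact Matrix.rank_submatrix_le _ _ _

end BlockRank

/-! ### Arithmetic of the parameters -/

section Parameters

variable {p q p' m r t : ℕ}

/-- With `α = p - m - r` and `δ = q - m - t`, the numbers `p, q, p', q'` are `m` plus `α + r`, `δ +
t`, `α + t`, `δ + r`, and the least of these sums is `min α δ + min r t`. -/
theorem nu_le (hp : m + r ≤ p) (hq : m + t ≤ q) (h : (t : ℤ) - r = (p' : ℤ) - p) :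
    nu p q p' ≤ m + min (p - m - r) (q - m - t) + min r t := by
  unfold nu
  omega

theorem min_le_mul (a b : ℕ) : min a b ≤ a * b := by
  rcases Nat.eq_zero_or_pos a with rfl | ha
  · simp
  rcases Nat.eq_zero_or_pos b with rfl | hb
  · simp
  exact (min_le_left a b).trans (Nat.le_mul_of_pos_right a hb)

/-- Use `u² + v² = (u - v)² + 2uv` twice: the differences `α - δ = p' - q` and `t - r = p' - p`
depend only on the component, so the products `αδ` and `rt` measure the excess over the minimum. -/
theorem sum_sq_eq (hp : m + r ≤ p) (hq : m + t ≤ q) (h : (t : ℤ) - r = (p' : ℤ) - p) :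
    (((p - m - r) ^ 2 + r ^ 2 + ((q - m - t) ^ 2 + t ^ 2) : ℕ) : ℤ) =
      ((p' : ℤ) - q) ^ 2 + ((p' : ℤ) - p) ^ 2 + 2 * ((p - m - r) * (q - m - t) + r * t : ℕ) := by
  obtain ⟨a, ha⟩ := Nat.exists_eq_add_of_le hp
  obtain ⟨b, hb⟩ := Nat.exists_eq_add_of_le hq
  rw [show p - m - r = a by omega, show q - m - t = b by omega]
  have h1 : (a : ℤ) - b = (p' : ℤ) - q := by omega
  rw [← h, ← h1]
  push_cast
  ring

end Parameters

/-! ### Stabilizer dimensions in the presence of a normal form -/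

section LowerBound

variable {K : Type*} [Field K] {p q p' : ℕ}

/-- The dimension of the centralizer of `x` in the algebra of matrices commuting with `θ`. -/
noncomputable def stabRank (x : Matrix (Fin p ⊕ Fin q) (Fin p ⊕ Fin q) K) : ℕ :=
  Module.finrank K (Subalgebra.centralizer K {thetaMat K p q p} ⊓ Subalgebra.centralizer K {x} :
    Subalgebra K (Matrix (Fin p ⊕ Fin q) (Fin p ⊕ Fin q) K))

theorem mem_stab_iff {x M : Matrix (Fin p ⊕ Fin q) (Fin p ⊕ Fin q) K} :
    M ∈ (Subalgebra.centralizer K {thetaMat K p q p} ⊓ Subalgebra.centralizer K {x} :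
      Subalgebra K (Matrix (Fin p ⊕ Fin q) (Fin p ⊕ Fin q) K)) ↔
      Commute M (thetaMat K p q p) ∧ Commute M x := by
  simp only [Algebra.mem_inf, Subalgebra.mem_centralizer_iff, Set.mem_singleton_iff, forall_eq]
  exact ⟨fun h => ⟨h.1.symm, h.2.symm⟩, fun h => ⟨h.1.eq.symm, h.2.eq.symm⟩⟩

theorem stabRank_eq_of_mem_conjOrbit {x y : Matrix (Fin p ⊕ Fin q) (Fin p ⊕ Fin q) K}
    (h : y ∈ conjOrbit (fixedGroup K p q) x) : stabRank y = stabRank x := by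
  obtain ⟨g, hg, rfl⟩ := h
  rw [mem_fixedGroup_iff] at hg
  let e := conjEquiv (K := K) g.mul_inv g.inv_mul
  have heθ : e (thetaMat K p q p) = thetaMat K p q p := by
    rw [conjEquiv_apply, hg, mul_assoc, Units.mul_inv, mul_one]
  refine (finrank_subalgebra_eq_of_algEquiv e fun a => ?_).symm
  rw [mem_stab_iff, mem_stab_iff]
  nth_rw 1 [← heθ]
  rw [← conjEquiv_apply g.mul_inv g.inv_mul x]
  simp only [Commute, SemiconjBy]
  rw [← map_mul, ← map_mul, ← map_mul, ← map_mul, e.injective.eq_iff, e.injective.eq_iff]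

/-- The linear map whose kernel describes the centralizer of `g θ_{p'} g⁻¹ θ`. -/
noncomputable def stabMap (p' : ℕ) (g : Matrix (Fin p ⊕ Fin q) (Fin p ⊕ Fin q) K) :
    Subalgebra.centralizer K {thetaMat K p q p} × Subalgebra.centralizer K {thetaMat K p q p'} →ₗ[K]
      Matrix (Fin p ⊕ Fin q) (Fin p ⊕ Fin q) K :=
  LinearMap.mulRight K g ∘ₗ (Subalgebra.val _).toLinearMap ∘ₗ LinearMap.fst K _ _ -
    LinearMap.mulLeft K g ∘ₗ (Subalgebra.val _).toLinearMap ∘ₗ LinearMap.snd K _ _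

theorem stabMap_apply (g : Matrix (Fin p ⊕ Fin q) (Fin p ⊕ Fin q) K)
    (z : Subalgebra.centralizer K {thetaMat K p q p} × Subalgebra.centralizer K {thetaMat K p q p'}) :
    stabMap p' g z = z.1.1 * g - g * z.2.1 := rfl

/-- `M` centralizes `θ` and `g θ_{p'} g⁻¹` exactly when it commutes with `θ` and `g⁻¹ M g` commutes
with `θ_{p'}`. Keeping both `M` and `N = g⁻¹ M g` turns this into `M g = g N`, which is linear in
`g` on a fixed space, as semicontinuity requires. -/
theorem stabRank_eq_finrank_ker (g : (Matrix (Fin p ⊕ Fin q) (Fin p ⊕ Fin q) K)ˣ) :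
    stabRank (g.1 * thetaMat K p q p' * (g⁻¹).1 * thetaMat K p q p) =
      Module.finrank K (LinearMap.ker (stabMap p' g.1)) := by
  let φ : LinearMap.ker (stabMap p' g.1) →ₗ[K] Matrix (Fin p ⊕ Fin q) (Fin p ⊕ Fin q) K :=
    (Subalgebra.val _).toLinearMap ∘ₗ LinearMap.fst K _ _ ∘ₗ Submodule.subtype _
  have hφ : ∀ z, φ z = z.1.1.1 := fun z => rfl
  have hker : ∀ z : LinearMap.ker (stabMap p' g.1), z.1.1.1 * g.1 = g.1 * z.1.2.1 := fun z => by
    have := z.2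
    rwa [LinearMap.mem_ker, stabMap_apply, sub_eq_zero] at this
  have hinj : Function.Injective φ := fun z w h => by
    rw [hφ, hφ] at h
    refine Subtype.ext (Prod.ext (Subtype.ext h) (Subtype.ext ?_))
    have h1 := hker z
    rw [h, hker w] at h1
    have := congrArg (fun c => (g⁻¹).1 * c) h1
    simpa only [← mul_assoc, Units.inv_mul, one_mul] using this.symm
  rw [← LinearMap.finrank_range_of_inj hinj, stabRank, ← Subalgebra.finrank_toSubmodule]
  refine congrArg (fun S : Submodule K (Matrix (Fin p ⊕ Fin q) (Fin p ⊕ Fin q) K) =>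
    Module.finrank K S) ?_
  have hθ := thetaMat_mul_self (R := K) p q p
  set θ := thetaMat K p q p
  set θ' := thetaMat K p q p'
  ext M
  rw [Subalgebra.mem_toSubmodule, mem_stab_iff]
  constructor
  · rintro ⟨hM1, hM2⟩
    have hM3 : Commute M (g.1 * θ' * (g⁻¹).1) := by
      have := hM2.mul_right hM1
      rwa [mul_assoc _ θ θ, hθ, mul_one] at this
    have hN : Commute ((g⁻¹).1 * M * g.1) θ' := by
      have := congrArg (fun c => (g⁻¹).1 * c * g.1) hM3.eq
      simp only [mul_assoc, Units.inv_mul_cancel_left, Units.inv_mul, mul_one] at this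
      rw [Commute, SemiconjBy]
      simp only [mul_assoc]
      exact this
    refine ⟨⟨(⟨M, ?_⟩, ⟨(g⁻¹).1 * M * g.1, ?_⟩), ?_⟩, rfl⟩
    · rw [Subalgebra.mem_centralizer_iff]
      simpa using hM1.eq.symm
    · rw [Subalgebra.mem_centralizer_iff]
      simpa using hN.eq.symm
    · rw [LinearMap.mem_ker, stabMap_apply]
      simp only [mul_assoc, Units.mul_inv_cancel_left, sub_self]
  · rintro ⟨z, rfl⟩
    rw [hφ]
    have h1 : Commute z.1.1.1 θ := ((Subalgebra.mem_centralizer_iff K).mp z.1.1.2 θ rfl).symm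
    have h2 : Commute z.1.2.1 θ' := ((Subalgebra.mem_centralizer_iff K).mp z.1.2.2 θ' rfl).symm
    refine ⟨h1, Commute.mul_right ?_ h1⟩
    have h3 : z.1.1.1 = g.1 * z.1.2.1 * (g⁻¹).1 := by
      rw [← hker z, mul_assoc, Units.mul_inv, mul_one]
    rw [h3, Commute, SemiconjBy]
    simp only [mul_assoc, Units.inv_mul_cancel_left]
    rw [← mul_assoc z.1.2.1, h2.eq, mul_assoc]

theorem isPolyMap_adjugate {n : Type*} [Fintype n] [DecidableEq n] :
    IsPolyMap K (fun w : Matrix n n K => w.adjugate) := fun i j => by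
  simp only [Matrix.adjugate_apply]
  refine IsPolyFun.det (M := fun w : Matrix n n K => w.updateRow j (Pi.single i 1)) fun a b => ?_
  by_cases h : a = j
  · subst h
    simp only [Matrix.updateRow_self]
    exact .const _
  · simp only [Matrix.updateRow_ne h]
    exact .linear (Matrix.entryLinearMap K K a b)

theorem IsPolyMap.linear_mulVec {W m n : Type*} [AddCommGroup W] [Module K W] [Fintype m]
    [DecidableEq m] [Fintype n] {M : W → Matrix m n K} (h : IsPolyMap K M) (l : (m → K) →ₗ[K] K)
    (v : n → K) : IsPolyFun K (fun w => l ((M w).mulVec v)) := by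
  have h1 : ∀ w, l ((M w).mulVec v) = ∑ a, (∑ b, M w a b * v b) * l (Pi.single a 1) := fun w => by
    conv_lhs => rw [pi_eq_sum_univ' ((M w).mulVec v)]
    simp only [map_sum, map_smul, smul_eq_mul, Matrix.mulVec, dotProduct]
  simp only [h1]
  exact .sum _ fun a => (IsPolyFun.sum _ fun b => (h a b).mul (.const _)).mul (.const _)

/-- If `x` is semisimple at the eigenvalues `±1`, its stabilizer is at least as large as the
generic one. -/
theorem le_stabRank_of_normalForm [Infinite K] [CharZero K] (hp' : p' ≤ p + q)
    {x : Matrix (Fin p ⊕ Fin q) (Fin p ⊕ Fin q) K} (hx : x ∈ symComponent K p q p')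
    (hz : ∃ w, x * x - 1 = (x * x - 1) * (x * x - 1) * w) :
    (nu p q p' : ℤ) + (((p' : ℤ) - q) ^ 2 + ((p' : ℤ) - p) ^ 2) ≤ stabRank x := by
  have h2 : (2 : K) ≠ 0 := two_ne_zero
  obtain ⟨w, hw⟩ := hz
  obtain ⟨m, r, t, A, hp, hq, hA, hxA⟩ := exists_normalForm_of_forall h2
    (symComponent_subset_symSpace p' hx) (fun W hW => by
      rw [hw, ← mul_assoc, ← mul_assoc, hW, zero_mul])
  have htr : (t : ℤ) - r = (p' : ℤ) - p := by
    rw [← xMat_mem_symComponent_iff K hp' hp hq A]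
    refine mem_symComponent_of_mem_conjOrbit hx ?_
    rw [conjOrbit_eq_of_mem hxA]
    exact mem_conjOrbit_self _ _
  rw [stabRank_eq_of_mem_conjOrbit hxA, stabRank, finrank_stabilizer_xMat h2 hp hq hA, Nat.cast_add,
    sum_sq_eq hp hq htr]
  -- The bound combines `m ≤ dim Z(A)` and `ν ≤ m + min α δ + min r t` with `min u v ≤ u v`.
  have h3 := le_finrank_centralizer A
  have h4 := nu_le hp hq htr
  have h5 := min_le_mul (p - m - r) (q - m - t)
  have h6 := min_le_mul r t
  have h7 : nu p q p' ≤ Module.finrank K (Subalgebra.centralizer K {A}) +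
    2 * ((p - m - r) * (q - m - t) + r * t) := by omega
  have h8 : (nu p q p' : ℤ) ≤ Module.finrank K (Subalgebra.centralizer K {A}) +
    2 * ((p - m - r) * (q - m - t) + r * t : ℕ) := by exact_mod_cast h7
  linarith

/-- A generic point of `S_{p'}`. -/
theorem exists_generic [IsAlgClosed K] [CharZero K] (hp' : p' ≤ p + q) :
    ∃ x ∈ symComponent K p q p', 2 * nu p q p' ≤ (x * x - 1).rank ∧
      (∃ w, x * x - 1 = (x * x - 1) * (x * x - 1) * w) ∧
      (nu p q p' : ℤ) + (((p' : ℤ) - q) ^ 2 + ((p' : ℤ) - p) ^ 2) = stabRank x := by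
  have h2 : (2 : K) ≠ 0 := two_ne_zero
  -- The entries `2, 3, …` are distinct and different from `±1` in characteristic zero.
  let v : Fin (nu p q p') → K := fun i => (i : ℕ) + 2
  have hv : Function.Injective v := fun i j h => by
    simp only [v] at h
    exact Fin.ext (by exact_mod_cast add_right_cancel h)
  have hp : nu p q p' + (p - p') ≤ p := by unfold nu; omega
  have hq : nu p q p' + (p' - p) ≤ q := by unfold nu; omega
  have htr : ((p' - p : ℕ) : ℤ) - (p - p' : ℕ) = (p' : ℤ) - p := by omega
  obtain ⟨f, hf⟩ : ∃ f : K[X], f = ∏ i, (X - C (v i)) := ⟨_, rfl⟩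
  have hfs : f.Separable := hf ▸ Polynomial.separable_prod_X_sub_C_iff.mpr hv
  have hfA : aeval (Matrix.diagonal v) f = 0 := by
    rw [hf, ← Matrix.charpoly_diagonal, Matrix.aeval_self_charpoly]
  have hf1 : f.eval 1 ≠ 0 := by
    rw [hf, eval_prod, Finset.prod_ne_zero_iff]
    intro i _
    rw [eval_sub, eval_X, eval_C, sub_ne_zero]
    simp only [v]
    norm_cast
    omega
  have hf1' : f.eval (-1) ≠ 0 := by
    rw [hf, eval_prod, Finset.prod_ne_zero_iff]
    intro i _
    rw [eval_sub, eval_X, eval_C, sub_ne_zero]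
    simp only [v]
    intro h
    have h3 : ((i : ℕ) + 2 + 1 : K) = 0 := by rw [← h]; simp
    norm_cast at h3
  have hA : IsUnit (Matrix.diagonal v * Matrix.diagonal v - 1) :=
    isUnit_of_aeval_eq_zero hfA hf1 hf1'
  refine ⟨xMat p q (Matrix.diagonal v) (p - p') (p' - p),
    (xMat_mem_symComponent_iff K hp' hp hq _).mpr htr,
    le_rank_xMat_mul_self_sub_one h2 hp hq hA,
    sub_one_eq_mul_of_hasClosedOrbit h2 (xMat_mem_symSpace hp hq _)
      (hasClosedOrbit_xMat h2 hp hq hfs hfA hf1 hf1'), ?_⟩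
  rw [stabRank, finrank_stabilizer_xMat h2 hp hq hA, Nat.cast_add, sum_sq_eq hp hq htr,
    finrank_centralizer_diagonal hv]
  -- For these parameters one factor of each product vanishes, so there is no excess.
  have h3 : (p - nu p q p' - (p - p')) * (q - nu p q p' - (p' - p)) = 0 := by
    unfold nu
    rw [Nat.mul_eq_zero]
    omega
  have h4 : (p - p') * (p' - p) = 0 := by
    rw [Nat.mul_eq_zero]
    omega
  rw [h3, h4]
  simp

end LowerBound

/-! ### The lower bound for all stabilizers -/

section LowerBoundAll

variable {K : Type*} [Field K] {p q p' : ℕ}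

theorem exists_linearIndependent_mulVec {m n : Type*} [Fintype m] [Fintype n] (M : Matrix m n K) :
    ∃ u : Fin M.rank → (n → K), LinearIndependent K (fun i => M.mulVec (u i)) := by
  let b := Module.finBasis K (LinearMap.range M.mulVecLin)
  choose u hu using fun i => (b i).2
  refine ⟨u, ?_⟩
  have h1 : (fun i => M.mulVec (u i)) = fun i => (b i : m → K) := funext hu
  have h2 := b.linearIndependent.map' (Submodule.subtype _) (Submodule.ker_subtype _)
  exact h1 ▸ h2

theorem card_le_rank {m n ι : Type*} [Fintype m] [Fintype n] [Fintype ι] {M : Matrix m n K}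
    {u : ι → (n → K)} (h : LinearIndependent K (fun i => M.mulVec (u i))) :
    Fintype.card ι ≤ M.rank :=
  card_le_finrank_of_mem (LinearMap.range M.mulVecLin) h fun i => ⟨u i, rfl⟩

/-- The dimension of the stabilizers is bounded below by its generic value. -/
theorem le_stabRank [IsAlgClosed K] [CharZero K] (hp' : p' ≤ p + q)
    {x : Matrix (Fin p ⊕ Fin q) (Fin p ⊕ Fin q) K} (hx : x ∈ symComponent K p q p') :
    (nu p q p' : ℤ) + (((p' : ℤ) - q) ^ 2 + ((p' : ℤ) - p) ^ 2) ≤ stabRank x := by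
  obtain ⟨y, hy, hy1, ⟨w, hw⟩, -⟩ := exists_generic (K := K) hp'
  have hrk : 2 * nu p q p' ≤ ((y * y - 1) * (y * y - 1)).rank := by
    rw [hw] at hy1
    exact hy1.trans (Matrix.rank_mul_le_left _ _)
  obtain ⟨g, rfl⟩ := hx
  obtain ⟨h, rfl⟩ := hy
  set θ := thetaMat K p q p
  set θ' := thetaMat K p q p'
  let pt (k : (Matrix (Fin p ⊕ Fin q) (Fin p ⊕ Fin q) K)ˣ) := k.1 * θ' * (k⁻¹).1 * θ
  -- The adjugate replaces the inverse to make this polynomial in `k`; on units it only introduces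
  -- nonzero powers of the determinant.
  let Y (k : Matrix (Fin p ⊕ Fin q) (Fin p ⊕ Fin q) K) := k * θ' * k.adjugate * θ
  let Z₁ (k : Matrix (Fin p ⊕ Fin q) (Fin p ⊕ Fin q) K) := Y k * Y k - k.det • (k.det • 1)
  let Z (k : Matrix (Fin p ⊕ Fin q) (Fin p ⊕ Fin q) K) := Z₁ k * Z₁ k
  have hY : ∀ k, Y (Units.val k) = k.1.det • pt k := fun k => by
    have h1 : k.1.adjugate = k.1.det • (k⁻¹).1 := by
      rw [← mul_one k.1.adjugate, ← Units.mul_inv k, ← mul_assoc, Matrix.adjugate_mul,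
        Matrix.smul_mul, one_mul]
    simp only [Y, pt, h1, Matrix.mul_smul, Matrix.smul_mul]
  have hZ₁ : ∀ k, Z₁ (Units.val k) = (k.1.det * k.1.det) • (pt k * pt k - 1) := fun k => by
    simp only [Z₁, hY, Matrix.mul_smul, Matrix.smul_mul, smul_smul, smul_sub]
  have hZ : ∀ k, Z (Units.val k) = ((k.1.det * k.1.det) * (k.1.det * k.1.det)) •
      ((pt k * pt k - 1) * (pt k * pt k - 1)) := fun k => by
    simp only [Z, hZ₁, Matrix.mul_smul, Matrix.smul_mul, smul_smul]
  have hZpoly : IsPolyMap K Z := by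
    have e0 : IsPolyMap K fun k : Matrix (Fin p ⊕ Fin q) (Fin p ⊕ Fin q) K => k :=
      fun i j => .linear (Matrix.entryLinearMap K K i j)
    have ed : IsPolyFun K fun k : Matrix (Fin p ⊕ Fin q) (Fin p ⊕ Fin q) K => k.det :=
      IsPolyFun.det (M := fun k => k) e0
    have e1 : IsPolyMap K Y := ((e0.mul (.const _)).mul isPolyMap_adjugate).mul (.const _)
    have e2 : IsPolyMap K Z₁ := (e1.mul e1).sub (.smul ed (.smul ed (.const _)))
    exact e2.mul e2
  -- Join `g` to `h`, whose point has `(y² - 1)²` of rank at least `2ν`. Outside the zeros of `f₁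
  -- f₂` the matrices on the line are invertible and this rank bound persists.
  obtain ⟨f₁, hf₁⟩ := (IsPolyFun.det (M := fun k : Matrix (Fin p ⊕ Fin q) (Fin p ⊕ Fin q) K => k)
    (fun i j => .linear (Matrix.entryLinearMap K K i j))).exists_line g.1 (h.1 - g.1)
  have hdet : ∀ k : (Matrix (Fin p ⊕ Fin q) (Fin p ⊕ Fin q) K)ˣ, k.1.det ≠ 0 := fun k =>
    ((Matrix.isUnit_iff_isUnit_det _).mp k.isUnit).ne_zero
  obtain ⟨u, hu⟩ := exists_linearIndependent_mulVec ((pt h * pt h - 1) * (pt h * pt h - 1))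
  obtain ⟨f₂, hf₂0, hf₂⟩ := exists_forall_linearIndependent (K := K) (w₀ := g.1) (w₁ := h.1 - g.1)
    (v := fun k i => (Z k).mulVec (u i)) (fun l i => hZpoly.linear_mulVec l (u i)) 1 (by
      have h1 : (fun i => (Z (g.1 + (1 : K) • (h.1 - g.1))).mulVec (u i)) = fun i =>
          Units.mk0 _ (mul_ne_zero (mul_ne_zero (hdet h) (hdet h)) (mul_ne_zero (hdet h) (hdet h))) •
            (((pt h * pt h - 1) * (pt h * pt h - 1)).mulVec (u i)) := by
        ext i : 1
        rw [one_smul, add_sub_cancel, hZ, Matrix.smul_mulVec]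
        rfl
      rw [h1]
      exact hu.units_smul fun _ => _)
  have hf : f₁ * f₂ ≠ 0 := mul_ne_zero
    (by
      rintro rfl
      have := hf₁ 1
      rw [one_smul, add_sub_cancel, eval_zero] at this
      exact hdet h this.symm)
    (by rintro rfl; simp at hf₂0)
  obtain ⟨k, hk⟩ : ∃ k : ℕ, (k : ℤ) = (nu p q p' : ℤ) + (((p' : ℤ) - q) ^ 2 + ((p' : ℤ) - p) ^ 2) :=
    ⟨_, Int.toNat_of_nonneg (by positivity)⟩
  rw [← hk, stabRank_eq_finrank_ker]
  refine Nat.cast_le.mpr (le_finrank_ker_of_line _ (stabMap p' (h.1 - g.1)) hf fun s hs => ?_)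
  rw [eval_mul] at hs
  have hs1 := left_ne_zero_of_mul hs
  rw [hf₁] at hs1
  obtain ⟨c, hc⟩ : IsUnit (g.1 + s • (h.1 - g.1)) := by
    rw [Matrix.isUnit_iff_isUnit_det]
    exact isUnit_iff_ne_zero.mpr hs1
  have hL : stabMap p' g.1 + s • stabMap p' (h.1 - g.1) = stabMap p' c.1 := by
    refine LinearMap.ext fun z => ?_
    rw [LinearMap.add_apply, LinearMap.smul_apply, stabMap_apply, stabMap_apply, stabMap_apply, hc,
      mul_add, add_mul, Matrix.mul_smul, Matrix.smul_mul, smul_sub]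
    abel
  have h3 := card_le_rank (hf₂ s (right_ne_zero_of_mul hs))
  rw [Fintype.card_fin, ← hc, hZ, Matrix.rank_smul_of_mem_nonZeroDivisors _ (by
    rw [mem_nonZeroDivisors_iff_ne_zero]
    exact mul_ne_zero (mul_ne_zero (hdet c) (hdet c)) (mul_ne_zero (hdet c) (hdet c)))] at h3
  have hcS : pt c ∈ symComponent K p q p' := ⟨c, rfl⟩
  -- The rank of `x² - 1` never exceeds `2ν` on `S_{p'}`, so here it equals that of its square and
  -- the case of a normal form applies.
  have h4 := le_stabRank_of_normalForm hp' hcS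
    (exists_eq_mul_of_rank_le ((rank_mul_self_sub_one_le hp' hcS).trans (hrk.trans h3)))
  rw [stabRank_eq_finrank_ker, ← hk] at h4
  rw [hL]
  exact_mod_cast h4

end LowerBoundAll

/-! ### Multiplicities of ±1 in the upper left block -/

section Multiplicity

variable {K : Type*} [Field K] {p q p' : ℕ}

/-- The left side is the dimension of the kernel of `(M - c)^k`, a subspace of the generalized
eigenspace. -/
theorem le_rootMultiplicity_charpoly {n : Type*} [Fintype n] [DecidableEq n] (M : Matrix n n K)
    (c : K) (k : ℕ) : Fintype.card n - ((M - Matrix.scalar n c) ^ k).rank ≤ M.charpoly.rootMultiplicity c := by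
  have h1 := LinearMap.finrank_genEigenspace_le (Matrix.toLin' M) c k
  rw [Matrix.charpoly_toLin'] at h1
  refine le_trans ?_ h1
  have h2 : (Module.End.genEigenspace (Matrix.toLin' M) c) k =
      LinearMap.ker ((M - Matrix.scalar n c) ^ k).mulVecLin := by
    rw [Module.End.genEigenspace_nat]
    congr 1
    rw [← Matrix.toLin'_apply', Matrix.toLin'_pow, map_sub]
    congr 2
    ext
    simp [Pi.single_apply]
  rw [h2]
  have := LinearMap.finrank_range_add_finrank_ker ((M - Matrix.scalar n c) ^ k).mulVecLin
  rw [Module.finrank_fintype_fun_eq_card] at this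
  change _ - Module.finrank K (LinearMap.range _) ≤ _
  omega

/-- The bounds `p'` and `q'` on the ranks of `a + 1` and `a - 1` leave eigenspaces of dimension at
least `p - p'` for `-1` and `p - q' = p' - q` for `1`. -/
theorem denominator_dvd_charpoly [NeZero (2 : K)] (hp' : p' ≤ p + q)
    {x : Matrix (Fin p ⊕ Fin q) (Fin p ⊕ Fin q) K} (hx : x ∈ symComponent K p q p') :
    (X - 1) ^ (p' - q) * (X + 1) ^ (p - p') ∣ x.toBlocks₁₁.charpoly := by
  obtain ⟨-, -, h1, h2⟩ := rank_toBlocks_le hp' hx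
  have e1 : (X - 1 : K[X]) = X - C 1 := by simp
  have e2 : (X + 1 : K[X]) = X - C (-1) := by simp
  have n1 : (1 : K) ≠ -1 := fun h => two_ne_zero (α := K) (by
    rw [← one_add_one_eq_two]; nth_rw 2 [h]; simp)
  have m1 := le_rootMultiplicity_charpoly x.toBlocks₁₁ 1 1
  have m2 := le_rootMultiplicity_charpoly x.toBlocks₁₁ (-1) 1
  rw [map_one, pow_one, Fintype.card_fin] at m1
  rw [map_neg, map_one, sub_neg_eq_add, pow_one, Fintype.card_fin] at m2
  have hne : x.toBlocks₁₁.charpoly ≠ 0 := (Matrix.charpoly_monic _).ne_zero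
  rw [e1, e2]
  refine IsCoprime.mul_dvd (IsCoprime.pow (isCoprime_X_sub_C_of_isUnit_sub ?_)) ?_ ?_
  · exact (sub_ne_zero.mpr n1).isUnit
  · exact (pow_dvd_pow _ (by omega)).trans (pow_rootMultiplicity_dvd _ _)
  · exact (pow_dvd_pow _ (by omega)).trans (pow_rootMultiplicity_dvd _ _)

end Multiplicity

/-! ### Minimal multiplicities force a normal form -/

section SeparableCriterion

variable {K : Type*} [Field K] {p q p' : ℕ}

/-- Sylvester's rank inequality. -/
theorem rank_add_rank_le {n : Type*} [Fintype n] [DecidableEq n] (A B : Matrix n n K) :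
    A.rank + B.rank ≤ (A * B).rank + Fintype.card n := by
  let f := A.mulVecLin.domRestrict (LinearMap.range B.mulVecLin)
  have h1 := LinearMap.finrank_range_add_finrank_ker f
  have h2 : LinearMap.range f = LinearMap.range (A * B).mulVecLin := by
    rw [LinearMap.range_domRestrict, Matrix.mulVecLin_mul, LinearMap.range_comp]
  have h3 : Module.finrank K (LinearMap.ker f) ≤ Module.finrank K (LinearMap.ker A.mulVecLin) := by
    refine LinearMap.finrank_le_finrank_of_injective (f := ((Submodule.subtype _).comp
      (Submodule.subtype (LinearMap.ker f))).codRestrict _ fun z => z.2) ?_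
    intro z z' h
    have h5 := congrArg (Submodule.subtype (LinearMap.ker A.mulVecLin)) h
    exact Subtype.ext (Subtype.ext h5)
  have h4 := LinearMap.finrank_range_add_finrank_ker A.mulVecLin
  rw [Module.finrank_fintype_fun_eq_card] at h4
  rw [h2] at h1
  change A.rank + _ = _ at h4
  change (A * B).rank + _ = B.rank at h1
  omega

theorem nu_eq (p q p' : ℕ) (hp' : p' ≤ p + q) : nu p q p' + ((p' - q) + (p - p')) = p := by
  unfold nu
  omega

/-- If the roots `±1` of the characteristic polynomial of the upper left block have the smallest
possible multiplicities, the image of `x² - 1` meets its kernel trivially. -/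
theorem exists_mul_self_sub_one_eq (h2 : (2 : K) ≠ 0) (hp' : p' ≤ p + q)
    {x : Matrix (Fin p ⊕ Fin q) (Fin p ⊕ Fin q) K} (hx : x ∈ symComponent K p q p') {P : K[X]}
    (hP : P.eval 1 ≠ 0 ∧ P.eval (-1) ≠ 0)
    (h : x.toBlocks₁₁.charpoly = P * ((X - 1) ^ (p' - q) * (X + 1) ^ (p - p'))) :
    ∃ w, x * x - 1 = (x * x - 1) * (x * x - 1) * w := by
  have hS := symComponent_subset_symSpace p' hx
  obtain ⟨hzN, hNx⟩ := mul_self_sub_one_eq hS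
  obtain ⟨hrb, hrc, -, -⟩ := rank_toBlocks_le hp' hx
  obtain ⟨a, b, c, e, rfl⟩ : ∃ a b c e, x = Matrix.fromBlocks a b c e :=
    ⟨_, _, _, _, (Matrix.fromBlocks_toBlocks x).symm⟩
  obtain ⟨haa, -, -, -⟩ := fromBlocks_mem_symSpace.mp hS
  simp only [Matrix.toBlocks_fromBlocks₁₁, Matrix.toBlocks_fromBlocks₁₂,
    Matrix.toBlocks_fromBlocks₂₁] at h hrb hrc hzN hNx
  -- The multiplicities bound the kernels of `(a - 1)²` and `(a + 1)²`. By Sylvester `(bc)² = (a -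
  -- 1)²(a + 1)²` has rank at least `ν`, the largest possible rank of `b` and `c`; hence `b = bc w₁`
  -- and `c = cb w₂`.
  have m1 := le_rootMultiplicity_charpoly a 1 2
  have m2 := le_rootMultiplicity_charpoly a (-1) 2
  rw [map_one, h, (rootMultiplicity_mul_pow h2 _ _ hP).1, Fintype.card_fin] at m1
  rw [map_neg, map_one, h, (rootMultiplicity_mul_pow h2 _ _ hP).2, Fintype.card_fin] at m2
  have hS2 := rank_add_rank_le ((a - 1) ^ 2) ((a - -1) ^ 2)
  have hbc : (a - 1) ^ 2 * (a - -1) ^ 2 = b * c * (b * c) := by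
    rw [← sub_eq_of_eq_add' (eq_add_of_sub_eq haa)]
    noncomm_ring
  rw [hbc, Fintype.card_fin] at hS2
  have hnu := nu_eq p q p' hp'
  have hr : nu p q p' ≤ (b * c * (b * c)).rank := by omega
  obtain ⟨w₁, hw₁⟩ := exists_eq_mul_of_rank_le (b := b) (c := c)
    (hrb.trans (hr.trans (Matrix.rank_mul_le_left _ _)))
  obtain ⟨w₂, hw₂⟩ := exists_eq_mul_of_rank_le (b := c) (c := b) (hrc.trans (hr.trans (by
    rw [Matrix.mul_assoc, ← Matrix.mul_assoc c]
    exact (Matrix.rank_mul_le_right _ _).trans (Matrix.rank_mul_le_left _ _))))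
  set x := Matrix.fromBlocks a b c e
  obtain ⟨N, hN⟩ : ∃ N : Matrix (Fin p ⊕ Fin q) (Fin p ⊕ Fin q) K, N = Matrix.fromBlocks 0 b c 0 :=
    ⟨_, rfl⟩
  rw [← hN] at hzN hNx
  have hN2 : N = N * N * Matrix.fromBlocks 0 w₁ w₂ 0 := by
    rw [hN, Matrix.fromBlocks_multiply, Matrix.fromBlocks_multiply]
    simp only [Matrix.zero_mul, Matrix.mul_zero, add_zero, zero_add]
    rw [← hw₁, ← hw₂]
  have hxx : x * (thetaMat K p q p * x * thetaMat K p q p) = 1 := by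
    have h1 : x * thetaMat K p q p * (x * thetaMat K p q p) = 1 := by rw [← sq]; exact hS
    simpa only [mul_assoc] using h1
  set x' := thetaMat K p q p * x * thetaMat K p q p
  set W := Matrix.fromBlocks 0 w₁ w₂ 0
  -- Here `x² - 1 = 2Nx`, `N = N² W` and `x' = x⁻¹` commute past `N` as needed: `(2Nx)² · (x⁻² W
  -- x)/2 = 2N² W x = 2Nx`.
  refine ⟨(2 : K)⁻¹ • (x' * (x' * W) * x), ?_⟩
  have h3 : N * x * (N * x) * (x' * (x' * W) * x) = N * x := by
    calc _ = N * (x * N) * (x * x' * x' * W) * x := by simp only [mul_assoc]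
      _ = N * (N * x) * (1 * x' * W) * x := by rw [hxx, hNx]
      _ = N * N * (x * x' * W) * x := by simp only [mul_assoc, one_mul]
      _ = N * x := by rw [hxx, one_mul, ← hN2]
  rw [hzN, ← two_smul K x, Matrix.mul_smul, Matrix.mul_smul, Matrix.smul_mul, Matrix.smul_mul,
    Matrix.mul_smul, Matrix.smul_mul, h3, inv_smul_smul₀ h2]

end SeparableCriterion

/-! ### Transport along multiplicative maps -/

section Transport

theorem mem_conjOrbit_map {A B : Type*} [Monoid A] [Monoid B] (f : A →* B) {H : Subgroup Aˣ}
    {H' : Subgroup Bˣ} (hH : ∀ g ∈ H, Units.map f g ∈ H') {x y : A} (h : y ∈ conjOrbit H x) :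
    f y ∈ conjOrbit H' (f x) := by
  obtain ⟨g, hg, rfl⟩ := h
  exact ⟨_, hH g hg, by rw [map_mul, map_mul, ← map_inv, Units.coe_map, Units.coe_map]⟩

variable {R R' : Type*} [Ring R] [Ring R'] {p q a b : ℕ}
  (f : Matrix (Fin p ⊕ Fin q) (Fin p ⊕ Fin q) R →* Matrix (Fin a ⊕ Fin b) (Fin a ⊕ Fin b) R')

theorem units_map_mem_fixedGroup (hf : f (thetaMat R p q p) = thetaMat R' a b a)
    {g : (Matrix (Fin p ⊕ Fin q) (Fin p ⊕ Fin q) R)ˣ} (hg : g ∈ fixedGroup R p q) :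
    Units.map f g ∈ fixedGroup R' a b := by
  rw [mem_fixedGroup_iff] at hg ⊢
  rw [Units.coe_map, ← hf]
  simpa only [map_mul] using congrArg f hg

theorem mem_symSpace_map (hf : f (thetaMat R p q p) = thetaMat R' a b a)
    {x : Matrix (Fin p ⊕ Fin q) (Fin p ⊕ Fin q) R} (hx : x ∈ symSpace R p q) :
    f x ∈ symSpace R' a b := by
  have : (x * thetaMat R p q p) ^ 2 = 1 := hx
  change (f x * thetaMat R' a b a) ^ 2 = 1
  rw [← hf, ← map_mul, ← map_pow, this, map_one]

theorem mem_symComponent_map (hf : f (thetaMat R p q p) = thetaMat R' a b a) {p' a' : ℕ}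
    (hf' : f (thetaMat R p q p') = thetaMat R' a b a')
    {x : Matrix (Fin p ⊕ Fin q) (Fin p ⊕ Fin q) R} (hx : x ∈ symComponent R p q p') :
    f x ∈ symComponent R' a b a' := by
  obtain ⟨g, rfl⟩ := hx
  exact ⟨Units.map f g, by
    rw [map_mul, map_mul, map_mul, hf, hf', ← map_inv, Units.coe_map, Units.coe_map]⟩

theorem mem_conjOrbit_fixedGroup_map (hf : f (thetaMat R p q p) = thetaMat R' a b a)
    {x y : Matrix (Fin p ⊕ Fin q) (Fin p ⊕ Fin q) R} (h : y ∈ conjOrbit (fixedGroup R p q) x) :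
    f y ∈ conjOrbit (fixedGroup R' a b) (f x) :=
  mem_conjOrbit_map f (fun _ => units_map_mem_fixedGroup f hf) h

end Transport

/-! ### Change of the coefficient ring -/

section BaseChange

theorem thetaMat_eq_fromBlocks (S : Type*) [Ring S] (p q p' : ℕ) : thetaMat S p q p' =
    Matrix.fromBlocks (Matrix.diagonal fun i : Fin p => if (i : ℕ) < p' then 1 else -1) 0 0
      (Matrix.diagonal fun i : Fin q => if (i : ℕ) + p < p' then 1 else -1) := by
  rw [Matrix.fromBlocks_diagonal, thetaMat]
  congr 1
  ext (i | i)
  · by_cases h : (i : ℕ) < p' <;> simp [h]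
  · by_cases h : p + (i : ℕ) < p' <;> simp [h, add_comm (i : ℕ)]

variable {R R' : Type*} [Ring R] [Ring R'] (f : R →+* R')

theorem map_thetaMat (p q p' : ℕ) : (thetaMat R p q p').map f = thetaMat R' p q p' := by
  rw [thetaMat, Matrix.diagonal_map (map_zero f), thetaMat]
  congr 1
  ext i
  simp [apply_ite f]

theorem map_corner {m : ℕ} (a b : ℕ) (A : Matrix (Fin m) (Fin m) R) :
    (corner a b A).map f = corner a b (A.map f) := by
  ext i j
  simp only [corner, Matrix.map_apply, Matrix.of_apply]
  split_ifs <;> simp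

theorem map_diagBlock {m : ℕ} (a r : ℕ) (A : Matrix (Fin m) (Fin m) R) :
    (diagBlock a r A).map f = diagBlock a r (A.map f) := by
  rw [diagBlock, diagBlock, Matrix.map_add f (map_add f), map_corner,
    Matrix.diagonal_map (map_zero f)]
  congr 2
  ext i
  simp [apply_ite f]

theorem map_xMat (p q : ℕ) {m : ℕ} (A : Matrix (Fin m) (Fin m) R) (r t : ℕ) :
    (xMat p q A r t).map f = xMat p q (A.map f) r t := by
  rw [xMat, xMat, Matrix.fromBlocks_map, map_diagBlock, map_diagBlock, map_corner, map_corner,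
    Matrix.map_sub f (map_sub f), Matrix.map_add f (map_add f),
    Matrix.map_one f (map_zero f) (map_one f)]

end BaseChange

/-! ### Passing from M_d(K)-coefficients to K-coefficients -/

section SplitBlocks

variable {K R : Type*} [Field K] [Ring R] [Algebra K R] {d : ℕ}
  (ψ : R ≃ₐ[K] Matrix (Fin d) (Fin d) K)

/-- A matrix over an algebra isomorphic to `M_d(K)`, viewed as a matrix over `K`. -/
def splitRect {a b : ℕ} (M : Matrix (Fin a) (Fin b) R) : Matrix (Fin (a * d)) (Fin (b * d)) K :=
  Matrix.of fun i j => ψ (M i.divNat j.divNat) i.modNat j.modNat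

/-- The isomorphism between `M_m(R)` and `M_{md}(K)`, where `R` is isomorphic to `M_d(K)`. -/
noncomputable def splitFin (m : ℕ) :
    Matrix (Fin m) (Fin m) R ≃ₐ[K] Matrix (Fin (m * d)) (Fin (m * d)) K :=
  (splitEquiv ψ (Fin m)).trans (Matrix.reindexAlgEquiv K K finProdFinEquiv)

theorem splitFin_apply {m : ℕ} (A : Matrix (Fin m) (Fin m) R) : splitFin ψ m A = splitRect ψ A := rfl

/-- The same identification for matrices divided into blocks. -/
noncomputable def splitSum (p q : ℕ) : Matrix (Fin p ⊕ Fin q) (Fin p ⊕ Fin q) R ≃ₐ[K]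
    Matrix (Fin (p * d) ⊕ Fin (q * d)) (Fin (p * d) ⊕ Fin (q * d)) K :=
  (splitEquiv ψ (Fin p ⊕ Fin q)).trans (Matrix.reindexAlgEquiv K K
    ((Equiv.sumProdDistrib _ _ _).trans (Equiv.sumCongr finProdFinEquiv finProdFinEquiv)))

theorem splitSum_fromBlocks {p q : ℕ} (a : Matrix (Fin p) (Fin p) R) (b : Matrix (Fin p) (Fin q) R)
    (c : Matrix (Fin q) (Fin p) R) (e : Matrix (Fin q) (Fin q) R) :
    splitSum ψ p q (Matrix.fromBlocks a b c e) =
      Matrix.fromBlocks (splitRect ψ a) (splitRect ψ b) (splitRect ψ c) (splitRect ψ e) := by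
  ext (i | i) (j | j) <;> rfl

theorem div_add_lt_iff {a i r : ℕ} (hd : 0 < d) : i / d + r < a ↔ i + r * d < a * d := by
  rw [← Nat.add_mul_div_right _ _ hd, Nat.div_lt_iff_lt_mul hd]

theorem splitRect_corner {m : ℕ} (a b : ℕ) (A : Matrix (Fin m) (Fin m) R) :
    splitRect ψ (corner a b A) = corner (a * d) (b * d) (splitRect ψ A) := by
  ext i j
  have hd : 0 < d := Nat.pos_of_ne_zero fun h => by subst h; exact i.elim0
  by_cases h : (i : ℕ) / d < m ∧ (j : ℕ) / d < m
  · have h' := h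
    rw [Nat.div_lt_iff_lt_mul hd, Nat.div_lt_iff_lt_mul hd] at h'
    have e1 : corner a b A i.divNat j.divNat = A ⟨_, h.1⟩ ⟨_, h.2⟩ := dif_pos h
    have e2 : corner (a * d) (b * d) (splitRect ψ A) i j = splitRect ψ A ⟨_, h'.1⟩ ⟨_, h'.2⟩ :=
      dif_pos h'
    rw [e2]
    change ψ (corner a b A i.divNat j.divNat) _ _ = _
    rw [e1]
    rfl
  · have h' := h
    rw [Nat.div_lt_iff_lt_mul hd, Nat.div_lt_iff_lt_mul hd] at h'
    have e1 : corner a b A i.divNat j.divNat = 0 := dif_neg h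
    have e2 : corner (a * d) (b * d) (splitRect ψ A) i j = 0 := dif_neg h'
    rw [e2]
    change ψ (corner a b A i.divNat j.divNat) _ _ = _
    rw [e1, map_zero, Matrix.zero_apply]

theorem splitRect_diagonal {a : ℕ} (g : Fin a → K) :
    splitRect ψ (Matrix.diagonal fun i => algebraMap K R (g i)) =
      Matrix.diagonal fun i => g i.divNat := by
  ext i j
  simp only [splitRect, Matrix.of_apply, Matrix.diagonal_apply]
  have hij : i = j ↔ i.divNat = j.divNat ∧ i.modNat = j.modNat := by
    rw [← finProdFinEquiv.symm.injective.eq_iff, Prod.ext_iff]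
    rfl
  by_cases h : i.divNat = j.divNat
  · simp [h, hij, Matrix.algebraMap_matrix_apply]
  · simp [h, hij]

theorem splitRect_diagBlock {m : ℕ} (a r : ℕ) (A : Matrix (Fin m) (Fin m) R) :
    splitRect ψ (diagBlock a r A) = diagBlock (a * d) (r * d) (splitRect ψ A) := by
  have h1 : (Matrix.diagonal fun i : Fin a =>
      if (i : ℕ) < m then (0 : R) else if (i : ℕ) + r < a then 1 else -1) =
      Matrix.diagonal fun i : Fin a => algebraMap K R
        (if (i : ℕ) < m then 0 else if (i : ℕ) + r < a then 1 else -1) := by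
    congr 1
    ext i
    simp [apply_ite (algebraMap K R)]
  rw [diagBlock, diagBlock, h1, ← splitFin_apply, map_add, splitFin_apply, splitFin_apply,
    splitRect_corner, splitRect_diagonal]
  congr 2
  ext i
  have hd : 0 < d := Nat.pos_of_ne_zero fun h => by subst h; exact i.elim0
  simp only [Fin.coe_divNat, Nat.div_lt_iff_lt_mul hd, div_add_lt_iff hd]

/-- Rows are grouped by `i ↦ i / d`, and `i / d < p'` means `i < p' d`: splitting multiplies the
parameters by `d`. -/
theorem splitSum_thetaMat (p q p' : ℕ) :
    splitSum ψ p q (thetaMat R p q p') = thetaMat K (p * d) (q * d) (p' * d) := by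
  have h2 : ∀ (n : ℕ) (P : Fin n → Prop) [DecidablePred P],
      (Matrix.diagonal fun i : Fin n => if P i then (1 : R) else -1) =
        Matrix.diagonal fun i : Fin n => algebraMap K R (if P i then 1 else -1) := fun n P _ => by
    congr 1
    ext i
    simp [apply_ite (algebraMap K R)]
  have h3 : ∀ a b : ℕ, splitRect ψ (0 : Matrix (Fin a) (Fin b) R) = 0 := fun a b => by
    ext i j
    simp [splitRect]
  rw [thetaMat_eq_fromBlocks, thetaMat_eq_fromBlocks, splitSum_fromBlocks, h2, h2, splitRect_diagonal, splitRect_diagonal, h3, h3]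
  congr 2
  all_goals
    ext i
    have hd : 0 < d := Nat.pos_of_ne_zero fun h => by subst h; exact i.elim0
    simp only [Fin.coe_divNat, Nat.div_lt_iff_lt_mul hd, div_add_lt_iff hd]

theorem splitSum_xMat (p q : ℕ) {m : ℕ} (A : Matrix (Fin m) (Fin m) R) (r t : ℕ) :
    splitSum ψ p q (xMat p q A r t) =
      xMat (p * d) (q * d) (splitFin ψ m A) (r * d) (t * d) := by
  rw [xMat, splitSum_fromBlocks, splitRect_diagBlock, splitRect_diagBlock, splitRect_corner,
    splitRect_corner, ← splitFin_apply, ← splitFin_apply, ← splitFin_apply, map_sub, map_add, map_one]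
  rfl

theorem nu_mul (p q p' d : ℕ) : nu (p * d) (q * d) (p' * d) = nu p q p' * d := by
  simp only [nu, ← add_mul, ← Nat.sub_mul, Nat.mul_min_mul_right]

theorem mem_symSpace_splitSum {p q : ℕ} {x : Matrix (Fin p ⊕ Fin q) (Fin p ⊕ Fin q) R} :
    splitSum ψ p q x ∈ symSpace K (p * d) (q * d) ↔ x ∈ symSpace R p q := by
  have h := splitSum_thetaMat ψ p q p
  refine ⟨fun hx => ?_, fun hx => mem_symSpace_map (MonoidHomClass.toMonoidHom (splitSum ψ p q)) h hx⟩
  have := mem_symSpace_map (MonoidHomClass.toMonoidHom (splitSum ψ p q).symm) ((AlgEquiv.symm_apply_eq _).mpr h.symm) hx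
  simpa using this

theorem mem_symComponent_splitSum {p q p' : ℕ} {x : Matrix (Fin p ⊕ Fin q) (Fin p ⊕ Fin q) R} :
    splitSum ψ p q x ∈ symComponent K (p * d) (q * d) (p' * d) ↔ x ∈ symComponent R p q p' := by
  have h := splitSum_thetaMat ψ p q
  refine ⟨fun hx => ?_, fun hx => mem_symComponent_map (MonoidHomClass.toMonoidHom (splitSum ψ p q)) (h p) (h p') hx⟩
  have := mem_symComponent_map (MonoidHomClass.toMonoidHom (splitSum ψ p q).symm)
    ((AlgEquiv.symm_apply_eq _).mpr (h p).symm) ((AlgEquiv.symm_apply_eq _).mpr (h p').symm) hx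
  simpa using this

theorem mem_conjOrbit_splitSum {p q : ℕ} {x y : Matrix (Fin p ⊕ Fin q) (Fin p ⊕ Fin q) R} :
    splitSum ψ p q y ∈ conjOrbit (fixedGroup K (p * d) (q * d)) (splitSum ψ p q x) ↔
      y ∈ conjOrbit (fixedGroup R p q) x := by
  have h := splitSum_thetaMat ψ p q p
  refine ⟨fun hx => ?_, fun hx => mem_conjOrbit_fixedGroup_map (MonoidHomClass.toMonoidHom (splitSum ψ p q)) h hx⟩
  have := mem_conjOrbit_fixedGroup_map (MonoidHomClass.toMonoidHom (splitSum ψ p q).symm)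
    ((AlgEquiv.symm_apply_eq _).mpr h.symm) hx
  simpa using this

theorem hasClosedOrbit_splitSum_iff {p q : ℕ} {x : Matrix (Fin p ⊕ Fin q) (Fin p ⊕ Fin q) R}
    {X : Set (Matrix (Fin p ⊕ Fin q) (Fin p ⊕ Fin q) R)} {X' : Set (Matrix _ _ K)}
    (hX : ∀ y, splitSum ψ p q y ∈ X' ↔ y ∈ X) :
    HasClosedOrbit K (fixedGroup R p q) X x ↔
      HasClosedOrbit K (fixedGroup K (p * d) (q * d)) X' (splitSum ψ p q x) := by
  constructor
  · intro h
    refine HasClosedOrbit.of_algEquiv (splitSum ψ p q).symm (H' := fixedGroup R p q) (X' := X)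
      (fun y hy => ?_) (fun y => ?_) (by simpa using h)
    · rw [← hX]
      simpa using hy
    · rw [← mem_conjOrbit_splitSum ψ]
      simp
  · exact HasClosedOrbit.of_algEquiv (splitSum ψ p q) (fun y hy => (hX y).mpr hy)
      fun y => mem_conjOrbit_splitSum ψ

/-- `G^θ` consists of the units of the centralizer algebra of `θ`, so the Krull dimension is a
linear dimension. -/
theorem stabilizerDim_fixedGroup [Infinite K] {p q : ℕ} (x : Matrix (Fin p ⊕ Fin q) (Fin p ⊕ Fin q) R) :
    stabilizerDim K (fixedGroup R p q) x = stabRank (splitSum ψ p q x) := by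
  have : FiniteDimensional K (Matrix (Fin p ⊕ Fin q) (Fin p ⊕ Fin q) R) :=
    (splitSum ψ p q).symm.toLinearEquiv.finiteDimensional
  have hT : ∀ g : (Matrix (Fin p ⊕ Fin q) (Fin p ⊕ Fin q) R)ˣ, g ∈ fixedGroup R p q ↔
      g.1 ∈ Subalgebra.centralizer K {thetaMat R p q p} := fun g => by
    rw [mem_fixedGroup_iff, Subalgebra.mem_centralizer_iff]
    simp [eq_comm]
  rw [stabilizerDim_eq _ _ hT]
  rw [stabRank]
  congr 1
  refine finrank_subalgebra_eq_of_algEquiv (splitSum ψ p q) fun a => ?_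
  rw [← splitSum_thetaMat ψ]
  simp only [Algebra.mem_inf, Subalgebra.mem_centralizer_iff, Set.mem_singleton_iff, forall_eq,
    ← map_mul, (splitSum ψ p q).injective.eq_iff]

theorem stabilizerDim_top [Infinite K] {m : ℕ} (A : Matrix (Fin m) (Fin m) R) :
    stabilizerDim K ⊤ A =
      (Module.finrank K (Subalgebra.centralizer K {splitFin ψ m A}) : WithBot ℕ∞) := by
  have : FiniteDimensional K (Matrix (Fin m) (Fin m) R) :=
    (splitFin ψ m).symm.toLinearEquiv.finiteDimensional
  rw [stabilizerDim_eq ⊤ (⊤ : Subalgebra K (Matrix (Fin m) (Fin m) R)) (fun g => by simp),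
    top_inf_eq]
  congr 1
  refine finrank_subalgebra_eq_of_algEquiv (splitFin ψ m) fun a => ?_
  simp only [Subalgebra.mem_centralizer_iff, Set.mem_singleton_iff, forall_eq, ← map_mul,
    (splitFin ψ m).injective.eq_iff]

end SplitBlocks

/-! ### Eigenvalues ±1 and separability of the minimal polynomial -/

section Spectrum

theorem isUnit_iff_forall_mulVec (F : Type*) [Field F] {D : Type*} [Ring D] [Algebra F D]
    [FiniteDimensional F D] {n : Type*} [Fintype n] [DecidableEq n] (M : Matrix n n D) :
    IsUnit M ↔ ∀ v, M.mulVec v = 0 → v = 0 := by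
  constructor
  · rintro ⟨u, rfl⟩ v hv
    rw [← Matrix.one_mulVec v, ← u.inv_mul, ← Matrix.mulVec_mulVec, hv, Matrix.mulVec_zero]
  · intro h
    have h0 : ∀ N : Matrix n n D, M * N = 0 → N = 0 := fun N hN => by
      ext i j
      have := h (N.col j) (by
        ext k
        exact congrFun (congrFun hN k) j)
      exact congrFun this i
    have hinj : Function.Injective (LinearMap.mulLeft F M) := by
      rw [← LinearMap.ker_eq_bot, LinearMap.ker_eq_bot']
      exact h0
    obtain ⟨N, hN⟩ := LinearMap.surjective_of_injective hinj 1
    have hN' : M * N = 1 := hN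
    refine ⟨⟨M, N, hN', sub_eq_zero.mp (h0 _ ?_)⟩, rfl⟩
    rw [mul_sub, ← mul_assoc, hN', one_mul, mul_one, sub_self]

theorem noEigenvalueOne_iff (F : Type*) [Field F] {D : Type*} [Ring D] [Algebra F D]
    [FiniteDimensional F D] {m : ℕ} (A : Matrix (Fin m) (Fin m) D) :
    NoEigenvalueOne A ↔ IsUnit (A * A - 1) := by
  rw [isUnit_mul_self_sub_one_iff, isUnit_iff_forall_mulVec F, isUnit_iff_forall_mulVec F]
  simp only [NoEigenvalueOne, or_imp, forall_and, Matrix.sub_mulVec, Matrix.add_mulVec,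
    Matrix.one_mulVec, sub_eq_zero, add_eq_zero_iff_eq_neg]

/-- If `c` were a root, cancelling the invertible `A - c` would leave an annihilating polynomial of
smaller degree. -/
theorem eval_minpoly_ne_zero {F B : Type*} [Field F] [Ring B] [Algebra F B]
    [FiniteDimensional F B] {A : B} {c : F} (h : IsUnit (A - algebraMap F B c)) :
    (minpoly F A).eval c ≠ 0 := by
  intro h0
  obtain ⟨g, hg⟩ := dvd_iff_isRoot.mpr h0
  have h1 : aeval A (minpoly F A) = 0 := minpoly.aeval F A
  have hne : minpoly F A ≠ 0 := minpoly.ne_zero (Algebra.IsIntegral.isIntegral A)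
  rw [hg, map_mul, map_sub, aeval_X, aeval_C, h.mul_right_eq_zero] at h1
  have h2 := minpoly.degree_le_of_ne_zero F A (right_ne_zero_of_mul (hg ▸ hne)) h1
  have h3 : g ≠ 0 := right_ne_zero_of_mul (hg ▸ hne)
  rw [degree_eq_natDegree hne, degree_eq_natDegree h3, Nat.cast_le] at h2
  have h4 : (minpoly F A).natDegree = 1 + g.natDegree := by
    conv_lhs => rw [hg]
    rw [natDegree_mul (X_sub_C_ne_zero c) h3, natDegree_X_sub_C]
  omega

theorem isSemisimpleMat_of_aeval_eq_zero {F D : Type*} [Field F] [DivisionRing D] [Algebra F D]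
    {m : ℕ} {A : Matrix (Fin m) (Fin m) D} {f : F[X]} (hf : f.Separable) (hA : aeval A f = 0) :
    IsSemisimpleMat F A :=
  hf.of_dvd (minpoly.dvd F A hA)

/-- If the minimal polynomial is `g²l`, then `(gl)²` annihilates `A`, hence so does `gl`, and `g`
must be a unit. In characteristic zero squarefree means separable. -/
theorem isSemisimpleMat_of_forall {F D : Type*} [Field F] [CharZero F] [DivisionRing D] [Algebra F D]
    [FiniteDimensional F D] {m : ℕ} {A : Matrix (Fin m) (Fin m) D}
    (h : ∀ k : F[X], aeval A (k * k) = 0 → aeval A k = 0) : IsSemisimpleMat F A := by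
  have hne : minpoly F A ≠ 0 := minpoly.ne_zero (Algebra.IsIntegral.isIntegral A)
  refine PerfectField.separable_iff_squarefree.mpr fun g ⟨l, hl⟩ => ?_
  have h1 : aeval A (g * l) = 0 := h _ (by
    rw [show g * l * (g * l) = g * g * l * l by ring, ← hl, map_mul, minpoly.aeval, zero_mul])
  obtain ⟨u, hu⟩ := minpoly.dvd F A h1
  have hgl : g * l ≠ 0 := fun h0 => hne (by rw [hl, mul_assoc, h0, mul_zero])
  refine IsUnit.of_mul_eq_one u (mul_right_cancel₀ hgl ?_)
  rw [one_mul]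
  conv_rhs => rw [hu, hl]
  ring

end Spectrum

/-! ### Regular semisimple matrices and separable characteristic polynomials -/

section Regular

variable {K : Type*} [Field K] {m : ℕ}

theorem finrank_centralizer_of_separable_charpoly [IsAlgClosed K] {A : Matrix (Fin m) (Fin m) K}
    (h : A.charpoly.Separable) : Module.finrank K (Subalgebra.centralizer K {A}) = m := by
  obtain ⟨u, u', v, hu, hu', rfl⟩ := exists_diagonal_of_separable h (Matrix.aeval_self_charpoly A)
  rw [← conjEquiv_apply hu hu', finrank_centralizer_algEquiv]
  rw [charpoly_conj hu', Matrix.charpoly_diagonal, separable_prod_X_sub_C_iff] at h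
  exact finrank_centralizer_diagonal h

theorem separable_charpoly_of_finrank_centralizer_le [IsAlgClosed K] {A : Matrix (Fin m) (Fin m) K}
    {f : K[X]} (hf : f.Separable) (hA : aeval A f = 0)
    (h : Module.finrank K (Subalgebra.centralizer K {A}) ≤ m) : A.charpoly.Separable := by
  obtain ⟨u, u', v, hu, hu', rfl⟩ := exists_diagonal_of_separable hf hA
  rw [← conjEquiv_apply hu hu', finrank_centralizer_algEquiv] at h
  rw [charpoly_conj hu', Matrix.charpoly_diagonal, separable_prod_X_sub_C_iff]
  intro i j hij
  by_contra hne
  exact (lt_finrank_centralizer_diagonal hne hij).not_ge h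

end Regular

/-! ### A closed orbit makes A semisimple -/

section ClosedOrbitSemisimple

variable {K : Type*} [Field K] {p q m r t : ℕ}

theorem aeval_diagBlock_eq_zero {a : ℕ} (h : m + r ≤ a) {A : Matrix (Fin m) (Fin m) K} {k : K[X]}
    (hA : aeval A k = 0) : aeval (diagBlock a r A) (k * (X * X - 1)) = 0 := by
  rw [aeval_diagBlock (by omega), map_mul, hA, zero_mul, aeval_fromBlocks_diagonal]
  simp

/-- Take `g = k (X² - 1)`, whose second factor kills the `±1` blocks. Then `g²` annihilates both
diagonal blocks, closedness gives `g = 0` on them, and the invertible `A² - 1` cancels. -/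
theorem aeval_eq_zero_of_hasClosedOrbit [Infinite K] (h2 : (2 : K) ≠ 0) (hp : m + r ≤ p)
    (hq : m + t ≤ q) {A : Matrix (Fin m) (Fin m) K} (hA : IsUnit (A * A - 1))
    (hc : HasClosedOrbit K (fixedGroup K p q) (symSpace K p q) (xMat p q A r t)) {k : K[X]}
    (hk : aeval A (k * k) = 0) : aeval A k = 0 := by
  let g := k * (X * X - 1)
  -- Composition with `X/2` compensates the factor in `x + θ x θ = 2 diag(a, e)`.
  obtain ⟨w, hw⟩ := aeval_eq_mul_of_hasClosedOrbit h2 (xMat_mem_symSpace hp hq A) hc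
    (g.comp (C 2⁻¹ * X))
  have hτ : xMat p q A r t + thetaMat K p q p * xMat p q A r t * thetaMat K p q p =
      (2 : K) • Matrix.fromBlocks (diagBlock p r A) 0 0 (diagBlock q t A) := by
    rw [thetaMat_eq, xMat]
    simp [Matrix.fromBlocks_multiply, Matrix.fromBlocks_add, two_smul]
  have h3 : ∀ f : K[X], aeval (xMat p q A r t + thetaMat K p q p * xMat p q A r t * thetaMat K p q p)
      (f.comp (C 2⁻¹ * X)) =
        Matrix.fromBlocks (aeval (diagBlock p r A) f) 0 0 (aeval (diagBlock q t A) f) := fun f => by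
    rw [← aeval_fromBlocks_diagonal, aeval_comp, hτ]
    congr 2
    rw [map_mul, aeval_C, aeval_X, ← Algebra.smul_def, inv_smul_smul₀ h2]
  have h4 : ∀ {a s : ℕ}, m + s ≤ a → aeval (diagBlock a s A) g * aeval (diagBlock a s A) g = 0 :=
    fun has => by
      rw [← map_mul, show g * g = k * k * (X * X - 1) * (X * X - 1) by ring, map_mul,
        aeval_diagBlock_eq_zero has hk, zero_mul]
  rw [h3, Matrix.fromBlocks_multiply, h4 hp, h4 hq] at hw
  have h5 := congrArg Matrix.toBlocks₁₁ hw
  simp only [Matrix.toBlocks_fromBlocks₁₁, Matrix.mul_zero, Matrix.zero_mul, add_zero,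
    Matrix.fromBlocks_zero, zero_mul] at h5
  have h6 := corner_mul_aeval_diagBlock hp (b := p) (by omega) A 1 g
  rw [h5, show Matrix.toBlocks₁₁ (0 : Matrix (Fin p ⊕ Fin q) (Fin p ⊕ Fin q) K) = 0 from rfl,
    Matrix.mul_zero, one_mul, eq_comm, corner_eq_zero_iff (by omega) (by omega), map_mul] at h6
  have h7 : aeval A (X * X - 1 : K[X]) = A * A - 1 := by simp
  rwa [h7, hA.mul_left_eq_zero] at h6

end ClosedOrbitSemisimple

/-! ### Points over D as matrices over the algebraic closure -/

section GeometricPoints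

variable {F : Type*} [Field F] {D : Type*} [DivisionRing D] [Algebra F D] {d p q : ℕ}
  (ψ : (AlgebraicClosure F ⊗[F] D) ≃ₐ[AlgebraicClosure F] Matrix (Fin d) (Fin d) (AlgebraicClosure F))

/-- The geometric point defined by a matrix over `D`, as a matrix over the algebraic closure. -/
noncomputable def splitPoint (p q : ℕ) : Matrix (Fin p ⊕ Fin q) (Fin p ⊕ Fin q) D →ₐ[F]
    Matrix (Fin (p * d) ⊕ Fin (q * d)) (Fin (p * d) ⊕ Fin (q * d)) (AlgebraicClosure F) :=
  ((splitSum ψ p q).restrictScalars F).toAlgHom.comp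
    (Algebra.TensorProduct.includeRight : D →ₐ[F] AlgebraicClosure F ⊗[F] D).mapMatrix

/-- The same for a square matrix which is not divided into blocks. -/
noncomputable def splitMat (m : ℕ) : Matrix (Fin m) (Fin m) D →ₐ[F]
    Matrix (Fin (m * d)) (Fin (m * d)) (AlgebraicClosure F) :=
  ((splitFin ψ m).restrictScalars F).toAlgHom.comp
    (Algebra.TensorProduct.includeRight : D →ₐ[F] AlgebraicClosure F ⊗[F] D).mapMatrix

theorem splitPoint_apply (x : Matrix (Fin p ⊕ Fin q) (Fin p ⊕ Fin q) D) :
    splitPoint ψ p q x = splitSum ψ p q (geomPoint F x) := rfl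

theorem splitMat_apply {m : ℕ} (A : Matrix (Fin m) (Fin m) D) :
    splitMat ψ m A = splitFin ψ m (geomPoint F A) := rfl

theorem geomPoint_injective (n : Type*) :
    Function.Injective (geomPoint F : Matrix n n D → Matrix n n (AlgebraicClosure F ⊗[F] D)) :=
  Matrix.map_injective
    (Algebra.TensorProduct.includeRight_injective (algebraMap F (AlgebraicClosure F)).injective)

theorem splitPoint_injective : Function.Injective (splitPoint ψ p q) :=
  (splitSum ψ p q).injective.comp (geomPoint_injective _)

theorem splitMat_injective (m : ℕ) : Function.Injective (splitMat ψ m) :=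
  (splitFin ψ m).injective.comp (geomPoint_injective _)

theorem geomPoint_thetaMat (p q p' : ℕ) :
    geomPoint F (thetaMat D p q p') = thetaMat (AlgebraicClosure F ⊗[F] D) p q p' :=
  map_thetaMat (Algebra.TensorProduct.includeRight : D →ₐ[F] AlgebraicClosure F ⊗[F] D).toRingHom _ _ _

theorem splitPoint_thetaMat (p' : ℕ) : splitPoint ψ p q (thetaMat D p q p') =
    thetaMat (AlgebraicClosure F) (p * d) (q * d) (p' * d) := by
  rw [splitPoint_apply, geomPoint_thetaMat, splitSum_thetaMat]

theorem splitPoint_xMat {m : ℕ} (A : Matrix (Fin m) (Fin m) D) (r t : ℕ) :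
    splitPoint ψ p q (xMat p q A r t) =
      xMat (p * d) (q * d) (splitMat ψ m A) (r * d) (t * d) := by
  rw [splitPoint_apply, splitMat_apply, ← splitSum_xMat]
  congr 1
  exact map_xMat (Algebra.TensorProduct.includeRight : D →ₐ[F] AlgebraicClosure F ⊗[F] D).toRingHom
    _ _ _ _ _

theorem splitPoint_toBlocks₁₁ (x : Matrix (Fin p ⊕ Fin q) (Fin p ⊕ Fin q) D) :
    (splitPoint ψ p q x).toBlocks₁₁ = splitMat ψ p x.toBlocks₁₁ := rfl

variable {x y : Matrix (Fin p ⊕ Fin q) (Fin p ⊕ Fin q) D}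

theorem splitPoint_mem_symSpace (hx : x ∈ symSpace D p q) :
    splitPoint ψ p q x ∈ symSpace (AlgebraicClosure F) (p * d) (q * d) :=
  mem_symSpace_map (MonoidHomClass.toMonoidHom (splitPoint ψ p q)) (splitPoint_thetaMat ψ p) hx

theorem splitPoint_mem_symComponent {p' : ℕ} (hx : x ∈ symComponent D p q p') :
    splitPoint ψ p q x ∈ symComponent (AlgebraicClosure F) (p * d) (q * d) (p' * d) :=
  mem_symComponent_map (MonoidHomClass.toMonoidHom (splitPoint ψ p q)) (splitPoint_thetaMat ψ p)
    (splitPoint_thetaMat ψ p') hx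

theorem splitPoint_mem_conjOrbit (h : y ∈ conjOrbit (fixedGroup D p q) x) :
    splitPoint ψ p q y ∈
      conjOrbit (fixedGroup (AlgebraicClosure F) (p * d) (q * d)) (splitPoint ψ p q x) :=
  mem_conjOrbit_fixedGroup_map (MonoidHomClass.toMonoidHom (splitPoint ψ p q))
    (splitPoint_thetaMat ψ p) h

theorem map_reducedCharpoly_eq [CharZero F] {n : ℕ} (A : Matrix (Fin n) (Fin n) D) :
    (reducedCharpoly F d A).map (algebraMap F (AlgebraicClosure F)) = (splitMat ψ n A).charpoly := by
  rw [map_reducedCharpoly ψ, splitMat_apply]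
  exact (Matrix.charpoly_reindex finProdFinEquiv _).symm

theorem aeval_splitMat_map {m : ℕ} (A : Matrix (Fin m) (Fin m) D) (f : F[X]) :
    aeval (splitMat ψ m A) (f.map (algebraMap F (AlgebraicClosure F))) = splitMat ψ m (aeval A f) := by
  rw [aeval_map_algebraMap, aeval_algHom_apply]

theorem isUnit_splitMat {m : ℕ} {A : Matrix (Fin m) (Fin m) D} (hA : IsUnit (A * A - 1)) :
    IsUnit (splitMat ψ m A * splitMat ψ m A - 1) := by
  have := hA.map (splitMat ψ m)
  rwa [map_sub, map_mul, map_one] at this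

theorem isThetaSemisimple_iff : IsThetaSemisimple F x ↔
    HasClosedOrbit (AlgebraicClosure F) (fixedGroup (AlgebraicClosure F) (p * d) (q * d))
      (symSpace (AlgebraicClosure F) (p * d) (q * d)) (splitPoint ψ p q x) :=
  hasClosedOrbit_splitSum_iff ψ fun _ => mem_symSpace_splitSum ψ

theorem isThetaSemisimpleIn_iff [CharZero F] (ψ : (AlgebraicClosure F ⊗[F] D) ≃ₐ[AlgebraicClosure F]
    Matrix (Fin d) (Fin d) (AlgebraicClosure F)) {p' : ℕ} (hp' : p' ≤ p + q)
    (hx : x ∈ symComponent D p q p') : IsThetaSemisimpleIn F p' x ↔ IsThetaSemisimple F x := by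
  have : CharZero (AlgebraicClosure F) := charZero_of_injective_algebraMap (algebraMap F _).injective
  rw [isThetaSemisimple_iff ψ, ← hasClosedOrbit_symComponent_iff (p' := p' * d)
    (by rw [← add_mul]; exact Nat.mul_le_mul_right d hp') (splitPoint_mem_symComponent ψ hx)]
  exact hasClosedOrbit_splitSum_iff ψ fun _ => mem_symComponent_splitSum ψ

/-- The right side is the universal lower bound of `le_stabRank`, attained at the generic point. -/
theorem isThetaRegularIn_iff [CharZero F] {p' : ℕ} (hp' : p' ≤ p + q) :
    IsThetaRegularIn F p' x ↔ (stabRank (splitPoint ψ p q x) : ℤ) ≤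
      (nu p q p' * d : ℕ) + (((p' * d : ℕ) - (q * d : ℕ)) ^ 2 + ((p' * d : ℕ) - (p * d : ℕ)) ^ 2 : ℤ) := by
  have : CharZero (AlgebraicClosure F) := charZero_of_injective_algebraMap (algebraMap F _).injective
  have hp'd : p' * d ≤ p * d + q * d := by rw [← add_mul]; exact Nat.mul_le_mul_right d hp'
  rw [← nu_mul]
  constructor
  · intro h
    obtain ⟨y, hy, -, -, hyr⟩ := exists_generic (K := AlgebraicClosure F) hp'd
    obtain ⟨z, rfl⟩ := (splitSum ψ p q).surjective y
    have h1 := h z ((mem_symComponent_splitSum ψ).mp hy)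
    rw [stabilizerDim_fixedGroup ψ, stabilizerDim_fixedGroup ψ] at h1
    rw [hyr, splitPoint_apply]
    exact_mod_cast h1
  · intro h z hz
    rw [stabilizerDim_fixedGroup ψ, stabilizerDim_fixedGroup ψ]
    have h1 := h.trans (le_stabRank hp'd ((mem_symComponent_splitSum ψ).mpr hz))
    exact_mod_cast h1

theorem isRegularMat_iff [CharZero F] {m : ℕ} {A : Matrix (Fin m) (Fin m) D} : IsRegularMat F A ↔
    Module.finrank (AlgebraicClosure F) (Subalgebra.centralizer (AlgebraicClosure F)
      {splitMat ψ m A}) ≤ m * d := by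
  have : CharZero (AlgebraicClosure F) := charZero_of_injective_algebraMap (algebraMap F _).injective
  constructor
  · intro h
    have h1 := h ((splitFin ψ m).symm (Matrix.diagonal fun i => ((i : ℕ) : AlgebraicClosure F))) trivial
    rw [stabilizerDim_top ψ, stabilizerDim_top ψ, AlgEquiv.apply_symm_apply,
      finrank_centralizer_diagonal (fun i j hij => Fin.ext (Nat.cast_injective hij))] at h1
    exact_mod_cast h1
  · intro h B _
    rw [stabilizerDim_top ψ, stabilizerDim_top ψ]
    have h1 := h.trans (le_finrank_centralizer (splitFin ψ m B))
    exact_mod_cast h1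

end GeometricPoints

/-! ### Semisimple and regular points over F -/

section Main

variable {F : Type*} [Field F] [CharZero F] {D : Type*} [DivisionRing D] [Algebra F D]
  {d p q p' : ℕ}
  {x : Matrix (Fin p ⊕ Fin q) (Fin p ⊕ Fin q) D}

/-- The factor `w` exists only over the closure, but its consequence `W z² = 0 → W z = 0` descends
along the injection `splitPoint`, so the normal form can be built over `D`. -/
theorem exists_normalForm_of_exists_splitPoint (ψ : (AlgebraicClosure F ⊗[F] D) ≃ₐ[AlgebraicClosure F]
    Matrix (Fin d) (Fin d) (AlgebraicClosure F))
    (hx : x ∈ symSpace D p q)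
    (hw : ∃ w, splitPoint ψ p q x * splitPoint ψ p q x - 1 =
      (splitPoint ψ p q x * splitPoint ψ p q x - 1) * (splitPoint ψ p q x * splitPoint ψ p q x - 1) * w) :
    ∃ (m r t : ℕ) (A : Matrix (Fin m) (Fin m) D), m + r ≤ p ∧ m + t ≤ q ∧ IsUnit (A * A - 1) ∧
      x ∈ conjOrbit (fixedGroup D p q) (xMat p q A r t) := by
  have : CharZero D := charZero_of_injective_algebraMap (algebraMap F D).injective
  obtain ⟨w, hw⟩ := hw
  refine exists_normalForm_of_forall two_ne_zero hx fun W hW => splitPoint_injective ψ ?_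
  have h1 := congrArg (splitPoint ψ p q) hW
  simp only [map_mul, map_sub, map_one, map_zero] at h1 ⊢
  rw [hw, ← mul_assoc, ← mul_assoc, h1, zero_mul]

variable [FiniteDimensional F D]

/-- The `G^θ`-semisimple elements are the conjugates of the matrices `x(A, r, t)`. -/
theorem isThetaSemisimple_iff_exists (ψ : (AlgebraicClosure F ⊗[F] D) ≃ₐ[AlgebraicClosure F]
    Matrix (Fin d) (Fin d) (AlgebraicClosure F))
    (hx : x ∈ symSpace D p q) : IsThetaSemisimple F x ↔
    ∃ (m r t : ℕ) (A : Matrix (Fin m) (Fin m) D), m + r ≤ p ∧ m + t ≤ q ∧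
      IsSemisimpleMat F A ∧ NoEigenvalueOne A ∧
        x ∈ conjOrbit (fixedGroup D p q) (xMat p q A r t) := by
  have : CharZero (AlgebraicClosure F) := charZero_of_injective_algebraMap (algebraMap F _).injective
  have hle : ∀ {m r n : ℕ}, m + r ≤ n → m * d + r * d ≤ n * d := fun h => by
    rw [← add_mul]; exact Nat.mul_le_mul_right d h
  have hclosed : ∀ {m r t : ℕ} {A : Matrix (Fin m) (Fin m) D},
      x ∈ conjOrbit (fixedGroup D p q) (xMat p q A r t) → (IsThetaSemisimple F x ↔
        HasClosedOrbit (AlgebraicClosure F) (fixedGroup (AlgebraicClosure F) (p * d) (q * d))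
          (symSpace (AlgebraicClosure F) (p * d) (q * d))
          (xMat (p * d) (q * d) (splitMat ψ m A) (r * d) (t * d))) := fun h => by
    have h1 := splitPoint_mem_conjOrbit ψ h
    rw [splitPoint_xMat] at h1
    rw [isThetaSemisimple_iff ψ, HasClosedOrbit, HasClosedOrbit, conjOrbit_eq_of_mem h1]
  constructor
  · intro h
    obtain ⟨m, r, t, A, hp, hq, hA, hxA⟩ := exists_normalForm_of_exists_splitPoint ψ hx
      (sub_one_eq_mul_of_hasClosedOrbit two_ne_zero (splitPoint_mem_symSpace ψ hx)
        ((isThetaSemisimple_iff ψ).mp h))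
    -- For `k` over `F`, the implication from `k²(A) = 0` to `k(A) = 0` holds after splitting and
    -- descends by injectivity.
    refine ⟨m, r, t, A, hp, hq, isSemisimpleMat_of_forall fun k hk => splitMat_injective ψ m ?_,
      (noEigenvalueOne_iff F A).mpr hA, hxA⟩
    have h1 := aeval_eq_zero_of_hasClosedOrbit two_ne_zero (hle hp) (hle hq) (isUnit_splitMat ψ hA)
      ((hclosed hxA).mp h) (k := k.map (algebraMap F (AlgebraicClosure F)))
      (by rw [← Polynomial.map_mul, aeval_splitMat_map, hk, map_zero])
    rw [map_zero, ← aeval_splitMat_map, h1]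
  · rintro ⟨m, r, t, A, hp, hq, hA, hAe, hxA⟩
    rw [noEigenvalueOne_iff F] at hAe
    obtain ⟨u1, u2⟩ := (isUnit_mul_self_sub_one_iff A).mp hAe
    have hev : ∀ c : F, (minpoly F A).eval c ≠ 0 →
        ((minpoly F A).map (algebraMap F (AlgebraicClosure F))).eval (algebraMap F _ c) ≠ 0 :=
      fun c hc => by
        rw [eval_map_algebraMap, aeval_algebraMap_apply, coe_aeval_eq_eval]
        exact (_root_.map_ne_zero _).mpr hc
    have e1 := hev 1 (eval_minpoly_ne_zero (by rwa [map_one]))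
    have e2 := hev (-1) (eval_minpoly_ne_zero (by rwa [map_neg, map_one, sub_neg_eq_add]))
    rw [map_one] at e1
    rw [map_neg, map_one] at e2
    rw [hclosed hxA]
    refine hasClosedOrbit_xMat two_ne_zero (hle hp) (hle hq) (Separable.map hA) ?_ e1 e2
    rw [aeval_splitMat_map, minpoly.aeval, map_zero]

theorem isThetaRegularIn_iff_of_mem_conjOrbit (ψ : (AlgebraicClosure F ⊗[F] D) ≃ₐ[AlgebraicClosure F]
    Matrix (Fin d) (Fin d) (AlgebraicClosure F))
    (hd : 0 < d) (hp' : p' ≤ p + q)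
    (hx : x ∈ symComponent D p q p') {m r t : ℕ} {A : Matrix (Fin m) (Fin m) D} (hp : m + r ≤ p)
    (hq : m + t ≤ q) (hA : IsUnit (A * A - 1))
    (hxA : x ∈ conjOrbit (fixedGroup D p q) (xMat p q A r t)) :
    IsThetaRegularIn F p' x ↔
      IsRegularMat F A ∧ m = nu p q p' ∧ r = p - p' ∧ t = p' - p := by
  have : CharZero (AlgebraicClosure F) := charZero_of_injective_algebraMap (algebraMap F _).injective
  have hle : ∀ {m r n : ℕ}, m + r ≤ n → m * d + r * d ≤ n * d := fun h => by
    rw [← add_mul]; exact Nat.mul_le_mul_right d h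
  have hrt : (t : ℤ) - r = p' - p := by
    rw [← xMat_mem_symComponent_iff F hp' hp hq A]
    obtain ⟨g, hg, rfl⟩ := hxA
    refine mem_symComponent_of_mem_conjOrbit hx ⟨g⁻¹, inv_mem hg, ?_⟩
    simp [mul_assoc]
  have hrtd : ((t * d : ℕ) : ℤ) - (r * d : ℕ) = (p' * d : ℕ) - (p * d : ℕ) := by
    push_cast
    rw [← sub_mul, hrt, sub_mul]
  have h1 := splitPoint_mem_conjOrbit ψ hxA
  rw [splitPoint_xMat] at h1
  rw [isThetaRegularIn_iff ψ hp', isRegularMat_iff ψ, stabRank_eq_of_mem_conjOrbit h1, stabRank,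
    finrank_stabilizer_xMat two_ne_zero (hle hp) (hle hq) (isUnit_splitMat ψ hA), Nat.cast_add,
    sum_sq_eq (hle hp) (hle hq) hrtd]
  have hZ := le_finrank_centralizer (splitMat ψ m A)
  have hnu := nu_le hp hq hrt
  have hnud := nu_le (hle hp) (hle hq) hrtd
  rw [nu_mul] at hnud
  have m1 := min_le_mul (p * d - m * d - r * d) (q * d - m * d - t * d)
  have m2 := min_le_mul (r * d) (t * d)
  generalize Module.finrank (AlgebraicClosure F) (Subalgebra.centralizer (AlgebraicClosure F)
    {splitMat ψ m A}) = Z at *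
  constructor
  · intro h
    have h2 : Z + 2 * ((p * d - m * d - r * d) * (q * d - m * d - t * d) + r * d * (t * d)) ≤
        nu p q p' * d := by
      zify
      push_cast at h ⊢
      linarith
    -- The products occur with a factor `2`, while `ν d ≤ m d + min + min` can absorb each of them
    -- only once; so both vanish and `m d = ν d`.
    have h3 : r * d * (t * d) = 0 := by omega
    have h4 : m * d = nu p q p' * d := by omega
    have h5 := Nat.eq_of_mul_eq_mul_right hd h4
    have h6 : r = 0 ∨ t = 0 := by
      simpa [hd.ne'] using h3
    refine ⟨by omega, h5, ?_, ?_⟩ <;> omega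
  · rintro ⟨hZ', rfl, rfl, rfl⟩
    have h2 : (p * d - nu p q p' * d - (p - p') * d) * (q * d - nu p q p' * d - (p' - p) * d) = 0 := by
      rw [← Nat.sub_mul, ← Nat.sub_mul, ← Nat.sub_mul, ← Nat.sub_mul]
      have : p - nu p q p' - (p - p') = 0 ∨ q - nu p q p' - (p' - p) = 0 := by
        unfold nu
        omega
      rcases this with h | h <;> simp [h]
    have h3 : (p - p') * d * ((p' - p) * d) = 0 := by
      have : p - p' = 0 ∨ p' - p = 0 := by omega
      rcases this with h | h <;> simp [h]
    rw [h2, h3]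
    have : (Z : ℤ) ≤ (nu p q p' * d : ℕ) := by exact_mod_cast hZ'
    push_cast at this ⊢
    linarith

end Main

/-! ### The polynomial χ and the three equivalent conditions -/

section Chi

variable {F : Type*} [Field F] {D : Type*} [DivisionRing D] [Algebra F D]
  {d p q p' : ℕ} {x : Matrix (Fin p ⊕ Fin q) (Fin p ⊕ Fin q) D}

theorem map_chiDenominator (F K : Type*) [Field F] [Field K] [Algebra F K] (d p q p' : ℕ) :
    (chiDenominator F d p q p').map (algebraMap F K) =
      (X - 1) ^ (p' * d - q * d) * (X + 1) ^ (p * d - p' * d) := by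
  rw [← Nat.sub_mul, ← Nat.sub_mul, mul_comm _ d, mul_comm _ d, chiDenominator]
  simp

theorem eval_one_map_ne_zero_iff (K : Type*) [Field K] [Algebra F K] (f : F[X]) :
    ((f.map (algebraMap F K)).eval 1 ≠ 0 ∧ (f.map (algebraMap F K)).eval (-1) ≠ 0) ↔
      f.eval 1 ≠ 0 ∧ f.eval (-1) ≠ 0 := by
  have h : ∀ c : F, (f.map (algebraMap F K)).eval (algebraMap F K c) ≠ 0 ↔ f.eval c ≠ 0 := fun c => by
    rw [eval_map_algebraMap, aeval_algebraMap_apply, coe_aeval_eq_eval]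
    exact _root_.map_ne_zero _
  rw [← h 1, ← h (-1), map_neg, map_one]

variable [CharZero F]

/-- The denominator is monic, so the divisibility may be checked over the algebraic closure. -/
theorem chiDenominator_mul_chi (ψ : (AlgebraicClosure F ⊗[F] D) ≃ₐ[AlgebraicClosure F]
    Matrix (Fin d) (Fin d) (AlgebraicClosure F)) (hp' : p' ≤ p + q) (hx : x ∈ symComponent D p q p') :
    chiDenominator F d p q p' * chi F d p' x = reducedCharpoly F d x.toBlocks₁₁ := by
  have : CharZero (AlgebraicClosure F) := charZero_of_injective_algebraMap (algebraMap F _).injective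
  have hmon : (chiDenominator F d p q p').Monic := by
    have h1 : (X - 1 : F[X]).Monic := monic_X_sub_C 1
    have h2 : (X + 1 : F[X]).Monic := monic_X_add_C 1
    exact (h1.pow _).mul (h2.pow _)
  have hdvd : chiDenominator F d p q p' ∣ reducedCharpoly F d x.toBlocks₁₁ := by
    rw [← map_dvd_map (algebraMap F (AlgebraicClosure F)) (algebraMap F _).injective hmon,
      map_reducedCharpoly_eq ψ, map_chiDenominator, ← splitPoint_toBlocks₁₁]
    exact denominator_dvd_charpoly (by rw [← add_mul]; exact Nat.mul_le_mul_right d hp')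
      (splitPoint_mem_symComponent ψ hx)
  have h1 := modByMonic_add_div (reducedCharpoly F d x.toBlocks₁₁) (chiDenominator F d p q p')
  rwa [(modByMonic_eq_zero_iff_dvd hmon).mpr hdvd, zero_add] at h1

theorem charpoly_splitPoint_toBlocks₁₁ (ψ : (AlgebraicClosure F ⊗[F] D) ≃ₐ[AlgebraicClosure F]
    Matrix (Fin d) (Fin d) (AlgebraicClosure F)) (hp' : p' ≤ p + q) (hx : x ∈ symComponent D p q p') :
    (splitPoint ψ p q x).toBlocks₁₁.charpoly = (chi F d p' x).map (algebraMap F (AlgebraicClosure F)) *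
      ((X - 1) ^ (p' * d - q * d) * (X + 1) ^ (p * d - p' * d)) := by
  rw [splitPoint_toBlocks₁₁, ← map_reducedCharpoly_eq ψ, ← chiDenominator_mul_chi ψ hp' hx,
    Polynomial.map_mul, map_chiDenominator, mul_comm]

theorem charpoly_splitPoint_of_mem_conjOrbit (ψ : (AlgebraicClosure F ⊗[F] D) ≃ₐ[AlgebraicClosure F]
    Matrix (Fin d) (Fin d) (AlgebraicClosure F)) {m r t : ℕ} {A : Matrix (Fin m) (Fin m) D}
    (hp : m + r ≤ p) (hxA : x ∈ conjOrbit (fixedGroup D p q) (xMat p q A r t)) :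
    (splitPoint ψ p q x).toBlocks₁₁.charpoly = (splitMat ψ m A).charpoly *
      ((X - 1) ^ (p * d - m * d - r * d) * (X + 1) ^ (r * d)) := by
  have : CharZero (AlgebraicClosure F) := charZero_of_injective_algebraMap (algebraMap F _).injective
  have h1 := splitPoint_mem_conjOrbit ψ hxA
  rw [splitPoint_xMat] at h1
  rw [charpoly_eq_of_mem_conjOrbit
    (toBlocks₁₁_mem_conjOrbit (isUnit_iff_ne_zero.mpr two_ne_zero) h1), xMat,
    Matrix.toBlocks_fromBlocks₁₁,
    charpoly_diagBlock (by rw [← add_mul]; exact Nat.mul_le_mul_right d hp)]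

variable [FiniteDimensional F D]

theorem tfae_chi (ψ : (AlgebraicClosure F ⊗[F] D) ≃ₐ[AlgebraicClosure F]
    Matrix (Fin d) (Fin d) (AlgebraicClosure F)) (hd : 0 < d) (hp' : p' ≤ p + q)
    (hx : x ∈ symComponent D p q p') : List.TFAE [
      ∃ A : Matrix (Fin (nu p q p')) (Fin (nu p q p')) D,
        IsSemisimpleMat F A ∧ IsRegularMat F A ∧ NoEigenvalueOne A ∧
          x ∈ conjOrbit (fixedGroup D p q) (xReg p q p' A),
      (chi F d p' x).Separable ∧ (chi F d p' x).eval 1 ≠ 0 ∧ (chi F d p' x).eval (-1) ≠ 0,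
      IsThetaSemisimpleIn F p' x ∧ IsThetaRegularIn F p' x] := by
  have : CharZero (AlgebraicClosure F) := charZero_of_injective_algebraMap (algebraMap F _).injective
  have hS := symComponent_subset_symSpace p' hx
  have hp'd : p' * d ≤ p * d + q * d := by rw [← add_mul]; exact Nat.mul_le_mul_right d hp'
  have hchar := charpoly_splitPoint_toBlocks₁₁ ψ hp' hx
  have hν1 : nu p q p' + (p - p') ≤ p := by unfold nu; omega
  have hν2 : nu p q p' + (p' - p) ≤ q := by unfold nu; omega
  tfae_have 1 → 2 := by
    rintro ⟨A, hA, hreg, hAe, hxA⟩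
    rw [noEigenvalueOne_iff F] at hAe
    have h1 := charpoly_splitPoint_of_mem_conjOrbit ψ hν1 hxA
    -- The `±1` blocks of `x(A)` contribute exactly the denominator, so `χ_x` is the reduced
    -- characteristic polynomial of `A`.
    have h2 : (chi F d p' x).map (algebraMap F (AlgebraicClosure F)) =
        (splitMat ψ (nu p q p') A).charpoly := by
      rw [hchar, ← Nat.sub_mul, ← Nat.sub_mul, ← Nat.sub_mul, ← Nat.sub_mul,
        show p - nu p q p' - (p - p') = p' - q by unfold nu; omega] at h1
      refine mul_right_cancel₀ (mul_ne_zero (pow_ne_zero _ ?_) (pow_ne_zero _ ?_)) h1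
      · exact X_sub_C_ne_zero 1
      · exact X_add_C_ne_zero 1
    rw [← separable_map (algebraMap F (AlgebraicClosure F)), ← eval_one_map_ne_zero_iff (AlgebraicClosure F), h2]
    refine ⟨separable_charpoly_of_finrank_centralizer_le
      (Separable.map (f := algebraMap F (AlgebraicClosure F)) hA) ?_
      ((isRegularMat_iff ψ).mp hreg), eval_charpoly_ne_zero (isUnit_splitMat ψ hAe)⟩
    rw [aeval_splitMat_map, minpoly.aeval, map_zero]
  tfae_have 2 → 1 := by
    rintro ⟨hsep, hev⟩
    rw [← eval_one_map_ne_zero_iff (AlgebraicClosure F)] at hev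
    obtain ⟨m, r, t, A, hp, hq, hA, hxA⟩ := exists_normalForm_of_exists_splitPoint ψ hS
      (exists_mul_self_sub_one_eq two_ne_zero hp'd (splitPoint_mem_symComponent ψ hx) hev hchar)
    have h1 := charpoly_splitPoint_of_mem_conjOrbit ψ hp hxA
    rw [hchar] at h1
    -- Comparing multiplicities at `±1` determines `m + r` and `r`, hence `m`; the component then
    -- determines `t`.
    obtain ⟨ha, hr, hχ⟩ := eq_of_mul_pow_eq two_ne_zero h1 hev
      (eval_charpoly_ne_zero (isUnit_splitMat ψ hA))
    rw [← Nat.sub_mul, ← Nat.sub_mul, ← Nat.sub_mul] at ha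
    rw [← Nat.sub_mul] at hr
    have ha := Nat.eq_of_mul_eq_mul_right hd ha
    have hr := Nat.eq_of_mul_eq_mul_right hd hr
    have hrt : (t : ℤ) - r = p' - p := by
      rw [← xMat_mem_symComponent_iff F hp' hp hq A]
      obtain ⟨g, hg, rfl⟩ := hxA
      refine mem_symComponent_of_mem_conjOrbit hx ⟨g⁻¹, inv_mem hg, ?_⟩
      simp [mul_assoc]
    obtain rfl : m = nu p q p' := by unfold nu; omega
    obtain rfl : r = p - p' := by omega
    obtain rfl : t = p' - p := by omega
    refine ⟨A, isSemisimpleMat_of_aeval_eq_zero hsep (splitMat_injective ψ _ ?_),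
      (isRegularMat_iff ψ).mpr (finrank_centralizer_of_separable_charpoly ?_).le,
      (noEigenvalueOne_iff F A).mpr hA, hxA⟩
    · rw [← aeval_splitMat_map, hχ, Matrix.aeval_self_charpoly, map_zero]
    · rw [← hχ]
      exact hsep.map
  tfae_have 1 → 3 := by
    rintro ⟨A, hA, hreg, hAe, hxA⟩
    rw [isThetaSemisimpleIn_iff ψ hp' hx, isThetaSemisimple_iff_exists ψ hS,
      isThetaRegularIn_iff_of_mem_conjOrbit ψ hd hp' hx hν1 hν2 ((noEigenvalueOne_iff F A).mp hAe) hxA]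
    exact ⟨⟨_, _, _, A, hν1, hν2, hA, hAe, hxA⟩, hreg, rfl, rfl, rfl⟩
  tfae_have 3 → 1 := by
    rintro ⟨hss, hreg⟩
    rw [isThetaSemisimpleIn_iff ψ hp' hx, isThetaSemisimple_iff_exists ψ hS] at hss
    obtain ⟨m, r, t, A, hp, hq, hA, hAe, hxA⟩ := hss
    rw [isThetaRegularIn_iff_of_mem_conjOrbit ψ hd hp' hx hp hq ((noEigenvalueOne_iff F A).mp hAe)
      hxA] at hreg
    obtain ⟨hregA, rfl, rfl, rfl⟩ := hreg
    exact ⟨A, hA, hregA, hAe, hxA⟩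
  tfae_finish

end Chi

/-! ### Classification of the semisimple classes -/

section Classification

variable {F : Type*} [Field F] [CharZero F] {D : Type*} [DivisionRing D] [Algebra F D]
  [FiniteDimensional F D] {d p q : ℕ}

open Classical in
/-- The map `(m, [A], r, t) ↦ [x(A, r, t)]`, defined through a choice of representatives. -/
noncomputable def classOf (D : Type*) [DivisionRing D] (p q : ℕ)
    (z : Σ m : ℕ, Set (Matrix (Fin m) (Fin m) D) × ℕ × ℕ) :
    Set (Matrix (Fin p ⊕ Fin q) (Fin p ⊕ Fin q) D) :=
  if h : ∃ A, z.2.1 = conjOrbit ⊤ A then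
    conjOrbit (fixedGroup D p q) (xMat p q h.choose z.2.2.1 z.2.2.2) else ∅

theorem classOf_eq (F : Type*) [Field F] [CharZero F] [Algebra F D] {m r t : ℕ} (hp : m + r ≤ p)
    (hq : m + t ≤ q) (A : Matrix (Fin m) (Fin m) D) :
    classOf D p q ⟨m, conjOrbit ⊤ A, r, t⟩ = conjOrbit (fixedGroup D p q) (xMat p q A r t) := by
  have : CharZero D := charZero_of_injective_algebraMap (algebraMap F D).injective
  have h : ∃ B, conjOrbit ⊤ A = conjOrbit ⊤ B := ⟨A, rfl⟩
  refine (dif_pos h).trans (conjOrbit_eq_of_mem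
    (xMat_mem_conjOrbit (isUnit_iff_ne_zero.mpr two_ne_zero) hp hq ?_))
  have h1 := mem_conjOrbit_self ⊤ h.choose
  rwa [← h.choose_spec] at h1

theorem mem_quadruples_iff (F : Type*) [Field F] [Algebra F D] {m r t : ℕ}
    {c : Set (Matrix (Fin m) (Fin m) D)} : ⟨m, c, r, t⟩ ∈ quadruples F D p q ↔
      m + r ≤ p ∧ m + t ≤ q ∧ ∃ A : Matrix (Fin m) (Fin m) D,
        IsSemisimpleMat F A ∧ NoEigenvalueOne A ∧ c = conjOrbit ⊤ A := Iff.rfl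

theorem bijOn_classOf (ψ : (AlgebraicClosure F ⊗[F] D) ≃ₐ[AlgebraicClosure F]
    Matrix (Fin d) (Fin d) (AlgebraicClosure F)) :
    Set.BijOn (classOf D p q) (quadruples F D p q) (semisimpleClasses F D p q) := by
  have : CharZero D := charZero_of_injective_algebraMap (algebraMap F D).injective
  refine ⟨?_, ?_, ?_⟩
  · rintro ⟨m, c, r, t⟩ h
    obtain ⟨hp, hq, A, hA, hAe, rfl⟩ := (mem_quadruples_iff F).mp h
    rw [classOf_eq F hp hq]
    refine ⟨_, xMat_mem_symSpace hp hq A, ?_, rfl⟩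
    rw [isThetaSemisimple_iff_exists ψ (xMat_mem_symSpace hp hq A)]
    exact ⟨m, r, t, A, hp, hq, hA, hAe, mem_conjOrbit_self _ _⟩
  · rintro ⟨m, c, r, t⟩ hz ⟨m', c', r', t'⟩ hz' h
    obtain ⟨hp, hq, A, hA, hAe, rfl⟩ := (mem_quadruples_iff F).mp hz
    obtain ⟨hp', hq', A', hA', hAe', rfl⟩ := (mem_quadruples_iff F).mp hz'
    rw [classOf_eq F hp hq, classOf_eq F hp' hq'] at h
    have h1 : xMat p q A r t ∈ conjOrbit (fixedGroup D p q) (xMat p q A' r' t') := by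
      rw [← h]
      exact mem_conjOrbit_self _ _
    obtain ⟨rfl, rfl, rfl, u, u', hu, hu', huA⟩ := xMat_conj (isUnit_iff_ne_zero.mpr two_ne_zero)
      hp hq hp' hq' ((noEigenvalueOne_iff F A).mp hAe) ((noEigenvalueOne_iff F A').mp hAe') h1
    rw [conjOrbit_eq_of_mem (H := ⊤) (x := A) (y := A') ⟨⟨u, u', hu, hu'⟩, trivial, huA⟩]
  · rintro _ ⟨x, hx, hss, rfl⟩
    obtain ⟨m, r, t, A, hp, hq, hA, hAe, hxA⟩ := (isThetaSemisimple_iff_exists ψ hx).mp hss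
    refine ⟨⟨m, conjOrbit ⊤ A, r, t⟩, ⟨hp, hq, A, hA, hAe, rfl⟩, ?_⟩
    rw [classOf_eq F hp hq, conjOrbit_eq_of_mem hxA]

end Classification

end GLInvolution

open GLInvolution
theorem proposition3p1 {F : Type*} [Field F] [CharZero F] {D : Type*} [DivisionRing D]
    [Algebra F D] [Algebra.IsCentral F D] [FiniteDimensional F D]
    (d : ℕ) (hd : d ^ 2 = Module.finrank F D) (p q : ℕ) :
    -- the three equivalent conditions on `x ∈ S_{p'}(F)`
    (∀ p' : ℕ, p' ≤ p + q → ∀ x ∈ symComponent D p q p',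
      chiDenominator F d p q p' * chi F d p' x = reducedCharpoly F d x.toBlocks₁₁ ∧
      List.TFAE [
        ∃ A : Matrix (Fin (nu p q p')) (Fin (nu p q p')) D,
          IsSemisimpleMat F A ∧ IsRegularMat F A ∧ NoEigenvalueOne A ∧
            x ∈ conjOrbit (fixedGroup D p q) (xReg p q p' A),
        (chi F d p' x).Separable ∧ (chi F d p' x).eval 1 ≠ 0 ∧ (chi F d p' x).eval (-1) ≠ 0,
        IsThetaSemisimpleIn F p' x ∧ IsThetaRegularIn F p' x]) ∧
    -- the `G^θ`-semisimple elements of `S(F)`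
    (∀ x ∈ symSpace D p q, IsThetaSemisimple F x ↔
      ∃ (m r t : ℕ) (A : Matrix (Fin m) (Fin m) D), m + r ≤ p ∧ m + t ≤ q ∧
        IsSemisimpleMat F A ∧ NoEigenvalueOne A ∧
          x ∈ conjOrbit (fixedGroup D p q) (xMat p q A r t)) ∧
    -- the classification of their classes, by `(m, [A], r, t) ↦ [x(A, r, t)]`
    (∃ Φ : (Σ m : ℕ, Set (Matrix (Fin m) (Fin m) D) × ℕ × ℕ) →
        Set (Matrix (Fin p ⊕ Fin q) (Fin p ⊕ Fin q) D),
      Set.BijOn Φ (quadruples F D p q) (semisimpleClasses F D p q) ∧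
      ∀ (m r t : ℕ) (A : Matrix (Fin m) (Fin m) D), m + r ≤ p → m + t ≤ q →
        IsSemisimpleMat F A → NoEigenvalueOne A →
          Φ ⟨m, conjOrbit ⊤ A, r, t⟩ = conjOrbit (fixedGroup D p q) (xMat p q A r t)) ∧
    -- the component of `S` that contains `x(A, r, t)`
    (∀ p' : ℕ, p' ≤ p + q → ∀ (m r t : ℕ) (A : Matrix (Fin m) (Fin m) D),
      m + r ≤ p → m + t ≤ q →
        (xMat p q A r t ∈ symComponent D p q p' ↔ (t : ℤ) - r = (p' : ℤ) - p)) := by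
  obtain ⟨ψ⟩ := exists_splitting F (AlgebraicClosure F) D d hd
  have hd0 : 0 < d := Nat.pos_of_ne_zero fun h => by
    rw [h, zero_pow two_ne_zero] at hd
    exact Module.finrank_pos.ne hd
  exact ⟨fun p' hp' x hx => ⟨chiDenominator_mul_chi ψ hp' hx, tfae_chi ψ hd0 hp' hx⟩,
    fun x hx => isThetaSemisimple_iff_exists ψ hx,
    ⟨classOf D p q, bijOn_classOf ψ, fun m r t A hp hq _ _ => classOf_eq F hp hq A⟩,
    fun p' hp' m r t A hp hq => xMat_mem_symComponent_iff F hp' hp hq A⟩
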